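/- Let $Q_n$ be the hypercube graph with vertex set $\{0,1\}^n$, two vertices being adjacent if they differ in exactly one coordinate. A bond percolation model on a graph $G$ is a probability distribution on the spanning subgraphs of $G$ (the edges present are called open). It is 1-independent if, for any two sets of edges $S_1,S_2$ such that no edge of $S_1$ shares a vertex with an edge of $S_2$, the states (open or closed) of the edges in $S_1$ are independent of the states of the edges in $S_2$. Let $\mathcal D_{\ge p}(G)$ be the class of 1-independent bond percolation models on $G$ in which each edge is open with probability at least $p$. Let $\varphi=\frac12(1+\sqrt5)$. **Theorem.** (a) Let $p\in(0,1]$, let $k\ge 1$ be an integer, and let $P>(1-p)^{2^{k-1}}\varphi$. Suppose that for every model in $\mathcal D_{\ge p}(Q_k)$ the probability that the random subgraph is connected is at least $P$. Then there exist constants $C>0$ and $c>0$ such that for every $n\ge 0$ and every model in $\mathcal D_{\ge p}(Q_n)$, the random subgraph has a component containing at least $C\cdot 2^n$ vertices with probability at least $1-e^{-cn^2}$. (b) Let $$p_{\mathrm{giant}}=\inf\Big\{p\in[0,1]:\ \exists C>0\ \text{such that}\ \lim_{n\to\infty}\ \inf_{\mu\in\mathcal D_{\ge p}(Q_n)}\mathbb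 P_\mu\big(Q_n\text{ has a component of size at least } C\cdot 2^n\big)=1\Big\}.$$ The set on the right is non-empty, and $p_{\mathrm{giant}}\le 0.5847$. -/

import Mathlib

open MeasureTheory ProbabilityTheory Filter Topology

/-- A configuration of a bond percolation model on `G`: each edge of `G` is open (`true`) or
closed (`false`). Configurations correspond to the spanning subgraphs of `G`; the space carries the
product `σ`-algebra. -/
abbrev EdgeConfig {V : Type*} (G : SimpleGraph V) : Type _ := G.edgeSet → Bool

/-- The spanning subgraph of `G` formed by the open edges of a configuration. -/
def openSubgraph {V : Type*} (G : SimpleGraph V) (ω : EdgeConfig G) : SimpleGraph V where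
  Adj u v := ∃ h : s(u, v) ∈ G.edgeSet, ω ⟨s(u, v), h⟩ = true
  symm := ⟨fun u v huv => by rw [Sym2.eq_swap]; exact huv⟩
  loopless := ⟨fun v hv => G.irrefl (G.mem_edgeSet.1 hv.1)⟩

/-- No edge in `S₁` shares a vertex with an edge in `S₂`. -/
def VertexDisjoint {V : Type*} {G : SimpleGraph V} (S₁ S₂ : Set G.edgeSet) : Prop :=
  ∀ e₁ ∈ S₁, ∀ e₂ ∈ S₂, ∀ v : V, v ∈ (e₁ : Sym2 V) → v ∉ (e₂ : Sym2 V)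

/-- The class `𝒟_{≥ p}(G)` of 1-independent bond percolation models on `G` in which each edge is
open with probability at least `p`: probability distributions `μ` on the configurations such that
the states of the edges in `S₁` are independent of the states of the edges in `S₂` whenever no edge
in `S₁` shares a vertex with an edge in `S₂`. -/
structure IsOneIndepModel {V : Type*} (G : SimpleGraph V) (p : ℝ)
    (μ : Measure (EdgeConfig G)) : Prop where
  isProbabilityMeasure : IsProbabilityMeasure μ
  indep : ∀ S₁ S₂ : Set G.edgeSet, VertexDisjoint S₁ S₂ →
    IndepFun (fun (ω : EdgeConfig G) (e : S₁) => ω e) (fun (ω : EdgeConfig G) (e : S₂) => ω e) μ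
  le_prob_open : ∀ e : G.edgeSet, p ≤ μ.real {ω | ω e = true}

/-- The hypercube graph `Q_n`: vertex set `{0,1}^n`, and two vertices are adjacent if they differ in
exactly one coordinate. -/
def hypercube (n : ℕ) : SimpleGraph (Fin n → Bool) where
  Adj u v := ∃! i, u i ≠ v i
  symm := ⟨fun u v huv => by simpa only [ne_comm] using huv⟩
  loopless := ⟨fun v hv => by obtain ⟨i, hi, -⟩ := hv; exact hi rfl⟩

/-- The event that the random spanning subgraph of `Q_n` is connected. -/
def connectedEvent (n : ℕ) : Set (EdgeConfig (hypercube n)) :=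
  {ω | (openSubgraph (hypercube n) ω).Connected}

/-- The event that the random spanning subgraph of `Q_n` has a component with at least `C * 2 ^ n`
vertices. -/
def giantEvent (n : ℕ) (C : ℝ) : Set (EdgeConfig (hypercube n)) :=
  {ω | ∃ c : (openSubgraph (hypercube n) ω).ConnectedComponent,
    C * 2 ^ n ≤ (c.supp.ncard : ℝ)}

/-- The probabilities `p` for which there is `C > 0` such that the infimum, over all models in
`𝒟_{≥ p}(Q_n)`, of the probability of a component of size at least `C * 2 ^ n` tends to `1`. -/
def giantSet : Set ℝ :=
  {p | p ∈ Set.Icc (0 : ℝ) 1 ∧ ∃ C : ℝ, 0 < C ∧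
    Tendsto (fun n : ℕ =>
      ⨅ μ : {μ : Measure (EdgeConfig (hypercube n)) // IsOneIndepModel (hypercube n) p μ},
        μ.1.real (giantEvent n C)) atTop (𝓝 1)}

/-- The threshold `p_giant` for the asymptotically almost sure existence of a giant component in
`Q_n` under every model in `𝒟_{≥ p}(Q_n)`. -/
noncomputable def pGiant : ℝ := sInf giantSet

noncomputable section
open scoped Classical
set_option linter.unusedSectionVars false

/-! Put `q = (1 - p) ^ 2 ^ (k - 1)` and cut the hypercube into parallel copies of `Q_k`. A block is
good if it is connected, which has probability at least `P`. Adjacent blocks are joined by `2 ^ k`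
vertex-disjoint, hence independent, edges, so they are both good and unlinked with probability at
most `Q = q ^ 2`. For `P > 0` the hypothesis `P > q φ` says that `P (P - q) > q ^ 2`; hence some `α`
slightly above `q` satisfies both `Q < (P - α) P` and `Q < α ^ 2`. These two inequalities carry the
local argument. The blocks form a field whose restrictions to disjoint sets of sites are independent
(`SiteBond`), and every locally defined coarser field inherits this property (`SiteBond.derive`).

The inequality `Q < (P - α) P` creates clusters (`sum_noLargeCluster_le`). In a star-shaped cube a
hub has `r` leaves and a leaf lies below `R` hubs; for `R` much larger than `r`, leaves are much
rarer than hubs. Reveal the hubs one at a time, keeping a small random set of test directions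
hidden. A hub that joins two explored clusters lowers the number of clusters of leaves, so this
happens for few hubs only. Suppose that a good hub joins no two clusters and that no explored
cluster contains a proportion `α` of its leaves. It is then linked to at most a proportion `α` of
them, while about `P` of them are good, so about `P - α` are unlinked to it, and the test directions
display the same proportion. The test sites are independent of the explored past, so given the past
the expected proportion is at most `Q`. Since the hub is good with probability `P`, such pasts are
rare, and most hubs have a cluster containing a proportion `α` of their leaves.

The inequality `Q < α ^ 2` glues clusters. If a cluster is chosen in one slice and a second one
inside it in a parallel slice, a proportion `α ^ 2` of the directions survives, more than the
proportion `Q` of unlinked parallel pairs, so the clusters are linked (`exists_link`). In a product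
of two star-shaped cubes the same count, made over columns, joins a horizontal cluster to a vertical
one (`crossJoin_of`). Changing hubs one coordinate at a time, and exchanging the factors, gives one
giant cluster that meets most local ones; the giant clusters of two adjacent copies of the product
are joined with probability close to one (`exists_copiesJoined`).

The copies are the vertices of a cube of dimension `3 * m`, with `n - 3 * m` bounded, and its bonds
are present with probability close to one. In a product of two cubes of dimension `m`, short detours
and a union bound give a dense connected set outside an event of probability `exp (-(s * m))`. In
the product with a third cube, the slices over the neighbours of a vertex are independent, so a
tenth of them fail together with probability `exp (-c * m ^ 2)`; this is the source of the exponent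
`n ^ 2`.

For the threshold take `k = 3` and `p = 0.5847`: it suffices that `Q_3` is connected with
probability at least `0.0485`. This is proved by linear programming duality. Multipliers that depend
only on edges disjoint from a given edge cost nothing in expectation, and one nonlinear constraint
is added, the independence of two opposite faces. Three certificates cover all values of the face
statistics. -/

/-- A probability distribution on a finite type, given by its weights. -/
structure FinProb (Ω : Type*) [Fintype Ω] where
  w : Ω → ℝ
  nonneg : ∀ ω, 0 ≤ w ω
  total : ∑ ω, w ω = 1

/-! ### Finite probability spaces and Chernoff bounds -/

namespace FinProb

variable {Ω : Type*} [Fintype Ω] (π : FinProb Ω)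

/-- Expectation. -/
def E (f : Ω → ℝ) : ℝ := ∑ ω, π.w ω * f ω

/-- Probability of an event. -/
def Pr (p : Ω → Prop) : ℝ := π.E (fun ω => if p ω then 1 else 0)

theorem E_mono {f g : Ω → ℝ} (h : ∀ ω, f ω ≤ g ω) : π.E f ≤ π.E g :=
  Finset.sum_le_sum fun ω _ => mul_le_mul_of_nonneg_left (h ω) (π.nonneg ω)

theorem E_const (c : ℝ) : π.E (fun _ => c) = c := by
  simp [E, ← Finset.sum_mul, π.total]

theorem E_add (f g : Ω → ℝ) : π.E (fun ω => f ω + g ω) = π.E f + π.E g := by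
  simp [E, mul_add, Finset.sum_add_distrib]

theorem E_sub (f g : Ω → ℝ) : π.E (fun ω => f ω - g ω) = π.E f - π.E g := by
  simp [E, mul_sub, Finset.sum_sub_distrib]

theorem E_mul_left (c : ℝ) (f : Ω → ℝ) : π.E (fun ω => c * f ω) = c * π.E f := by
  simp only [E, Finset.mul_sum]
  exact Finset.sum_congr rfl fun _ _ => by ring

theorem E_mul_right (c : ℝ) (f : Ω → ℝ) : π.E (fun ω => f ω * c) = π.E f * c := by
  simp only [E, Finset.sum_mul]
  exact Finset.sum_congr rfl fun _ _ => by ring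

theorem E_sum {ι : Type*} (s : Finset ι) (f : ι → Ω → ℝ) :
    π.E (fun ω => ∑ i ∈ s, f i ω) = ∑ i ∈ s, π.E (f i) := by
  simp only [E, Finset.mul_sum]
  exact Finset.sum_comm

theorem E_nonneg {f : Ω → ℝ} (h : ∀ ω, 0 ≤ f ω) : 0 ≤ π.E f :=
  Finset.sum_nonneg fun ω _ => mul_nonneg (π.nonneg ω) (h ω)

theorem E_le_const {f : Ω → ℝ} {c : ℝ} (h : ∀ ω, f ω ≤ c) : π.E f ≤ c :=
  (π.E_mono h).trans (π.E_const c).le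

theorem Pr_nonneg (p : Ω → Prop) : 0 ≤ π.Pr p :=
  π.E_nonneg fun ω => by split_ifs <;> norm_num

theorem Pr_mono {p q : Ω → Prop} (h : ∀ ω, p ω → q ω) : π.Pr p ≤ π.Pr q :=
  π.E_mono fun ω => by
    by_cases hp : p ω
    · simp [hp, h ω hp]
    · simp only [hp, if_false]; split_ifs <;> norm_num

theorem Pr_le_one (p : Ω → Prop) : π.Pr p ≤ 1 :=
  π.E_le_const fun ω => by split_ifs <;> norm_num

theorem Pr_or (p q : Ω → Prop) : π.Pr (fun ω => p ω ∨ q ω) ≤ π.Pr p + π.Pr q := by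
  rw [Pr, Pr, Pr, ← E_add]
  refine π.E_mono fun ω => ?_
  by_cases hp : p ω <;> by_cases hq : q ω <;> simp [hp, hq]

theorem Pr_le_add {p q s : Ω → Prop} (h : ∀ ω, p ω → q ω ∨ s ω) : π.Pr p ≤ π.Pr q + π.Pr s :=
  (π.Pr_mono h).trans (π.Pr_or q s)

theorem Pr_not (p : Ω → Prop) : π.Pr (fun ω => ¬ p ω) = 1 - π.Pr p := by
  have h := π.E_sub (fun _ => 1) (fun ω => if p ω then 1 else 0)
  rw [π.E_const] at h
  rw [Pr, Pr, ← h]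
  congr 1; ext ω
  by_cases hp : p ω <;> simp [hp]

theorem Pr_exists_le {ι : Type*} (s : Finset ι) (p : ι → Ω → Prop) :
    π.Pr (fun ω => ∃ i ∈ s, p i ω) ≤ ∑ i ∈ s, π.Pr (p i) := by
  simp only [Pr]
  rw [← E_sum]
  refine π.E_mono fun ω => ?_
  have hn : ∀ i ∈ s, (0 : ℝ) ≤ if p i ω then 1 else 0 := fun i _ => by split_ifs <;> norm_num
  by_cases h : ∃ i ∈ s, p i ω
  · obtain ⟨i, hi, hp⟩ := h
    have := Finset.single_le_sum hn hi
    rw [if_pos hp] at this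
    rwa [if_pos ⟨i, hi, hp⟩]
  · rw [if_neg h]; exact Finset.sum_nonneg hn

theorem markov {X : Ω → ℝ} (h0 : ∀ ω, 0 ≤ X ω) (a : ℝ) :
    a * π.Pr (fun ω => a ≤ X ω) ≤ π.E X := by
  rw [Pr, ← E_mul_left]
  refine π.E_mono fun ω => ?_
  split_ifs with h
  · simpa using h
  · simpa using h0 ω

theorem E_card {ι : Type*} (s : Finset ι) (p : ι → Ω → Prop) :
    π.E (fun ω => ((s.filter fun i => p i ω).card : ℝ)) = ∑ i ∈ s, π.Pr (p i) := by
  simp only [Pr]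
  rw [← E_sum]
  congr 1; ext ω
  rw [Finset.card_filter]; push_cast; rfl

/-- The Chernoff bound for sums of `[0,1]`-valued variables whose exponentials multiply in
expectation. -/
theorem chernoff {ι : Type*} (s : Finset ι) (X : ι → Ω → ℝ) (q : ι → ℝ)
    (h0 : ∀ i ∈ s, ∀ ω, 0 ≤ X i ω) (h1 : ∀ i ∈ s, ∀ ω, X i ω ≤ 1)
    (hE : ∀ i ∈ s, π.E (X i) ≤ q i) (hq : ∀ i ∈ s, q i ≤ 1)
    (hprod : ∀ t : ℝ, π.E (fun ω => ∏ i ∈ s, Real.exp (t * X i ω)) =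
      ∏ i ∈ s, π.E (fun ω => Real.exp (t * X i ω)))
    {κ : ℝ} (hκ : 0 ≤ κ) (hκ1 : κ ≤ 1) :
    π.Pr (fun ω => ∑ i ∈ s, q i + κ * s.card ≤ ∑ i ∈ s, X i ω) ≤
      Real.exp (-(κ ^ 2 / 4) * s.card) := by
  -- This value minimizes the exponent `t ^ 2 - κ * t` per term, with minimum `-κ ^ 2 / 4`.
  set t := κ / 2 with ht
  have ht0 : 0 ≤ t := by positivity
  have ht1 : t ≤ 1 := by linarith
  have hexp : Real.exp t - 1 ≤ t + t ^ 2 := by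
    have := Real.abs_exp_sub_one_sub_id_le (x := t) (by rw [abs_of_nonneg ht0]; exact ht1)
    have := (abs_le.1 this).2
    linarith
  have hexp0 : 0 ≤ Real.exp t - 1 := by have := Real.add_one_le_exp t; linarith
  have hX : ∀ i ∈ s, π.E (fun ω => Real.exp (t * X i ω)) ≤ Real.exp (t * q i + t ^ 2) := by
    intro i hi
    have h2 : π.E (fun ω => Real.exp (t * X i ω)) ≤ 1 + π.E (X i) * (Real.exp t - 1) := by
      rw [← E_mul_right, ← π.E_const 1, ← E_add]
      refine π.E_mono fun ω => ?_
      rw [π.E_const]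
      -- On `[0, 1]` the function `exp (t * x)` lies below its chord `1 + x * (exp t - 1)`.
      have hc := convexOn_exp.2 (Set.mem_univ 0) (Set.mem_univ t)
        (sub_nonneg.2 (h1 i hi ω)) (h0 i hi ω) (by ring)
      simp only [smul_eq_mul, mul_zero, zero_add, Real.exp_zero, mul_one] at hc
      rw [mul_comm t]
      linarith
    have h3 : 1 + π.E (X i) * (Real.exp t - 1) ≤ 1 + (t * q i + t ^ 2) := by
      have hE0 : 0 ≤ π.E (X i) := π.E_nonneg (h0 i hi)
      have a1 := mul_le_mul_of_nonneg_left hexp hE0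
      have a2 := mul_le_mul_of_nonneg_right (hE i hi) ht0
      have a3 := mul_le_mul_of_nonneg_right ((hE i hi).trans (hq i hi)) (sq_nonneg t)
      nlinarith
    refine h2.trans (h3.trans ?_)
    have := Real.add_one_le_exp (t * q i + t ^ 2)
    linarith
  have hm := π.markov (X := fun ω => ∏ i ∈ s, Real.exp (t * X i ω))
    (fun ω => Finset.prod_nonneg fun i _ => (Real.exp_pos _).le)
    (Real.exp (t * (∑ i ∈ s, q i + κ * s.card)))
  rw [hprod] at hm
  have hle : ∏ i ∈ s, π.E (fun ω => Real.exp (t * X i ω)) ≤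
      Real.exp (t * ∑ i ∈ s, q i + t ^ 2 * s.card) := by
    refine (Finset.prod_le_prod (fun i _ => π.E_nonneg fun ω => (Real.exp_pos _).le) hX).trans ?_
    rw [← Real.exp_sum, Finset.sum_add_distrib, ← Finset.mul_sum, Finset.sum_const, nsmul_eq_mul,
      mul_comm (s.card : ℝ)]
  have hev : π.Pr (fun ω => ∑ i ∈ s, q i + κ * s.card ≤ ∑ i ∈ s, X i ω) ≤
      π.Pr (fun ω => Real.exp (t * (∑ i ∈ s, q i + κ * s.card)) ≤
        ∏ i ∈ s, Real.exp (t * X i ω)) := by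
    refine π.Pr_mono fun ω hω => ?_
    rw [← Real.exp_sum, ← Finset.mul_sum]
    exact Real.exp_le_exp.2 (mul_le_mul_of_nonneg_left hω ht0)
  refine hev.trans ?_
  have hpos := Real.exp_pos (t * (∑ i ∈ s, q i + κ * s.card))
  have := (le_div_iff₀' hpos).2 (hm.trans hle)
  refine this.trans ?_
  rw [← Real.exp_sub]
  refine (Real.exp_le_exp.2 ?_)
  rw [ht]; ring_nf; exact le_refl _

/-- The product of Bernoulli measures of parameter `γ`. -/
def bernoulli {J : Type*} [Fintype J] (γ : ℝ) (h0 : 0 ≤ γ) (h1 : γ ≤ 1) : FinProb (J → Bool) where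
  w c := ∏ j, if c j then γ else 1 - γ
  nonneg c := Finset.prod_nonneg fun j _ => by split_ifs <;> linarith
  total := by
    have := Finset.prod_univ_sum (R := ℝ) (fun _ : J => (Finset.univ : Finset Bool))
      (fun _ b => if b then γ else 1 - γ)
    rw [Fintype.piFinset_univ] at this
    rw [← this]
    simp

theorem bernoulli_prod {J : Type*} [Fintype J] (γ : ℝ) (h0 : 0 ≤ γ) (h1 : γ ≤ 1)
    (f : J → Bool → ℝ) :
    (bernoulli (J := J) γ h0 h1).E (fun c => ∏ j, f j (c j)) =
      ∏ j, (γ * f j true + (1 - γ) * f j false) := by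
  have := Finset.prod_univ_sum (R := ℝ) (fun _ : J => (Finset.univ : Finset Bool))
      (fun j b => (if b then γ else 1 - γ) * f j b)
  rw [Fintype.piFinset_univ] at this
  simp only [E, bernoulli, ← Finset.prod_mul_distrib]
  rw [← this]
  simp

theorem bernoulli_prod_finset {J : Type*} [Fintype J] (γ : ℝ) (h0 : 0 ≤ γ) (h1 : γ ≤ 1)
    (s : Finset J) (f : J → Bool → ℝ) :
    (bernoulli (J := J) γ h0 h1).E (fun c => ∏ j ∈ s, f j (c j)) =
      ∏ j ∈ s, (γ * f j true + (1 - γ) * f j false) := by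
  have := bernoulli_prod γ h0 h1 (fun j b => if j ∈ s then f j b else 1)
  simp only [Finset.prod_ite_mem, Finset.univ_inter] at this
  rw [this, ← Finset.prod_subset (Finset.subset_univ s)]
  · exact Finset.prod_congr rfl fun j hj => by simp [hj]
  · intro j _ hj; simp [hj]

theorem bernoulli_single {J : Type*} [Fintype J] (γ : ℝ) (h0 : 0 ≤ γ) (h1 : γ ≤ 1)
    (j : J) (f : Bool → ℝ) :
    (bernoulli (J := J) γ h0 h1).E (fun c => f (c j)) = γ * f true + (1 - γ) * f false := by
  simpa using bernoulli_prod_finset γ h0 h1 {j} (fun _ => f)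

/-- Chernoff bound for Bernoulli products. -/
theorem bernoulli_chernoff {J : Type*} [Fintype J] (γ : ℝ) (h0 : 0 ≤ γ) (h1 : γ ≤ 1)
    (s : Finset J) (f : J → Bool → ℝ) (hf0 : ∀ j b, 0 ≤ f j b) (hf1 : ∀ j b, f j b ≤ 1)
    {κ : ℝ} (hκ : 0 ≤ κ) (hκ1 : κ ≤ 1) :
    (bernoulli (J := J) γ h0 h1).Pr (fun c =>
      ∑ j ∈ s, (γ * f j true + (1 - γ) * f j false) + κ * s.card ≤ ∑ j ∈ s, f j (c j)) ≤
      Real.exp (-(κ ^ 2 / 4) * s.card) := by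
  refine (bernoulli (J := J) γ h0 h1).chernoff s (fun j c => f j (c j)) _ (fun j _ c => hf0 _ _) (fun j _ c => hf1 _ _)
    (fun j _ => (bernoulli_single γ h0 h1 j (f j)).le) (fun j _ => ?_) (fun t => ?_) hκ hκ1
  · nlinarith [hf1 j true, hf1 j false]
  · rw [bernoulli_prod_finset γ h0 h1 s (fun j b => Real.exp (t * f j b))]
    exact Finset.prod_congr rfl fun j _ =>
      (bernoulli_single γ h0 h1 j (fun b => Real.exp (t * f j b))).symm

end FinProb

/-! ### Random relations with independence over disjoint sets -/

/-- Two outcomes agree on `A`: the random relation `R` restricted to `A` is the same. -/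
def AgreeOn {Ω V : Type*} (R : Ω → V → V → Prop) (A : Set V) (ω ω' : Ω) : Prop :=
  ∀ u ∈ A, ∀ v ∈ A, (R ω u v ↔ R ω' u v)

/-- `f` is determined by the random relation `R` restricted to `A`. -/
def DeterminedBy {Ω V β : Type*} (R : Ω → V → V → Prop) (A : Set V) (f : Ω → β) : Prop :=
  ∀ ω ω', AgreeOn R A ω ω' → f ω = f ω'

/-- A random symmetric relation on `V` whose restrictions to disjoint sets are independent.
A site `v` is good when it is related to itself. -/
structure SiteBond {Ω : Type*} [Fintype Ω] (π : FinProb Ω) (V : Type*) where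
  R : Ω → V → V → Prop
  symm : ∀ ω u v, R ω u v → R ω v u
  left : ∀ ω u v, R ω u v → R ω u u
  indep : ∀ A B : Set V, Disjoint A B → ∀ f g : Ω → ℝ, DeterminedBy R A f → DeterminedBy R B g →
    π.E (fun ω => f ω * g ω) = π.E f * π.E g

theorem AgreeOn.mono {Ω V : Type*} {R : Ω → V → V → Prop} {A B : Set V} (h : A ⊆ B) {ω ω' : Ω}
    (hB : AgreeOn R B ω ω') : AgreeOn R A ω ω' :=
  fun u hu v hv => hB u (h hu) v (h hv)

theorem DeterminedBy.comp {Ω V β γ : Type*} {R : Ω → V → V → Prop} {A : Set V}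
    {f : Ω → β} (hf : DeterminedBy R A f) (g : β → γ) : DeterminedBy R A (fun ω => g (f ω)) :=
  fun ω ω' h => congrArg g (hf ω ω' h)

theorem determinedBy_rel {Ω V : Type*} (R : Ω → V → V → Prop) {A : Set V} {u v : V} (hu : u ∈ A)
    (hv : v ∈ A) : DeterminedBy R A (fun ω => R ω u v) :=
  fun _ _ h => propext (h u hu v hv)

/-- The sites `u` and `v` are joined by a path of related sites in `A`. -/
def ReachIn {V : Type*} (ρ : V → V → Prop) (A : Set V) : V → V → Prop :=
  Relation.TransGen (fun a b => a ∈ A ∧ b ∈ A ∧ ρ a b)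

namespace ReachIn

variable {V : Type*} {ρ : V → V → Prop} {A B : Set V} {u v w : V}

theorem single (hu : u ∈ A) (hv : v ∈ A) (h : ρ u v) : ReachIn ρ A u v :=
  Relation.TransGen.single ⟨hu, hv, h⟩

theorem trans (h : ReachIn ρ A u v) (h' : ReachIn ρ A v w) : ReachIn ρ A u w :=
  Relation.TransGen.trans h h'

theorem symm (hs : ∀ a b, ρ a b → ρ b a) (h : ReachIn ρ A u v) : ReachIn ρ A v u := by
  induction h with
  | single h => exact single h.2.1 h.1 (hs _ _ h.2.2)
  | tail _ h ih => exact (single h.2.1 h.1 (hs _ _ h.2.2)).trans ih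

theorem mono (hAB : A ⊆ B) (h : ReachIn ρ A u v) : ReachIn ρ B u v :=
  Relation.TransGen.mono (fun _ _ h => ⟨hAB h.1, hAB h.2.1, h.2.2⟩) _ _ h

end ReachIn

theorem determinedBy_reachIn {Ω V : Type*} (R : Ω → V → V → Prop) (A : Set V) :
    DeterminedBy R A (fun ω => ReachIn (R ω) A) := by
  intro ω ω' h
  refine congrArg Relation.TransGen ?_
  ext a b
  constructor
  · rintro ⟨ha, hb, hr⟩; exact ⟨ha, hb, (h a ha b hb).1 hr⟩
  · rintro ⟨ha, hb, hr⟩; exact ⟨ha, hb, (h a ha b hb).2 hr⟩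

namespace SiteBond

variable {Ω : Type*} [Fintype Ω] {π : FinProb Ω} {V : Type*} (S : SiteBond π V)

/-- `f` is determined by the field on `A`. -/
abbrev Det {β : Type*} (A : Set V) (f : Ω → β) : Prop := DeterminedBy S.R A f

theorem right (ω : Ω) {u v : V} (h : S.R ω u v) : S.R ω v v := S.left ω v u (S.symm ω u v h)

theorem reach_symm {ω : Ω} {A : Set V} {u v : V} (h : ReachIn (S.R ω) A u v) :
    ReachIn (S.R ω) A v u := h.symm (S.symm ω)

theorem reach_good_left {ω : Ω} {A : Set V} {u v : V} (h : ReachIn (S.R ω) A u v) :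
    S.R ω u u := by
  induction h with
  | single h => exact S.left _ _ _ h.2.2
  | tail _ _ ih => exact ih

theorem indep_pr {A B : Set V} (hAB : Disjoint A B) {p q : Ω → Prop} (hp : S.Det A p)
    (hq : S.Det B q) : π.Pr (fun ω => p ω ∧ q ω) = π.Pr p * π.Pr q := by
  have := S.indep A B hAB _ _ (hp.comp fun p => if p then (1 : ℝ) else 0)
    (hq.comp fun p => if p then (1 : ℝ) else 0)
  rw [FinProb.Pr, FinProb.Pr, FinProb.Pr, ← this]
  congr 1; ext ω
  by_cases h1 : p ω <;> by_cases h2 : q ω <;> simp [h1, h2]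

/-- Functions of the field on pairwise disjoint sets multiply in expectation. -/
theorem indep_prod {ι : Type*} (s : Finset ι) (A : ι → Set V)
    (hA : ∀ i ∈ s, ∀ j ∈ s, i ≠ j → Disjoint (A i) (A j)) (f : ι → Ω → ℝ)
    (hf : ∀ i ∈ s, S.Det (A i) (f i)) :
    π.E (fun ω => ∏ i ∈ s, f i ω) = ∏ i ∈ s, π.E (f i) := by
  induction s using Finset.induction_on with
  | empty => simpa using π.E_const 1
  | insert a s ha ih =>
    simp only [Finset.prod_insert ha]
    rw [← ih (fun i hi j hj => hA i (Finset.mem_insert_of_mem hi) j (Finset.mem_insert_of_mem hj))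
      (fun i hi => hf i (Finset.mem_insert_of_mem hi))]
    refine S.indep (A a) (⋃ i ∈ s, A i) ?_ _ _ (hf a (Finset.mem_insert_self a s)) ?_
    · refine Set.disjoint_iUnion₂_right.2 fun i hi => ?_
      exact hA a (Finset.mem_insert_self a s) i (Finset.mem_insert_of_mem hi)
        (fun h => ha (h ▸ hi))
    · intro ω ω' h
      exact Finset.prod_congr rfl fun i hi =>
        hf i (Finset.mem_insert_of_mem hi) ω ω' (h.mono (Set.subset_biUnion_of_mem hi))

theorem chernoff {ι : Type*} (s : Finset ι) (A : ι → Set V)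
    (hA : ∀ i ∈ s, ∀ j ∈ s, i ≠ j → Disjoint (A i) (A j)) (X : ι → Ω → ℝ)
    (hX : ∀ i ∈ s, S.Det (A i) (X i))
    (h0 : ∀ i ∈ s, ∀ ω, 0 ≤ X i ω) (h1 : ∀ i ∈ s, ∀ ω, X i ω ≤ 1) {q : ℝ} (hq : q ≤ 1)
    (hE : ∀ i ∈ s, π.E (X i) ≤ q) {κ : ℝ} (hκ : 0 ≤ κ) (hκ1 : κ ≤ 1) :
    π.Pr (fun ω => (q + κ) * s.card ≤ ∑ i ∈ s, X i ω) ≤ Real.exp (-(κ ^ 2 / 4) * s.card) := by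
  have := π.chernoff s X (fun _ => q) h0 h1 hE (fun _ _ => hq)
    (fun t => S.indep_prod s A hA _ fun i hi => (hX i hi).comp fun x => Real.exp (t * x)) hκ hκ1
  refine le_trans (π.Pr_mono fun ω h => ?_) this
  rw [Finset.sum_const, nsmul_eq_mul]
  linarith

theorem chernoff_card {ι : Type*} (s : Finset ι) (A : ι → Set V)
    (hA : ∀ i ∈ s, ∀ j ∈ s, i ≠ j → Disjoint (A i) (A j)) (p : ι → Ω → Prop)
    (hp : ∀ i ∈ s, S.Det (A i) (p i)) {q : ℝ} (hq : q ≤ 1)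
    (hE : ∀ i ∈ s, π.Pr (p i) ≤ q) {κ : ℝ} (hκ : 0 ≤ κ) (hκ1 : κ ≤ 1) :
    π.Pr (fun ω => (q + κ) * s.card ≤ ((s.filter fun i => p i ω).card : ℝ)) ≤
      Real.exp (-(κ ^ 2 / 4) * s.card) := by
  have := S.chernoff s A hA (fun i ω => if p i ω then (1 : ℝ) else 0)
    (fun i hi => (hp i hi).comp fun p => if p then (1 : ℝ) else 0)
    (fun i _ ω => by split_ifs <;> norm_num) (fun i _ ω => by split_ifs <;> norm_num) hq hE hκ hκ1
  refine le_trans (π.Pr_mono fun ω h => ?_) this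
  rw [Finset.card_filter] at h
  push_cast at h
  exact h

/-- A parameter determined on `W` may be frozen when looking at the field on a disjoint set. -/
theorem freeze {W U : Set V} (hWU : Disjoint W U) {β : Type*} (X : Ω → β) (hX : S.Det W X)
    (g : β → Ω → ℝ) (hg : ∀ t, S.Det U (g t)) :
    π.E (fun ω => g (X ω) ω) = π.E (fun ω' => π.E (g (X ω'))) := by
  -- Decompose according to the value `t` of `X`; then `g t` is independent of the event `X = t`.
  have key : ∀ G : β → Ω → ℝ, π.E (fun ω => G (X ω) ω) =
      ∑ t ∈ Finset.univ.image X, π.E (fun ω => (if X ω = t then 1 else 0) * G t ω) := by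
    intro G
    rw [← FinProb.E_sum]
    congr 1; ext ω
    simp
  rw [key g, key (fun t _ => π.E (g t))]
  refine Finset.sum_congr rfl fun t _ => ?_
  rw [S.indep W U hWU _ _ (hX.comp fun x => if x = t then (1 : ℝ) else 0) (hg t),
    FinProb.E_mul_right]

theorem freeze_le {W U : Set V} (hWU : Disjoint W U) {β : Type*} (X : Ω → β) (hX : S.Det W X)
    (g : β → Ω → ℝ) (hg : ∀ t, S.Det U (g t)) {c : ℝ} (hc : ∀ t, π.E (g t) ≤ c) :
    π.E (fun ω => g (X ω) ω) ≤ c := by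
  rw [S.freeze hWU X hX g hg]
  exact π.E_le_const fun _ => hc _

theorem freeze_pr {W U : Set V} (hWU : Disjoint W U) {β : Type*} (X : Ω → β) (hX : S.Det W X)
    (p : β → Ω → Prop) (hp : ∀ t, S.Det U (p t)) {c : ℝ} (hc : ∀ t, π.Pr (p t) ≤ c) :
    π.Pr (fun ω => p (X ω) ω) ≤ c :=
  S.freeze_le hWU X hX (fun t ω => if p t ω then 1 else 0)
    (fun t => (hp t).comp fun p => if p then (1 : ℝ) else 0) hc

/-- A field built locally from another one. -/
def derive {V' : Type*} (R' : Ω → V' → V' → Prop) (D : V' → Set V)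
    (hD : ∀ u v, u ≠ v → Disjoint (D u) (D v))
    (symm : ∀ ω u v, R' ω u v → R' ω v u) (left : ∀ ω u v, R' ω u v → R' ω u u)
    (det : ∀ u v, S.Det (D u ∪ D v) (fun ω => R' ω u v)) : SiteBond π V' where
  R := R'
  symm := symm
  left := left
  indep A B hAB f g hf hg := by
    -- What the coarse field on `A` determines is already determined by the original field on the
    -- union of the domains, and these unions are disjoint for disjoint sets.
    have key : ∀ (A : Set V') (f : Ω → ℝ), DeterminedBy R' A f → S.Det (⋃ a ∈ A, D a) f := by
      intro A f hf ω ω' h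
      refine hf ω ω' fun u hu v hv => ?_
      refine iff_of_eq (det u v ω ω' (h.mono ?_))
      exact Set.union_subset (Set.subset_biUnion_of_mem hu) (Set.subset_biUnion_of_mem hv)
    refine S.indep _ _ ?_ f g (key A f hf) (key B g hg)
    refine Set.disjoint_iUnion₂_left.2 fun a ha => Set.disjoint_iUnion₂_right.2 fun b hb => ?_
    exact hD a b fun h => Set.disjoint_left.1 hAB ha (h ▸ hb)

/-- Restriction of a field along an injective map. -/
def comap {V' : Type*} (φ : V' → V) (hφ : Function.Injective φ) : SiteBond π V' :=
  S.derive (fun ω u v => S.R ω (φ u) (φ v)) (fun u => {φ u})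
    (fun u v h => Set.disjoint_singleton.2 fun h' => h (hφ h'))
    (fun ω _ _ h => S.symm ω _ _ h) (fun ω _ _ h => S.left ω _ _ h)
    (fun u v => determinedBy_rel _ (by simp) (by simp))

theorem comap_R {V' : Type*} (φ : V' → V) (hφ : Function.Injective φ) (ω : Ω) (u v : V') :
    (S.comap φ hφ).R ω u v = S.R ω (φ u) (φ v) := rfl

theorem reach_of_comap {V' : Type*} (φ : V' → V) (hφ : Function.Injective φ) {ω : Ω}
    {A : Set V'} {u v : V'} (h : ReachIn ((S.comap φ hφ).R ω) A u v) :
    ReachIn (S.R ω) (φ '' A) (φ u) (φ v) := by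
  induction h with
  | single h => exact .single (Set.mem_image_of_mem _ h.1) (Set.mem_image_of_mem _ h.2.1) h.2.2
  | tail _ h ih =>
    exact ih.trans (.single (Set.mem_image_of_mem _ h.1) (Set.mem_image_of_mem _ h.2.1) h.2.2)

end SiteBond

/-! ### Large clusters around most hubs -/

/-- Along an increasing sequence of sets, the number of steps at which two points of `Λ` become
joined is at most the number of points of `Λ`. -/
theorem card_merging_le {V : Type*} {ρ : V → V → Prop} (hs : ∀ a b, ρ a b → ρ b a) (Λ : Finset V)
    (A : ℕ → Set V) (hA : Monotone A) (N : ℕ) :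
    ((Finset.range N).filter fun t => ∃ x ∈ Λ, ∃ y ∈ Λ, x ≠ y ∧ ¬ ReachIn ρ (A t) x y ∧
      ReachIn ρ (A (t + 1)) x y).card ≤ Λ.card := by
  -- Equality is added by hand because `ReachIn` need not be reflexive.
  let s : ℕ → Setoid Λ := fun t =>
    { r := fun x y => x = y ∨ ReachIn ρ (A t) x y
      iseqv := ⟨fun x => Or.inl rfl,
        fun h => h.elim (fun h => Or.inl h.symm) fun h => Or.inr (h.symm hs),
        fun h h' => by
          rcases h with rfl | h
          · exact h'
          · rcases h' with rfl | h'
            · exact Or.inr h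
            · exact Or.inr (h.trans h')⟩ }
  -- Strengthened for the induction: each merging step is paid for by the loss of a class.
  have key : ((Finset.range N).filter fun t => ∃ x ∈ Λ, ∃ y ∈ Λ, x ≠ y ∧ ¬ ReachIn ρ (A t) x y ∧
      ReachIn ρ (A (t + 1)) x y).card + Fintype.card (Quotient (s N)) ≤ Λ.card := by
    induction N with
    | zero =>
      simpa using Fintype.card_le_of_surjective (Quotient.mk (s 0)) Quotient.mk_surjective
    | succ N ih =>
      have hle : ∀ x y : Λ, (s N).r x y → (s (N + 1)).r x y := fun x y h =>
        h.imp id fun h => h.mono (hA (Nat.le_succ N))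
      let f : Quotient (s N) → Quotient (s (N + 1)) := Quotient.map' id hle
      have hf : Function.Surjective f := fun y => by
        induction y using Quotient.inductionOn with
        | h a => exact ⟨Quotient.mk _ a, rfl⟩
      rw [Finset.range_add_one, Finset.filter_insert]
      split_ifs with hc
      · obtain ⟨x, hx, y, hy, hne, h1, h2⟩ := hc
        have hlt : Fintype.card (Quotient (s (N + 1))) < Fintype.card (Quotient (s N)) := by
          refine Fintype.card_lt_of_surjective_not_injective f hf fun hi => ?_
          have h3 : (Quotient.mk (s N) ⟨x, hx⟩) = Quotient.mk (s N) ⟨y, hy⟩ :=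
            hi (Quotient.sound (s := s (N + 1)) (Or.inr h2))
          rcases Quotient.exact h3 with h4 | h4
          · exact hne (congrArg Subtype.val h4)
          · exact h1 h4
        rw [Finset.card_insert_of_notMem (by simp)]
        omega
      · have := Fintype.card_le_of_surjective f hf
        omega
  omega

namespace SiteBond

variable {Ω : Type*} [Fintype Ω] {π : FinProb Ω} {V : Type*} (S : SiteBond π V)

/-- Both sites are good, but they are not related. -/
def Unlinked (ω : Ω) (u v : V) : Prop := S.R ω u u ∧ S.R ω v v ∧ ¬ S.R ω u v

theorem det_unlinked {A : Set V} {u v : V} (hu : u ∈ A) (hv : v ∈ A) :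
    S.Det A (fun ω => S.Unlinked ω u v) := by
  intro ω ω' h
  simp only [Unlinked, h u hu u hu, h v hv v hv, h u hu v hv]

variable {H J : Type*} [Fintype H] [Fintype J]

/-- A system of hubs, each with a family of leaves indexed by `J`; the leaves may be shared between
hubs, but only for the same index. -/
structure IsStarSystem (hub : H → V) (leaf : H → J → V) : Prop where
  hub_inj : Function.Injective hub
  leaf_dir : ∀ h h' j j', leaf h j = leaf h' j' → j = j'
  hub_ne : ∀ h h' j, hub h ≠ leaf h' j

section Existence

variable (hub : H → V) (leaf : H → J → V) (I : H → Finset J) (α : ℝ) (c : J → Bool)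

/-- The set explored before stage `n`: the leaves in non-test directions and the first hubs. -/
def explored (n : ℕ) : Set V :=
  {v | ∃ h j, c j = false ∧ v = leaf h j} ∪ {v | ∃ h, (Fintype.equivFin H h : ℕ) < n ∧ v = hub h}

theorem explored_mono : Monotone (explored hub leaf c) := by
  intro m n hmn v hv
  rcases hv with hv | ⟨h, hh, rfl⟩
  · exact Or.inl hv
  · exact Or.inr ⟨h, hh.trans_le hmn, rfl⟩

/-- No explored cluster contains a large part of the leaves of `h`. -/
def ExploredBad (h : H) (ω : Ω) : Prop :=
  ∀ j₀, (((I h).filter fun j => c j = false ∧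
    ReachIn (S.R ω) (explored hub leaf c (Fintype.equivFin H h)) (leaf h j₀) (leaf h j)).card : ℝ) <
      α * (I h).card

/-- The hub `h` joins two explored clusters. -/
def Crossing (h : H) (ω : Ω) : Prop :=
  S.R ω (hub h) (hub h) ∧ ∃ j j', c j = false ∧ c j' = false ∧ S.R ω (hub h) (leaf h j) ∧
    S.R ω (hub h) (leaf h j') ∧
    ¬ ReachIn (S.R ω) (explored hub leaf c (Fintype.equivFin H h)) (leaf h j) (leaf h j')

theorem det_exploredBad (h : H) :
    S.Det (explored hub leaf c (Fintype.equivFin H h)) (S.ExploredBad hub leaf I α c h) := by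
  intro ω ω' hω
  have := determinedBy_reachIn S.R _ ω ω' hω
  simp only [ExploredBad, this]

/-- Adding a crossing hub to the explored set joins two leaves that were not joined before. Distinct
hubs are added at distinct stages, so `card_merging_le` bounds the number of crossings in every
outcome. -/
theorem sum_crossing_le (L : ℕ)
    (hL : (Finset.univ.image fun p : H × J => leaf p.1 p.2).card ≤ L) :
    ∑ h, π.Pr (S.Crossing hub leaf c h) ≤ L := by
  rw [← FinProb.E_card]
  refine π.E_le_const fun ω => ?_
  have h1 := card_merging_le (S.symm ω) (Finset.univ.image fun p : H × J => leaf p.1 p.2)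
    (explored hub leaf c) (explored_mono hub leaf c) (Fintype.card H)
  refine Nat.cast_le.2 (le_trans ?_ (h1.trans hL))
  refine Finset.card_le_card_of_injOn (fun h => (Fintype.equivFin H h : ℕ)) ?_ ?_
  · intro h hh
    obtain ⟨hg, j, j', hj, hj', hr, hr', hn⟩ := (Finset.mem_filter.1 hh).2
    simp only [Finset.coe_filter, Finset.mem_range, Set.mem_ofPred_eq]
    have hlt := (Fintype.equivFin H h).isLt
    have hm : ∀ j n, c j = false → leaf h j ∈ explored hub leaf c n :=
      fun j n hj => Or.inl ⟨h, j, hj, rfl⟩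
    have hh' : hub h ∈ explored hub leaf c ((Fintype.equivFin H h : ℕ) + 1) :=
      Or.inr ⟨h, Nat.lt_succ_self _, rfl⟩
    refine ⟨hlt, leaf h j, Finset.mem_image_of_mem _ (Finset.mem_univ (h, j)), leaf h j',
      Finset.mem_image_of_mem _ (Finset.mem_univ (h, j')), ?_, hn, ?_⟩
    · intro he
      apply hn
      rw [← he]
      exact .single (hm _ _ hj) (hm _ _ hj) (S.right _ hr)
    · exact ReachIn.trans (.single (hm _ _ hj) hh' (S.symm _ _ _ hr)) (.single hh' (hm _ _ hj') hr')
  · intro a _ b _ hab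
    exact (Fintype.equivFin H).injective (Fin.ext hab)

/-- Few leaves of `h` in test directions are unlinked, compared to all unlinked leaves. -/
def TestAtypical (κ : ℝ) (h : H) (ω : Ω) (c : J → Bool) : Prop :=
  (((I h).filter fun j => S.Unlinked ω (hub h) (leaf h j) ∧ c j = true).card : ℝ) <
    κ * ((I h).filter fun j => S.Unlinked ω (hub h) (leaf h j)).card - κ ^ 2 * (I h).card

/-- Too many leaves of `h` are not good. -/
def ManyBadLeaves (P κ : ℝ) (h : H) (ω : Ω) : Prop :=
  (1 - P + κ) * (I h).card ≤ ((I h).filter fun j => ¬ S.R ω (leaf h j) (leaf h j)).card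

/-- A leaf is not good, or in a test direction, or linked to the hub, or unlinked to it. Without a
crossing, all linked leaves in non-test directions lie in one explored cluster, which is small.
Hence a proportion `P - α - 3 * κ` is unlinked, and typical test directions display a fraction `κ`
of it, up to `κ ^ 2`. -/
theorem unlinked_test_ge {P κ : ℝ} (hκ : 0 < κ) (h : H) (ω : Ω)
    (hI : 0 < (I h).card) (hα : 0 < α)
    (hT : (((I h).filter fun j => c j = true).card : ℝ) < (κ + κ ^ 2) * (I h).card)
    (hB : S.ExploredBad hub leaf I α c h ω) (hg : S.R ω (hub h) (hub h))
    (hC : ¬ S.Crossing hub leaf c h ω) (hTA : ¬ S.TestAtypical hub leaf I κ h ω c)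
    (hMB : ¬ S.ManyBadLeaves leaf I P κ h ω) :
    κ * (P - α - 4 * κ) * (I h).card ≤
      (((I h).filter fun j => S.Unlinked ω (hub h) (leaf h j) ∧ c j = true).card : ℝ) := by
  have hlink : (((I h).filter fun j => c j = false ∧ S.R ω (hub h) (leaf h j)).card : ℝ) ≤
      α * (I h).card := by
    by_cases hex : ∃ j₀, c j₀ = false ∧ S.R ω (hub h) (leaf h j₀)
    · obtain ⟨j₀, h1, h2⟩ := hex
      refine le_trans ?_ (hB j₀).le
      refine Nat.cast_le.2 (Finset.card_le_card fun j hj => ?_)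
      rw [Finset.mem_filter] at hj ⊢
      refine ⟨hj.1, hj.2.1, ?_⟩
      by_contra hn
      exact hC ⟨hg, j₀, j, h1, hj.2.1, h2, hj.2.2, hn⟩
    · rw [Finset.filter_eq_empty_iff.2 fun j _ hj => hex ⟨j, hj⟩]
      simp only [Finset.card_empty, Nat.cast_zero]
      positivity
  unfold ManyBadLeaves at hMB
  unfold TestAtypical at hTA
  push Not at hMB hTA
  have hsplit : (I h).card ≤ ((I h).filter fun j => ¬ S.R ω (leaf h j) (leaf h j)).card +
      ((I h).filter fun j => c j = false ∧ S.R ω (hub h) (leaf h j)).card +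
      ((I h).filter fun j => c j = true).card +
      ((I h).filter fun j => S.Unlinked ω (hub h) (leaf h j)).card := by
    have : I h ⊆ (((I h).filter fun j => ¬ S.R ω (leaf h j) (leaf h j)) ∪
      ((I h).filter fun j => c j = false ∧ S.R ω (hub h) (leaf h j)) ∪
      ((I h).filter fun j => c j = true)) ∪
      ((I h).filter fun j => S.Unlinked ω (hub h) (leaf h j)) := by
      intro j hj
      simp only [Finset.mem_union, Finset.mem_filter, hj, true_and, Unlinked, hg]
      cases c j <;> tauto
    refine (Finset.card_le_card this).trans ?_
    refine (Finset.card_union_le _ _).trans (Nat.add_le_add_right ?_ _)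
    refine (Finset.card_union_le _ _).trans (Nat.add_le_add_right ?_ _)
    exact Finset.card_union_le _ _
  have hsplit' : ((I h).card : ℝ) ≤
      ((I h).filter fun j => ¬ S.R ω (leaf h j) (leaf h j)).card +
      ((I h).filter fun j => c j = false ∧ S.R ω (hub h) (leaf h j)).card +
      ((I h).filter fun j => c j = true).card +
      ((I h).filter fun j => S.Unlinked ω (hub h) (leaf h j)).card := by exact_mod_cast hsplit
  have hm : (0 : ℝ) < (I h).card := by exact_mod_cast hI
  have hU : (P - α - 3 * κ) * (I h).card ≤
      ((I h).filter fun j => S.Unlinked ω (hub h) (leaf h j)).card := by nlinarith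
  nlinarith

/-- The unlinked test leaves of `h` on the event `ExploredBad` are counted twice. From above: the
hub and its test leaves are unexplored, so by independence each contributes at most `Q` times the
probability of the event. From below: `h` is good independently of the event, and outside the three
exceptional events `unlinked_test_ge` applies; Markov's inequality compares the two. -/
theorem exploredBad_le {P Q κ : ℝ} (hst : IsStarSystem hub leaf) (hP1 : P ≤ 1)
    (hκ : 0 < κ) (hQ0 : 0 ≤ Q) (hα : 0 < α)
    (hc0 : 0 < (P - α - 4 * κ) * P - (1 + κ) * Q) (hP0 : 0 ≤ P)
    (h : H) (hI : 0 < (I h).card) (hgood : P ≤ π.Pr (fun ω => S.R ω (hub h) (hub h)))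
    (hunl : ∀ j, π.Pr (fun ω => S.Unlinked ω (hub h) (leaf h j)) ≤ Q)
    (hT : (((I h).filter fun j => c j = true).card : ℝ) < (κ + κ ^ 2) * (I h).card) :
    ((P - α - 4 * κ) * P - (1 + κ) * Q) * π.Pr (S.ExploredBad hub leaf I α c h) ≤
      π.Pr (S.Crossing hub leaf c h) +
      π.Pr (fun ω => S.TestAtypical hub leaf I κ h ω c) +
      π.Pr (S.ManyBadLeaves leaf I P κ h) := by
  set B := S.ExploredBad hub leaf I α c h with hB
  set e := π.Pr (S.Crossing hub leaf c h) + π.Pr (fun ω => S.TestAtypical hub leaf I κ h ω c) +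
      π.Pr (S.ManyBadLeaves leaf I P κ h) with he
  have hm : (0 : ℝ) < (I h).card := by exact_mod_cast hI
  have hb : 0 < P - α - 4 * κ := by
    by_contra hb
    push Not at hb
    nlinarith [mul_nonneg hQ0 hκ.le]
  set X : Ω → ℝ := fun ω => (((I h).filter fun j => (B ω ∧
    S.Unlinked ω (hub h) (leaf h j)) ∧ c j = true).card : ℝ) with hX
  have hhub : hub h ∉ explored hub leaf c (Fintype.equivFin H h) := by
    rintro (⟨h', j, -, h2⟩ | ⟨h', h1, h2⟩)
    · exact hst.hub_ne _ _ _ h2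
    · rw [hst.hub_inj h2] at h1
      exact lt_irrefl _ h1
  have hBdet := S.det_exploredBad hub leaf I α c h
  have hup : π.E X ≤ (κ + κ ^ 2) * (I h).card * (π.Pr B * Q) := by
    have h1 : π.E X = ∑ j ∈ (I h).filter fun j => c j = true,
        π.Pr (fun ω => B ω ∧ S.Unlinked ω (hub h) (leaf h j)) := by
      rw [← FinProb.E_card]
      congr 1; ext ω
      simp only [hX]
      congr 2; ext j
      simp only [Finset.mem_filter]
      tauto
    have h2 : ∀ j ∈ (I h).filter fun j => c j = true,
        π.Pr (fun ω => B ω ∧ S.Unlinked ω (hub h) (leaf h j)) ≤ π.Pr B * Q := by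
      intro j hj
      rw [S.indep_pr (A := explored hub leaf c (Fintype.equivFin H h)) (B := {hub h, leaf h j}) ?_
        hBdet (S.det_unlinked (by simp) (by simp))]
      · exact mul_le_mul_of_nonneg_left (hunl j) (π.Pr_nonneg _)
      · rw [Set.disjoint_right]
        intro v hv hv'
        rcases hv with rfl | rfl
        · exact hhub hv'
        · rcases hv' with ⟨h', j', h1, h2⟩ | ⟨h', h1, h2⟩
          · have hj' := (Finset.mem_filter.1 hj).2
            rw [hst.leaf_dir _ _ _ _ h2, h1] at hj'
            exact Bool.false_ne_true hj'
          · exact hst.hub_ne _ _ _ h2.symm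
    rw [h1]
    refine (Finset.sum_le_card_nsmul _ _ _ h2).trans ?_
    rw [nsmul_eq_mul]
    exact mul_le_mul_of_nonneg_right hT.le (mul_nonneg (π.Pr_nonneg _) hQ0)
  have hlow : κ * (P - α - 4 * κ) * (I h).card * (P * π.Pr B - e) ≤ π.E X := by
    have h1 : P * π.Pr B - e ≤ π.Pr (fun ω => κ * (P - α - 4 * κ) * (I h).card ≤ X ω) := by
      have h2 : π.Pr B * π.Pr (fun ω => S.R ω (hub h) (hub h)) ≤
          π.Pr (fun ω => κ * (P - α - 4 * κ) * (I h).card ≤ X ω) + e := by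
        rw [← S.indep_pr (A := explored hub leaf c (Fintype.equivFin H h)) (B := {hub h})
          (Set.disjoint_singleton_right.2 hhub) hBdet (determinedBy_rel _ rfl rfl), he]
        have := π.Pr_or (fun ω => S.Crossing hub leaf c h ω ∨ S.TestAtypical hub leaf I κ h ω c)
          (S.ManyBadLeaves leaf I P κ h)
        have h5 := π.Pr_or (S.Crossing hub leaf c h) (fun ω => S.TestAtypical hub leaf I κ h ω c)
        refine (π.Pr_le_add (q := fun ω => κ * (P - α - 4 * κ) * (I h).card ≤ X ω)
          (s := fun ω => (S.Crossing hub leaf c h ω ∨ S.TestAtypical hub leaf I κ h ω c) ∨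
            S.ManyBadLeaves leaf I P κ h ω) ?_).trans (by linarith)
        rintro ω ⟨hBω, hg⟩
        by_cases hbad : (S.Crossing hub leaf c h ω ∨ S.TestAtypical hub leaf I κ h ω c) ∨
            S.ManyBadLeaves leaf I P κ h ω
        · exact Or.inr hbad
        · left
          simp only [not_or] at hbad
          have := S.unlinked_test_ge hub leaf I α c hκ h ω hI hα hT hBω hg hbad.1.1
            hbad.1.2 hbad.2
          refine this.trans (Nat.cast_le.2 (Finset.card_le_card fun j hj => ?_))
          simp only [Finset.mem_filter] at hj ⊢
          exact ⟨hj.1, ⟨hBω, hj.2.1⟩, hj.2.2⟩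
      have h3 := mul_le_mul_of_nonneg_right hgood (π.Pr_nonneg B)
      linarith
    exact (mul_le_mul_of_nonneg_left h1 (by positivity)).trans
      (π.markov (fun ω => Nat.cast_nonneg _) _)
  have h0 : κ * (I h).card * ((P - α - 4 * κ) * (P * π.Pr B - e)) ≤
      κ * (I h).card * ((1 + κ) * (π.Pr B * Q)) := by
    calc _ = κ * (P - α - 4 * κ) * (I h).card * (P * π.Pr B - e) := by ring
      _ ≤ _ := hlow.trans hup
      _ = _ := by ring
  have h1 := le_of_mul_le_mul_left h0 (by positivity)
  have he0 : 0 ≤ e := add_nonneg (add_nonneg (π.Pr_nonneg _) (π.Pr_nonneg _)) (π.Pr_nonneg _)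
  nlinarith

/-- For most hubs some cluster of the field on `T` contains a large part of the given leaves. -/
theorem sum_noLargeCluster_le {P Q κ m : ℝ} (hst : IsStarSystem hub leaf) (hP1 : P ≤ 1)
    (hκ : 0 < κ) (hκ1 : κ ≤ 1) (hQ0 : 0 ≤ Q) (hα : 0 < α)
    (hc0 : 0 < (P - α - 4 * κ) * P - (1 + κ) * Q) (hP0 : 0 ≤ P) (hm : 0 < m)
    (hgood : ∀ v, P ≤ π.Pr (fun ω => S.R ω v v))
    (hunl : ∀ h j, π.Pr (fun ω => S.Unlinked ω (hub h) (leaf h j)) ≤ Q)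
    (L : ℕ) (hL : (Finset.univ.image fun p : H × J => leaf p.1 p.2).card ≤ L)
    (T : Set V) (hubT : ∀ h, hub h ∈ T) (leafT : ∀ h j, leaf h j ∈ T) :
    ((P - α - 4 * κ) * P - (1 + κ) * Q) * ∑ h, π.Pr (fun ω => m ≤ (I h).card ∧
      ∀ j₀, (((I h).filter fun j => ReachIn (S.R ω) T (leaf h j₀) (leaf h j)).card : ℝ) <
        α * (I h).card) ≤
      L + Fintype.card H * (3 * Real.exp (-(κ ^ 4 / 4) * m)) := by
  set c0 := (P - α - 4 * κ) * P - (1 + κ) * Q with hc0d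
  set bad : H → Ω → Prop := fun h ω => m ≤ (I h).card ∧
      ∀ j₀, (((I h).filter fun j => ReachIn (S.R ω) T (leaf h j₀) (leaf h j)).card : ℝ) <
        α * (I h).card with hbad
  set δ := Real.exp (-(κ ^ 4 / 4) * m) with hδ
  set ν := FinProb.bernoulli (J := J) κ hκ.le hκ1 with hν
  have hk4 : κ ^ 4 ≤ κ ^ 2 := pow_le_pow_of_le_one hκ.le hκ1 (by norm_num)
  have hc01 : c0 ≤ 1 := by
    have : (P - α - 4 * κ) ≤ 1 := by linarith
    nlinarith [mul_nonneg hQ0 hκ.le, mul_le_mul_of_nonneg_right this hP0]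
  -- the bound for a fixed set of test directions
  have step : ∀ h, m ≤ (I h).card → ∀ c : J → Bool, c0 * π.Pr (bad h) ≤
      π.Pr (S.Crossing hub leaf c h) + π.Pr (fun ω => S.TestAtypical hub leaf I κ h ω c) +
      π.Pr (S.ManyBadLeaves leaf I P κ h) +
      (if (κ + κ ^ 2) * (I h).card ≤ (((I h).filter fun j => c j = true).card : ℝ)
        then 1 else 0) := by
    intro h hmI c
    have hI : 0 < (I h).card := by exact_mod_cast hm.trans_le hmI
    have n1 := π.Pr_nonneg (S.Crossing hub leaf c h)
    have n2 := π.Pr_nonneg (fun ω => S.TestAtypical hub leaf I κ h ω c)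
    have n3 := π.Pr_nonneg (S.ManyBadLeaves leaf I P κ h)
    split_ifs with hT
    · have := π.Pr_le_one (bad h)
      nlinarith [π.Pr_nonneg (bad h)]
    · push Not at hT
      have h1 := S.exploredBad_le hub leaf I α c hst hP1 hκ hQ0 hα hc0 hP0 h hI (hgood _)
        (hunl h) hT
      have h2 : π.Pr (bad h) ≤ π.Pr (S.ExploredBad hub leaf I α c h) := by
        refine π.Pr_mono fun ω hω j₀ => lt_of_le_of_lt (Nat.cast_le.2 ?_) (hω.2 j₀)
        refine Finset.card_le_card fun j hj => ?_
        rw [Finset.mem_filter] at hj ⊢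
        refine ⟨hj.1, hj.2.2.mono ?_⟩
        rintro v (⟨h', j', -, rfl⟩ | ⟨h', -, rfl⟩)
        · exact leafT _ _
        · exact hubT _
      nlinarith
  have hexp : ∀ h, m ≤ (I h).card → ∀ a, κ ^ 4 ≤ a → Real.exp (-(a / 4) * (I h).card) ≤ δ := by
    intro h hmI a ha
    refine Real.exp_le_exp.2 ?_
    have : κ ^ 4 * m ≤ a * (I h).card := mul_le_mul ha hmI hm.le ((by positivity : (0:ℝ) ≤ κ^4).trans ha)
    linarith
  -- The left-hand side does not involve the test directions, so each may be chosen at random with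
  -- probability `κ` and the inequality averaged.
  have hone : ∀ h, c0 * π.Pr (bad h) ≤
      ν.E (fun c => π.Pr (S.Crossing hub leaf c h)) + 3 * δ := by
    intro h
    by_cases hmI : m ≤ (I h).card
    swap
    · have : π.Pr (bad h) = 0 := by
        simp only [hbad, hmI, false_and, FinProb.Pr, if_false]
        exact π.E_const 0
      rw [this, mul_zero]
      exact add_nonneg (ν.E_nonneg fun _ => π.Pr_nonneg _) (by positivity)
    have h1 : c0 * π.Pr (bad h) ≤ ν.E (fun c => π.Pr (S.Crossing hub leaf c h) +
        π.Pr (fun ω => S.TestAtypical hub leaf I κ h ω c) + π.Pr (S.ManyBadLeaves leaf I P κ h) +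
        (if (κ + κ ^ 2) * (I h).card ≤ (((I h).filter fun j => c j = true).card : ℝ)
        then 1 else 0)) := by
      rw [← ν.E_const (c0 * π.Pr (bad h))]
      exact ν.E_mono fun c => step h hmI c
    rw [FinProb.E_add, FinProb.E_add, FinProb.E_add, FinProb.E_const] at h1
    -- For a fixed outcome the unlinked leaves form a fixed set and only the coins are random. The
    -- Chernoff bound is for upper tails, so it is applied to the unlinked leaves in non-test
    -- directions. The deviation `κ ^ 2` is what puts `κ ^ 4` in the exponent.
    have e1 : ν.E (fun c => π.Pr (fun ω => S.TestAtypical hub leaf I κ h ω c)) ≤ δ := by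
      have hswap : ν.E (fun c => π.Pr (fun ω => S.TestAtypical hub leaf I κ h ω c)) =
          π.E (fun ω => ν.Pr (fun c => S.TestAtypical hub leaf I κ h ω c)) := by
        simp only [FinProb.Pr, FinProb.E, Finset.mul_sum]
        rw [Finset.sum_comm]
        exact Finset.sum_congr rfl fun _ _ => Finset.sum_congr rfl fun _ _ => by ring
      rw [hswap]
      refine π.E_le_const fun ω => ?_
      have := FinProb.bernoulli_chernoff κ hκ.le hκ1 (I h)
        (fun j b => if S.Unlinked ω (hub h) (leaf h j) ∧ b = false then 1 else 0)
        (fun j b => by split_ifs <;> norm_num) (fun j b => by split_ifs <;> norm_num)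
        (κ := κ ^ 2) (by positivity) (by nlinarith)
      refine le_trans (ν.Pr_mono fun c hc => ?_) (this.trans (hexp h hmI _ (le_of_eq (by ring))))
      unfold TestAtypical at hc
      have hs : (((I h).filter fun j => S.Unlinked ω (hub h) (leaf h j) ∧ c j = true).card : ℝ) +
          ∑ j ∈ I h, (if S.Unlinked ω (hub h) (leaf h j) ∧ c j = false then (1 : ℝ) else 0) =
          ((I h).filter fun j => S.Unlinked ω (hub h) (leaf h j)).card := by
        rw [Finset.card_filter, Finset.card_filter]
        push_cast
        rw [← Finset.sum_add_distrib]
        refine Finset.sum_congr rfl fun j _ => ?_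
        by_cases hu : S.Unlinked ω (hub h) (leaf h j) <;> cases c j <;> simp [hu]
      have hs2 : ∑ j ∈ I h, (κ * (if S.Unlinked ω (hub h) (leaf h j) ∧ true = false
          then (1 : ℝ) else 0) +
          (1 - κ) * (if S.Unlinked ω (hub h) (leaf h j) ∧ false = false then (1 : ℝ) else 0)) =
          (1 - κ) * ((I h).filter fun j => S.Unlinked ω (hub h) (leaf h j)).card := by
        rw [Finset.card_filter]
        push_cast
        rw [Finset.mul_sum]
        refine Finset.sum_congr rfl fun j _ => by simp
      rw [hs2]
      linarith
    have e2 : π.Pr (S.ManyBadLeaves leaf I P κ h) ≤ δ := by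
      have := S.chernoff_card (I h) (fun j => {leaf h j})
        (fun i _ j _ hij => Set.disjoint_singleton.2 fun he => hij (hst.leaf_dir _ _ _ _ he))
        (fun j ω => ¬ S.R ω (leaf h j) (leaf h j))
        (fun j _ => (determinedBy_rel S.R (Set.mem_singleton (leaf h j))
          (Set.mem_singleton (leaf h j))).comp Not) (q := 1 - P) (by linarith)
        (fun j _ => by
          have := π.Pr_not (fun ω => S.R ω (leaf h j) (leaf h j))
          have := hgood (leaf h j)
          linarith) hκ.le hκ1
      refine le_trans (π.Pr_mono fun ω hω => ?_) (this.trans (hexp h hmI _ hk4))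
      unfold ManyBadLeaves at hω
      convert hω
    have e3 : ν.E (fun c => if (κ + κ ^ 2) * (I h).card ≤
        (((I h).filter fun j => c j = true).card : ℝ) then 1 else 0) ≤ δ := by
      have := FinProb.bernoulli_chernoff κ hκ.le hκ1 (I h)
        (fun j b => if b = true then 1 else 0)
        (fun j b => by split_ifs <;> norm_num) (fun j b => by split_ifs <;> norm_num)
        (κ := κ ^ 2) (by positivity) (by nlinarith)
      refine le_trans (ν.Pr_mono fun c hc => ?_) (this.trans (hexp h hmI _ (le_of_eq (by ring))))
      rw [Finset.card_filter] at hc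
      push_cast at hc
      simp only [if_true, mul_one, Bool.false_eq_true, if_false, mul_zero, add_zero,
        Finset.sum_const, nsmul_eq_mul]
      linarith
    linarith
  rw [Finset.mul_sum]
  refine (Finset.sum_le_sum fun h _ => hone h).trans ?_
  rw [Finset.sum_add_distrib, ← FinProb.E_sum, Finset.sum_const, nsmul_eq_mul, Finset.card_univ]
  exact add_le_add_left (ν.E_le_const fun c => S.sum_crossing_le hub leaf c L hL) _

end Existence

end SiteBond

/-! ### Largest classes and star-shaped cubes -/

/-- A largest class of the relation `ρ` inside `I`. -/
def largestClass {J : Type*} [Fintype J] (ρ : J → J → Prop) (I : Finset J) : Finset J :=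
  if _ : Nonempty J then
    I.filter (ρ (Finset.exists_max_image Finset.univ (fun j₀ => (I.filter (ρ j₀)).card)
      Finset.univ_nonempty).choose)
  else ∅

section LargestClass

variable {J : Type*} [Fintype J] {ρ : J → J → Prop} {I : Finset J}

theorem largestClass_subset : largestClass ρ I ⊆ I := by
  unfold largestClass
  split_ifs
  · exact Finset.filter_subset _ _
  · exact Finset.empty_subset _

theorem card_le_largestClass (j₀ : J) : (I.filter (ρ j₀)).card ≤ (largestClass ρ I).card := by
  have h : Nonempty J := ⟨j₀⟩
  unfold largestClass
  rw [dif_pos h]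
  exact (Finset.exists_max_image Finset.univ (fun j₀ => (I.filter (ρ j₀)).card)
      Finset.univ_nonempty).choose_spec.2 j₀ (Finset.mem_univ _)

theorem largestClass_rel (hs : ∀ i j, ρ i j → ρ j i) (ht : ∀ i j k, ρ i j → ρ j k → ρ i k)
    {i j : J} (hi : i ∈ largestClass ρ I) (hj : j ∈ largestClass ρ I) : ρ i j := by
  unfold largestClass at hi hj
  split_ifs at hi hj with h
  · exact ht _ _ _ (hs _ _ (Finset.mem_filter.1 hi).2) (Finset.mem_filter.1 hj).2
  · simp at hi

end LargestClass

/-- The points of a star-shaped cube. -/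
abbrev StarCube (r R : ℕ) := Fin r → Option (Fin R)

/-- The labels of the hubs of a star-shaped cube. -/
abbrev HubLabel (r R : ℕ) := Fin r → Fin R

namespace StarCube

variable {r R : ℕ}

/-- The hub with label `B`. -/
def hub (B : HubLabel r R) : StarCube r R := fun i => some (B i)

/-- The leaf below the hub `B` in direction `j`. -/
def leaf (B : HubLabel r R) (j : Fin r) : StarCube r R := Function.update (hub B) j none

theorem hub_injective : Function.Injective (hub (r := r) (R := R)) := fun _ _ h =>
  funext fun i => Option.some_injective _ (congrFun h i)

theorem leaf_eq_none_iff (B : HubLabel r R) (j i : Fin r) : leaf B j i = none ↔ i = j := by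
  unfold leaf hub
  by_cases h : i = j
  · subst h; simp
  · simp [h]

theorem leaf_dir {A B : HubLabel r R} {i j : Fin r} (h : leaf A i = leaf B j) : i = j := by
  have := (leaf_eq_none_iff A i i).2 rfl
  rw [h, leaf_eq_none_iff] at this
  exact this

theorem hub_ne_leaf (A B : HubLabel r R) (j : Fin r) : hub A ≠ leaf B j := by
  intro h
  have := (leaf_eq_none_iff B j j).2 rfl
  rw [← h] at this
  simp [hub] at this

theorem leaf_update (A : HubLabel r R) (i : Fin r) (v : Fin R) :
    leaf (Function.update A i v) i = leaf A i := by
  ext1 k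
  unfold leaf hub
  by_cases h : k = i
  · subst h; simp
  · simp [h]

/-- Each leaf lies below the `R` hubs obtained by filling in its missing coordinate. Leaves
therefore number at most `r / R` per hub, which makes crossings negligible. -/
theorem card_leaves_mul_le :
    (Finset.univ.image fun p : HubLabel r R × Fin r => leaf p.1 p.2).card * R ≤
      r * Fintype.card (HubLabel r R) := by
  have h1 := Finset.card_nsmul_le_sum
    (Finset.univ.image fun p : HubLabel r R × Fin r => leaf p.1 p.2)
    (fun x => (Finset.univ.filter fun p : HubLabel r R × Fin r => leaf p.1 p.2 = x).card) R ?_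
  · rw [← Finset.card_eq_sum_card_image, Finset.card_univ, Fintype.card_prod, Fintype.card_fin,
      smul_eq_mul, mul_comm (Fintype.card _)] at h1
    exact h1
  · intro x hx
    obtain ⟨⟨A, i⟩, -, rfl⟩ := Finset.mem_image.1 hx
    have : ((Finset.univ : Finset (Fin R)).image fun v => (Function.update A i v, i)).card = R := by
      rw [Finset.card_image_of_injective, Finset.card_univ, Fintype.card_fin]
      intro v w h
      have := congrFun (congrArg Prod.fst h) i
      simpa using this
    refine this.symm.le.trans (Finset.card_le_card fun p hp => ?_)
    obtain ⟨v, -, rfl⟩ := Finset.mem_image.1 hp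
    simp [leaf_update]

end StarCube

open StarCube

/-- The largest class of leaves of `B` in `I` which are joined by the relation `σ`. -/
def sliceClass {r R : ℕ} (σ : StarCube r R → StarCube r R → Prop) (B : HubLabel r R)
    (I : Finset (Fin r)) : Finset (Fin r) :=
  largestClass (fun i j => ReachIn σ Set.univ (leaf B i) (leaf B j)) I

/-- Successive largest classes over a list of slices; the last slice is the head of the list. -/
def nestedClass {r R : ℕ} {U : Type*} (ρ : U × StarCube r R → U × StarCube r R → Prop)
    (B : HubLabel r R) : List U → Finset (Fin r)
  | [] => Finset.univ
  | u :: l => sliceClass (fun w w' => ρ (u, w) (u, w')) B (nestedClass ρ B l)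

namespace ReachIn

theorem map {V V' : Type*} {ρ : V → V → Prop} {σ : V' → V' → Prop} (φ : V' → V)
    (h : ∀ a b, σ a b → ρ (φ a) (φ b)) {u v : V'} (huv : ReachIn σ Set.univ u v) :
    ReachIn ρ Set.univ (φ u) (φ v) := by
  induction huv with
  | single h' => exact .single trivial trivial (h _ _ h'.2.2)
  | tail _ h' ih => exact ih.trans (.single trivial trivial (h _ _ h'.2.2))

end ReachIn

/-! ### Classes of leaves in successive slices -/

/-- Constants for the local argument: `m` is a lower bound for the sizes of the classes that are
considered and `κ` is a small error. -/
structure LocalParams (P Q α κ m : ℝ) (r R : ℕ) : Prop where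
  P_nonneg : 0 ≤ P
  P_le_one : P ≤ 1
  Q_nonneg : 0 ≤ Q
  α_pos : 0 < α
  α_le_one : α ≤ 1
  κ_pos : 0 < κ
  κ_le_one : κ ≤ 1
  gap : 0 < (P - α - 4 * κ) * P - (1 + κ) * Q
  Q_add_le : Q + κ ≤ α * (α - 2 * κ)
  m_pos : 0 < m
  m_le : m ≤ α ^ 3 * r
  m_le_sub : m ≤ r - 1
  one_le : 1 ≤ κ * r
  R_pos : 0 < R

namespace LocalParams

variable {P Q α κ m : ℝ} {r R : ℕ}

/-- Bound for the probability that a typical slice has no large cluster. -/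
def sliceErr (P Q α κ m : ℝ) (r R : ℕ) : ℝ :=
  (r / R + 3 * Real.exp (-(κ ^ 4 / 4) * m)) / ((P - α - 4 * κ) * P - (1 + κ) * Q)

/-- Bound for the probability of an atypical fluctuation. -/
def flucErr (κ m : ℝ) : ℝ := Real.exp (-(κ ^ 4 / 4) * m)

theorem sliceErr_nonneg (hp : LocalParams P Q α κ m r R) : 0 ≤ sliceErr P Q α κ m r R :=
  div_nonneg (by positivity) hp.gap.le

theorem exp_le (hp : LocalParams P Q α κ m r R) {n : ℝ} (hn : m ≤ n) :
    Real.exp (-(κ ^ 2 / 4) * n) ≤ flucErr κ m := by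
  refine Real.exp_le_exp.2 ?_
  have hk4 : κ ^ 4 ≤ κ ^ 2 := pow_le_pow_of_le_one hp.κ_pos.le hp.κ_le_one (by norm_num)
  have := mul_le_mul hk4 hn hp.m_pos.le (by positivity)
  linarith

theorem Q_le_one (hp : LocalParams P Q α κ m r R) : Q ≤ 1 := by
  nlinarith [hp.Q_add_le, hp.α_le_one, hp.α_pos, hp.κ_pos, mul_pos hp.α_pos hp.κ_pos]

end LocalParams

namespace SiteBond

open LocalParams

variable {Ω : Type*} [Fintype Ω] {π : FinProb Ω} {r R : ℕ} {U : Type*}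
  (S : SiteBond π (U × StarCube r R)) {P Q α κ m : ℝ}

/-- This is what permits the class of a list to be frozen while a slice outside the list is
revealed. -/
theorem det_nestedClass (B : HubLabel r R) (l : List U) :
    S.Det {v | v.1 ∈ l} (fun ω => nestedClass (S.R ω) B l) := by
  intro ω ω' h
  induction l with
  | nil => rfl
  | cons u l ih =>
    have ih' := ih (h.mono fun v hv => List.mem_cons_of_mem _ hv)
    simp only [nestedClass] at ih' ⊢
    rw [ih']
    congr 1
    ext w w'
    exact h (u, w) (by simp) (u, w') (by simp)

theorem nestedClass_cons_subset (ω : Ω) (B : HubLabel r R) (u : U) (l : List U) :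
    nestedClass (S.R ω) B (u :: l) ⊆ nestedClass (S.R ω) B l := largestClass_subset

theorem nestedClass_reach {ω : Ω} {B : HubLabel r R} {u : U} {l : List U} {i j : Fin r}
    (hi : i ∈ nestedClass (S.R ω) B (u :: l)) (hj : j ∈ nestedClass (S.R ω) B (u :: l)) :
    ReachIn (fun w w' => S.R ω (u, w) (u, w')) Set.univ (leaf B i) (leaf B j) :=
  largestClass_rel (ρ := fun i j => ReachIn (fun w w' => S.R ω (u, w) (u, w')) Set.univ
    (leaf B i) (leaf B j)) (fun _ _ h => h.symm fun _ _ => S.symm ω _ _) (fun _ _ _ h h' => h.trans h') hi hj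

theorem nestedClass_good {ω : Ω} {B : HubLabel r R} {u : U} {l : List U} {j : Fin r}
    (hj : j ∈ nestedClass (S.R ω) B (u :: l)) : S.R ω (u, leaf B j) (u, leaf B j) :=
  S.reach_good_left ((S.nestedClass_reach hj hj).map (ρ := S.R ω) (fun w => (u, w))
    fun _ _ h => h)

/-- Passing to the slice `u` loses too large a part of the class of `l`. -/
def SmallClass (α m : ℝ) (u : U) (l : List U) (B : HubLabel r R) (ω : Ω) : Prop :=
  m ≤ (nestedClass (S.R ω) B l).card ∧
    ((nestedClass (S.R ω) B (u :: l)).card : ℝ) < α * (nestedClass (S.R ω) B l).card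

/-- Since `u ∉ l`, the classes of `l`, for all hubs at once, are independent of the slice `u`.
Frozen, they serve as the prescribed sets of leaves in `sum_noLargeCluster_le`, applied inside this
slice. -/
theorem sum_smallClass_le (hp : LocalParams P Q α κ m r R)
    (hgood : ∀ v, P ≤ π.Pr (fun ω => S.R ω v v))
    (hY : ∀ u B j, π.Pr (fun ω => S.Unlinked ω (u, hub B) (u, leaf B j)) ≤ Q)
    {u : U} {l : List U} (hu : u ∉ l) :
    ∑ B, π.Pr (S.SmallClass α m u l B) ≤
      Fintype.card (HubLabel r R) * sliceErr P Q α κ m r R := by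
  have hc := hp.gap
  let bad : (HubLabel r R → Finset (Fin r)) → HubLabel r R → Ω → Prop := fun I B ω =>
    m ≤ (I B).card ∧ ((sliceClass (fun w w' => S.R ω (u, w) (u, w')) B (I B)).card : ℝ) <
      α * (I B).card
  have hdis : Disjoint {v : U × StarCube r R | v.1 ∈ l} {v | v.1 = u} := by
    rw [Set.disjoint_left]
    rintro v hv rfl
    exact hu hv
  have hdet : ∀ I B, S.Det {v | v.1 = u} (bad I B) := by
    intro I B ω ω' h
    have : (fun w w' => S.R ω (u, w) (u, w')) = fun w w' => S.R ω' (u, w) (u, w') := by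
      ext w w'
      exact h (u, w) rfl (u, w') rfl
    simp only [bad, this]
  have key := S.freeze_le hdis (fun ω B => nestedClass (S.R ω) B l)
    (fun ω ω' h => funext fun B => S.det_nestedClass B l ω ω' h)
    (fun I ω => ∑ B, @ite ℝ (bad I B ω) (Classical.propDecidable _) 1 0)
    (fun I ω ω' h => Finset.sum_congr rfl fun B _ => by rw [hdet I B ω ω' h])
    (c := Fintype.card (HubLabel r R) * sliceErr P Q α κ m r R) ?_
  · rw [FinProb.E_sum] at key
    exact key
  · intro I
    rw [FinProb.E_sum]
    let S' : SiteBond π (StarCube r R) := S.comap (fun w => (u, w)) (Prod.mk_right_injective u)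
    have h1 := S'.sum_noLargeCluster_le (H := HubLabel r R) (J := Fin r) hub leaf I α (P := P)
      (Q := Q) (κ := κ) (m := m)
      ⟨hub_injective, fun _ _ _ _ h => leaf_dir h, fun _ _ _ => hub_ne_leaf _ _ _⟩ hp.P_le_one
      hp.κ_pos hp.κ_le_one hp.Q_nonneg hp.α_pos hp.gap hp.P_nonneg hp.m_pos
      (fun v => hgood (u, v)) (fun B j => hY u B j)
      ((Finset.univ.image fun p : HubLabel r R × Fin r => leaf p.1 p.2).card)
      (le_of_eq (by congr; exact Subsingleton.elim _ _)) Set.univ (fun _ => trivial)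
      (fun _ _ => trivial)
    have h2 : ∑ B, π.Pr (fun ω => bad I B ω) ≤
        ∑ B, π.Pr (fun ω => m ≤ (I B).card ∧
      ∀ j₀, (((I B).filter fun j => ReachIn (S'.R ω) Set.univ (leaf B j₀) (leaf B j)).card : ℝ) <
        α * (I B).card) := by
      refine Finset.sum_le_sum fun B _ => π.Pr_mono fun ω h => ⟨h.1, fun j₀ => ?_⟩
      refine lt_of_le_of_lt (Nat.cast_le.2 ?_) h.2
      exact card_le_largestClass (ρ := fun i j =>
        ReachIn (fun w w' => S.R ω (u, w) (u, w')) Set.univ (leaf B i) (leaf B j)) j₀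
    refine h2.trans ?_
    rw [sliceErr, mul_div_assoc', le_div_iff₀' hc]
    refine h1.trans ?_
    have hR : (0 : ℝ) < R := by exact_mod_cast hp.R_pos
    have h3 : ((Finset.univ.image fun p : HubLabel r R × Fin r => leaf p.1 p.2).card : ℝ) * R ≤
      r * Fintype.card (HubLabel r R) := by exact_mod_cast card_leaves_mul_le
    have h4 := (le_div_iff₀ hR).2 h3
    have h5 : (r : ℝ) * Fintype.card (HubLabel r R) / R = Fintype.card (HubLabel r R) * (r / R) := by
      ring
    rw [h5] at h4
    rw [mul_add]
    linarith

/-- Many parallel pairs of leaves between the slices `u` and `u'` are unlinked. -/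
def ManyUnlinked (α m : ℝ) (u u' : U) (l : List U) (B : HubLabel r R) (ω : Ω) : Prop :=
  m ≤ (nestedClass (S.R ω) B l).card ∧ α ^ 2 * (nestedClass (S.R ω) B l).card ≤
    ((nestedClass (S.R ω) B l).filter fun j =>
      S.Unlinked ω (u, leaf B j) (u', leaf B j)).card

/-- With the class frozen, pairs in different directions occupy disjoint sites and are unlinked with
probability at most `Q` each, while `Q + κ ≤ α ^ 2`. -/
theorem pr_manyUnlinked_le (hp : LocalParams P Q α κ m r R) {u u' : U} {l : List U}
    (hu : u ∉ l) (hu' : u' ∉ l)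
    (huu : ∀ w, π.Pr (fun ω => S.Unlinked ω (u, w) (u', w)) ≤ Q) (B : HubLabel r R) :
    π.Pr (S.ManyUnlinked α m u u' l B) ≤ flucErr κ m := by
  have hdis : Disjoint {v : U × StarCube r R | v.1 ∈ l} {v | v.1 = u ∨ v.1 = u'} := by
    rw [Set.disjoint_left]
    rintro v hv (rfl | rfl)
    · exact hu hv
    · exact hu' hv
  refine S.freeze_pr hdis (fun ω => nestedClass (S.R ω) B l) (S.det_nestedClass B l)
    (fun I ω => m ≤ I.card ∧ α ^ 2 * I.card ≤
      (I.filter fun j => S.Unlinked ω (u, leaf B j) (u', leaf B j)).card) ?_ ?_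
  · intro I ω ω' h
    have : ∀ j, S.Unlinked ω (u, leaf B j) (u', leaf B j) =
        S.Unlinked ω' (u, leaf B j) (u', leaf B j) := fun j =>
      S.det_unlinked (Or.inl rfl) (Or.inr rfl) ω ω' h
    simp only [this]
  · intro I
    by_cases hm : m ≤ I.card
    · have h1 := S.chernoff_card I (fun j => {(u, leaf B j), (u', leaf B j)}) ?_
        (fun j ω => S.Unlinked ω (u, leaf B j) (u', leaf B j))
        (fun j _ => S.det_unlinked (by simp) (by simp)) hp.Q_le_one (fun j _ => huu _) hp.κ_pos.le
        hp.κ_le_one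
      · refine le_trans (π.Pr_mono fun ω h => ?_) (h1.trans (hp.exp_le hm))
        refine le_trans ?_ h.2
        refine mul_le_mul_of_nonneg_right ?_ (Nat.cast_nonneg _)
        have := hp.Q_add_le
        nlinarith [mul_pos hp.α_pos hp.κ_pos]
      · intro i _ j _ hij
        have hne : leaf B i ≠ leaf B j := fun h => hij (leaf_dir h)
        simp [Set.disjoint_left, hne]
    · simp only [hm, false_and, FinProb.Pr, if_false]
      rw [π.E_const]
      exact (Real.exp_pos _).le

/-- Two successive classes keep a proportion `α ^ 2` of the class of `l`, more than the unlinked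
parallel pairs. The leaves of the inner class are good in both slices, so a pair that is not
unlinked is linked. -/
theorem exists_link {u u' : U} {l : List U} {B : HubLabel r R} {ω : Ω} (hα : 0 < α)
    (h0 : m ≤ (nestedClass (S.R ω) B l).card)
    (h1 : ¬ S.SmallClass α m u' l B ω)
    (h2 : α * (nestedClass (S.R ω) B (u' :: l)).card ≤ (nestedClass (S.R ω) B (u :: u' :: l)).card)
    (h3 : ¬ S.ManyUnlinked α m u u' l B ω) :
    ∃ j ∈ nestedClass (S.R ω) B (u :: u' :: l), S.R ω (u, leaf B j) (u', leaf B j) := by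
  by_contra hn
  push Not at hn
  simp only [SmallClass, h0, true_and, not_lt] at h1
  refine h3 ⟨h0, ?_⟩
  calc α ^ 2 * ((nestedClass (S.R ω) B l).card : ℝ)
      = α * (α * (nestedClass (S.R ω) B l).card) := by ring
    _ ≤ α * (nestedClass (S.R ω) B (u' :: l)).card := mul_le_mul_of_nonneg_left h1 hα.le
    _ ≤ (nestedClass (S.R ω) B (u :: u' :: l)).card := h2
    _ ≤ _ := by
      refine Nat.cast_le.2 (Finset.card_le_card fun j hj => ?_)
      have hj' := S.nestedClass_cons_subset ω B u _ hj
      exact Finset.mem_filter.2 ⟨S.nestedClass_cons_subset ω B u' _ hj',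
        S.nestedClass_good hj, S.nestedClass_good hj', hn j hj⟩

/-- At each step along the list the class keeps a proportion `α`. -/
def ChainOK (α : ℝ) (B : HubLabel r R) (ω : Ω) : List U → Prop
  | [] => True
  | u :: l => ChainOK α B ω l ∧
      α * (nestedClass (S.R ω) B l).card ≤ (nestedClass (S.R ω) B (u :: l)).card

theorem ChainOK.card_ge {B : HubLabel r R} {ω : Ω} (hα : 0 < α) : ∀ {l : List U},
    S.ChainOK α B ω l → α ^ l.length * r ≤ (nestedClass (S.R ω) B l).card
  | [], _ => by simp [nestedClass]
  | u :: l, h => by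
    have ih := ChainOK.card_ge hα h.1
    refine le_trans ?_ h.2
    rw [List.length_cons, pow_succ, mul_comm _ α, mul_assoc]
    exact mul_le_mul_of_nonneg_left ih hα.le

theorem ChainOK.le_card (hp : LocalParams P Q α κ m r R) {B : HubLabel r R} {ω : Ω} {l : List U}
    (h : S.ChainOK α B ω l) (hl : l.length ≤ 3) : m ≤ (nestedClass (S.R ω) B l).card := by
  refine hp.m_le.trans (le_trans ?_ (h.card_ge S hp.α_pos))
  exact mul_le_mul_of_nonneg_right (pow_le_pow_of_le_one hp.α_pos.le hp.α_le_one hl)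
    (Nat.cast_nonneg _)

/-- The length is limited to four so that the class preceding each step still has size at least `α ^
3 * r ≥ m`. -/
theorem sum_not_chainOK_le (hp : LocalParams P Q α κ m r R)
    (hgood : ∀ v, P ≤ π.Pr (fun ω => S.R ω v v))
    (hY : ∀ u B j, π.Pr (fun ω => S.Unlinked ω (u, hub B) (u, leaf B j)) ≤ Q) :
    ∀ l : List U, l.Nodup → l.length ≤ 4 →
    ∑ B, π.Pr (fun ω => ¬ S.ChainOK α B ω l) ≤
      l.length * (Fintype.card (HubLabel r R) * sliceErr P Q α κ m r R)
  | [], _, _ => by simp [ChainOK, FinProb.Pr, FinProb.E_const]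
  | u :: l, hn, hl => by
    rw [List.nodup_cons] at hn
    rw [List.length_cons] at hl
    have ih := sum_not_chainOK_le hp hgood hY l hn.2 (by omega)
    have h1 := S.sum_smallClass_le hp hgood hY hn.1
    rw [List.length_cons, Nat.cast_succ, add_mul, one_mul]
    refine le_trans ?_ (add_le_add ih h1)
    rw [← Finset.sum_add_distrib]
    refine Finset.sum_le_sum fun B _ => π.Pr_le_add fun ω h => ?_
    by_cases hc : S.ChainOK α B ω l
    · right
      refine ⟨hc.le_card S hp (by omega), ?_⟩
      by_contra hlt
      exact h ⟨hc, not_lt.1 hlt⟩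
    · exact Or.inl hc

end SiteBond

/-! ### Crossing horizontal and vertical clusters -/

/-- The sites of two copies of a product of two star-shaped cubes. -/
abbrev CopySite (r R : ℕ) := (Bool × StarCube r R) × StarCube r R

/-- The largest cluster of leaves around the hub pair `(A, B)` in the first direction, in the
copy `b`. -/
def xClass {r R : ℕ} (ρ : CopySite r R → CopySite r R → Prop) (b : Bool)
    (A B : HubLabel r R) : Finset (Fin r) :=
  sliceClass (fun x x' => ρ ((b, x), hub B) ((b, x'), hub B)) A Finset.univ

/-- The relation inside the copy `b`. -/
def copyRel {r R : ℕ} (ρ : CopySite r R → CopySite r R → Prop) (b : Bool)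
    (z z' : StarCube r R × StarCube r R) : Prop :=
  ρ ((b, z.1), z.2) ((b, z'.1), z'.2)

namespace SiteBond

open LocalParams

variable {Ω : Type*} [Fintype Ω] {π : FinProb Ω}

theorem unlinked_comm {V : Type*} (S : SiteBond π V) (ω : Ω) (u v : V) :
    S.Unlinked ω u v ↔ S.Unlinked ω v u := by
  have : S.R ω u v ↔ S.R ω v u := ⟨S.symm ω u v, S.symm ω v u⟩
  unfold Unlinked
  rw [this]
  tauto

theorem pr_unlinked_comm {V : Type*} (S : SiteBond π V) (u v : V) :
    π.Pr (fun ω => S.Unlinked ω u v) = π.Pr (fun ω => S.Unlinked ω v u) := by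
  simp only [S.unlinked_comm _ u v]

variable {r R : ℕ} (S : SiteBond π ((Bool × StarCube r R) × StarCube r R)) {P Q α κ m : ℝ}

/-- Sites are good with probability at least `P`, and neighbouring sites are both good and not
related with probability at most `Q`. -/
structure LocalHyp (P Q : ℝ) : Prop where
  good : ∀ v, P ≤ π.Pr (fun ω => S.R ω v v)
  unlX : ∀ b A i w, π.Pr (fun ω => S.Unlinked ω ((b, hub A), w) ((b, leaf A i), w)) ≤ Q
  unlY : ∀ u B j, π.Pr (fun ω => S.Unlinked ω (u, hub B) (u, leaf B j)) ≤ Q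
  unlE : ∀ b z w, π.Pr (fun ω => S.Unlinked ω ((b, z), w) ((!b, z), w)) ≤ Q

/-- The exchange of the two star-shaped cubes. -/
def exchange : SiteBond π ((Bool × StarCube r R) × StarCube r R) :=
  S.comap (fun v => ((v.1.1, v.2), v.1.2)) (by
    rintro ⟨⟨b, x⟩, y⟩ ⟨⟨b', x'⟩, y'⟩ h
    simp only [Prod.mk.injEq] at h ⊢
    tauto)

theorem LocalHyp.exchange (h : S.LocalHyp P Q) : S.exchange.LocalHyp P Q where
  good _ := h.good _
  unlX b A i w := h.unlY (b, w) A i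
  unlY u B j := h.unlX u.1 B j u.2
  unlE b z w := h.unlE b w z

theorem xClass_eq (ω : Ω) (b : Bool) (A B : HubLabel r R) :
    xClass (S.R ω) b A B = nestedClass (S.exchange.R ω) A [(b, hub B)] := rfl

theorem xClass_reach {ω : Ω} {b : Bool} {A B : HubLabel r R} {i i' : Fin r}
    (hi : i ∈ xClass (S.R ω) b A B) (hi' : i' ∈ xClass (S.R ω) b A B) :
    ReachIn (copyRel (S.R ω) b) Set.univ (leaf A i, hub B) (leaf A i', hub B) := by
  rw [xClass_eq] at hi hi'
  exact (S.exchange.nestedClass_reach hi hi').map (fun x => (x, hub B)) fun _ _ h => h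

theorem nestedClass_reach_copy {ω : Ω} {b : Bool} {x : StarCube r R} {B : HubLabel r R}
    {l : List (Bool × StarCube r R)} {j j' : Fin r}
    (hj : j ∈ nestedClass (S.R ω) B ((b, x) :: l)) (hj' : j' ∈ nestedClass (S.R ω) B ((b, x) :: l)) :
    ReachIn (copyRel (S.R ω) b) Set.univ (x, leaf B j) (x, leaf B j') :=
  (S.nestedClass_reach hj hj').map (fun y => (x, y)) fun _ _ h => h

/-- The cluster around `(A, B)` in the first direction is small. -/
def SmallX (α : ℝ) (b : Bool) (A B : HubLabel r R) (ω : Ω) : Prop :=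
  ((xClass (S.R ω) b A B).card : ℝ) < α * r

theorem sum_smallX_le (hp : LocalParams P Q α κ m r R) (hS : S.LocalHyp P Q) (b : Bool)
    (B : HubLabel r R) :
    ∑ A, π.Pr (S.SmallX α b A B) ≤ Fintype.card (HubLabel r R) * sliceErr P Q α κ m r R := by
  have h := S.exchange.sum_smallClass_le hp (hS.exchange S).good (hS.exchange S).unlY
    (u := (b, hub B)) (l := []) (by simp)
  refine le_trans (Finset.sum_le_sum fun A _ => π.Pr_mono fun ω hω => ⟨?_, ?_⟩) h
  · simp only [nestedClass, Finset.card_univ, Fintype.card_fin]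
    linarith [hp.m_le_sub]
  · rw [← xClass_eq]
    simp only [nestedClass, Finset.card_univ, Fintype.card_fin]
    exact hω

/-- The directions whose slices are not used by the list `l`. -/
def freshDirs (b : Bool) (A : HubLabel r R) (l : List (Bool × StarCube r R)) : Finset (Fin r) :=
  Finset.univ.filter fun i => (b, leaf A i) ∉ l

/-- Among the pairs joining the leaves of the first direction to the class of `l`, many are
unlinked. -/
def ManyUnlinkedPairs (Q κ m : ℝ) (b : Bool) (A : HubLabel r R) (l : List (Bool × StarCube r R))
    (B : HubLabel r R) (ω : Ω) : Prop :=
  m ≤ (nestedClass (S.R ω) B l).card ∧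
  (Q + κ) * (freshDirs b A l).card * (nestedClass (S.R ω) B l).card ≤
    ∑ i ∈ freshDirs b A l, (((nestedClass (S.R ω) B l).filter fun j =>
      S.Unlinked ω ((b, leaf A i), hub B) ((b, leaf A i), leaf B j)).card : ℝ)

/-- Pairs in one column share the site over `hub B` and need not be independent. The normalized
counts of different columns are independent and lie in `[0, 1]`, so the Chernoff bound is applied to
the columns. -/
theorem pr_manyUnlinkedPairs_le (hp : LocalParams P Q α κ m r R) (hS : S.LocalHyp P Q) (b : Bool)
    (A : HubLabel r R) (l : List (Bool × StarCube r R)) (B : HubLabel r R)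
    (hfresh : (r : ℝ) - 1 ≤ (freshDirs b A l).card) :
    π.Pr (S.ManyUnlinkedPairs Q κ m b A l B) ≤ flucErr κ m := by
  have hdis : Disjoint {v : (Bool × StarCube r R) × StarCube r R | v.1 ∈ l}
      {v | ∃ i ∈ freshDirs b A l, v.1 = (b, leaf A i)} := by
    rw [Set.disjoint_left]
    rintro v hv ⟨i, hi, he⟩
    have hv' : v.1 ∈ l := hv
    rw [he] at hv'
    exact (Finset.mem_filter.1 hi).2 hv'
  refine S.freeze_pr hdis (fun ω => nestedClass (S.R ω) B l) (S.det_nestedClass B l)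
    (fun I ω => m ≤ I.card ∧ (Q + κ) * (freshDirs b A l).card * I.card ≤
      ∑ i ∈ freshDirs b A l, ((I.filter fun j =>
        S.Unlinked ω ((b, leaf A i), hub B) ((b, leaf A i), leaf B j)).card : ℝ)) ?_ ?_
  · intro I ω ω' h
    refine congrArg (fun x : ℝ => m ≤ I.card ∧ (Q + κ) * (freshDirs b A l).card * I.card ≤ x) ?_
    refine Finset.sum_congr rfl fun i hi => ?_
    have : ∀ j, S.Unlinked ω ((b, leaf A i), hub B) ((b, leaf A i), leaf B j) =
        S.Unlinked ω' ((b, leaf A i), hub B) ((b, leaf A i), leaf B j) := fun j =>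
      S.det_unlinked (A := {v | ∃ i ∈ freshDirs b A l, v.1 = (b, leaf A i)})
        ⟨i, hi, rfl⟩ ⟨i, hi, rfl⟩ ω ω' h
    simp only [this]
  · intro I
    by_cases hm : m ≤ I.card
    · have hI : (0 : ℝ) < I.card := hp.m_pos.trans_le hm
      have h1 := S.chernoff (freshDirs b A l) (fun i => {v | v.1 = (b, leaf A i)}) ?_
        (fun i ω => ((I.filter fun j =>
          S.Unlinked ω ((b, leaf A i), hub B) ((b, leaf A i), leaf B j)).card : ℝ) / I.card) ?_
        (fun i _ ω => by positivity)
        (fun i _ ω => (div_le_one hI).2 (Nat.cast_le.2 (Finset.card_filter_le _ _)))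
        hp.Q_le_one ?_ hp.κ_pos.le hp.κ_le_one
      · refine le_trans (π.Pr_mono fun ω h => ?_)
          (h1.trans (hp.exp_le (hp.m_le_sub.trans hfresh)))
        rw [← Finset.sum_div, le_div_iff₀ hI]
        exact h.2
      · intro i _ j _ hij
        rw [Set.disjoint_left]
        intro v hv hv'
        have h2 : (b, leaf A i) = (b, leaf A j) := hv.symm.trans hv'
        exact hij (leaf_dir (Prod.mk.inj h2).2)
      · intro i _ ω ω' h
        have : ∀ j, S.Unlinked ω ((b, leaf A i), hub B) ((b, leaf A i), leaf B j) =
            S.Unlinked ω' ((b, leaf A i), hub B) ((b, leaf A i), leaf B j) := fun j =>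
          S.det_unlinked (A := {v | v.1 = (b, leaf A i)}) rfl rfl ω ω' h
        simp only [this]
      · intro i _
        have h2 : ∀ j ∈ I, π.Pr (fun ω =>
            S.Unlinked ω ((b, leaf A i), hub B) ((b, leaf A i), leaf B j)) ≤ Q :=
          fun j _ => hS.unlY _ _ _
        simp only [div_eq_mul_inv]
        rw [FinProb.E_mul_right, FinProb.E_card, ← div_eq_mul_inv, div_le_iff₀ hI]
        refine (Finset.sum_le_card_nsmul _ _ _ h2).trans ?_
        rw [nsmul_eq_mul, mul_comm]
    · simp only [hm, false_and, FinProb.Pr, if_false]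
      rw [π.E_const]
      exact (Real.exp_pos _).le

/-- The slice of the leaf in direction `i` cannot be used to join the cluster to the class of
`(b, hub A) :: l`. -/
def SliceFails (α m : ℝ) (b : Bool) (A : HubLabel r R) (l : List (Bool × StarCube r R))
    (B : HubLabel r R) (i : Fin r) (ω : Ω) : Prop :=
  S.SmallClass α m (b, leaf A i) ((b, hub A) :: l) B ω ∨
    S.ManyUnlinked α m (b, leaf A i) (b, hub A) l B ω

/-- The cluster around `(A, B)` in the first direction is joined to the class of
`(b, hub A) :: l`. -/
def CrossJoin (b : Bool) (A : HubLabel r R) (l : List (Bool × StarCube r R))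
    (B : HubLabel r R) (ω : Ω) : Prop :=
  (xClass (S.R ω) b A B).Nonempty ∧ (nestedClass (S.R ω) B ((b, hub A) :: l)).Nonempty ∧
  ∀ i ∈ xClass (S.R ω) b A B, ∀ j ∈ nestedClass (S.R ω) B ((b, hub A) :: l),
    ReachIn (copyRel (S.R ω) b) Set.univ (leaf A i, hub B) (hub A, leaf B j)

/-- If no usable column over the horizontal cluster links its site over `hub B` to the nested class
of that column, then each of these at least `(α - 2 * κ) * r` columns contributes `α * N.card`
unlinked pairs, contradicting the typical count. So some column `i₀` has such a link, and
`exists_link` connects this column to the one over `hub A`. -/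
theorem crossJoin_of (hp : LocalParams P Q α κ m r R) {b : Bool} {A B : HubLabel r R}
    {l : List (Bool × StarCube r R)} {ω : Ω} (hl : l.length ≤ 2)
    (hfresh : (r : ℝ) - 1 ≤ (freshDirs b A ((b, hub A) :: l)).card)
    (hch : S.ChainOK α B ω ((b, hub A) :: l)) (hX : ¬ S.SmallX α b A B ω)
    (hU : ¬ S.ManyUnlinkedPairs Q κ m b A ((b, hub A) :: l) B ω)
    (hF : (((freshDirs b A ((b, hub A) :: l)).filter fun i =>
      S.SliceFails α m b A l B i ω).card : ℝ) < κ * r) : S.CrossJoin b A l B ω := by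
  set N := nestedClass (S.R ω) B ((b, hub A) :: l) with hN
  set X := xClass (S.R ω) b A B with hXd
  set D := freshDirs b A ((b, hub A) :: l) with hD
  have hmN : m ≤ N.card := hch.le_card S hp (by rw [List.length_cons]; omega)
  have hml : m ≤ (nestedClass (S.R ω) B l).card := hch.1.le_card S hp (by omega)
  have hNpos : (0 : ℝ) < N.card := hp.m_pos.trans_le hmN
  have hα := hp.α_pos
  unfold SmallX at hX
  rw [not_lt, ← hXd] at hX
  have hr : (0 : ℝ) < r := by linarith [hp.m_pos, hp.m_le_sub]
  have hXpos : (0 : ℝ) < X.card := lt_of_lt_of_le (by positivity) hX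
  refine ⟨Finset.card_pos.1 (by exact_mod_cast hXpos), Finset.card_pos.1 (by exact_mod_cast hNpos),
    ?_⟩
  set G := (X ∩ D).filter fun i => ¬ S.SliceFails α m b A l B i ω with hG
  have hex : ∃ i ∈ G, ∃ j ∈ nestedClass (S.R ω) B ((b, leaf A i) :: (b, hub A) :: l),
      S.R ω ((b, leaf A i), hub B) ((b, leaf A i), leaf B j) := by
    by_contra hn
    push Not at hn
    refine hU ⟨hmN, ?_⟩
    rw [← hN, ← hD]
    have hcard : X.card ≤ G.card + (D.filter fun i => S.SliceFails α m b A l B i ω).card + Dᶜ.card := by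
      have : X ⊆ G ∪ (D.filter fun i => S.SliceFails α m b A l B i ω) ∪ Dᶜ := by
        intro i hi
        simp only [hG, Finset.mem_union, Finset.mem_filter, Finset.mem_inter, hi, true_and,
          Finset.mem_compl]
        tauto
      refine (Finset.card_le_card this).trans ((Finset.card_union_le _ _).trans ?_)
      exact Nat.add_le_add_right (Finset.card_union_le _ _) _
    have hDc : (D.card : ℝ) + Dᶜ.card = r := by
      have := Finset.card_add_card_compl D
      rw [Fintype.card_fin] at this
      exact_mod_cast this
    have hcard' : (X.card : ℝ) ≤ G.card + (D.filter fun i => S.SliceFails α m b A l B i ω).card +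
      Dᶜ.card := by exact_mod_cast hcard
    -- One `κ * r` accounts for the failing columns. The other absorbs the single column that may be
    -- missing from `D`, by `1 ≤ κ * r`.
    have hGc : (α - 2 * κ) * r ≤ G.card := by
      have := hp.one_le
      linarith
    have hDr : (D.card : ℝ) ≤ r := by linarith [Nat.cast_nonneg (α := ℝ) Dᶜ.card]
    have hterm : ∀ i ∈ G, α * N.card ≤ ((N.filter fun j =>
        S.Unlinked ω ((b, leaf A i), hub B) ((b, leaf A i), leaf B j)).card : ℝ) := by
      intro i hi
      have hi' := Finset.mem_filter.1 hi
      have hsf := hi'.2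
      simp only [SliceFails, SmallClass, not_or] at hsf
      rw [← hN] at hsf
      have hsz : α * N.card ≤ (nestedClass (S.R ω) B ((b, leaf A i) :: (b, hub A) :: l)).card := by
        by_contra hlt
        exact hsf.1 ⟨hmN, not_le.1 hlt⟩
      refine hsz.trans (Nat.cast_le.2 (Finset.card_le_card fun j hj => ?_))
      refine Finset.mem_filter.2 ⟨S.nestedClass_cons_subset ω B _ _ hj, ?_, S.nestedClass_good hj,
        hn i hi j hj⟩
      have hiX := (Finset.mem_inter.1 hi'.1).1
      rw [hXd, xClass_eq] at hiX
      exact S.exchange.nestedClass_good hiX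
    have hQ := hp.Q_add_le
    have hQ0 : 0 ≤ Q + κ := add_nonneg hp.Q_nonneg hp.κ_pos.le
    calc (Q + κ) * D.card * N.card ≤ (Q + κ) * r * N.card := by gcongr
      _ ≤ α * (α - 2 * κ) * r * N.card := by gcongr
      _ = ((α - 2 * κ) * r) * (α * N.card) := by ring
      _ ≤ G.card * (α * N.card) := mul_le_mul_of_nonneg_right hGc (by positivity)
      _ = ∑ i ∈ G, (α * N.card) := by rw [Finset.sum_const, nsmul_eq_mul]
      _ ≤ ∑ i ∈ G, ((N.filter fun j =>
          S.Unlinked ω ((b, leaf A i), hub B) ((b, leaf A i), leaf B j)).card : ℝ) :=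
          Finset.sum_le_sum hterm
      _ ≤ _ := Finset.sum_le_sum_of_subset_of_nonneg
          (fun i hi => (Finset.mem_inter.1 (Finset.mem_filter.1 hi).1).2)
          fun _ _ _ => Nat.cast_nonneg _
  obtain ⟨i₀, hi₀, j₀, hj₀, hR₀⟩ := hex
  have hi₀' := Finset.mem_filter.1 hi₀
  have hsf := hi₀'.2
  simp only [SliceFails, not_or] at hsf
  obtain ⟨j₁, hj₁, hR₁⟩ := S.exists_link hα hml (fun h => not_lt.2 hch.2 h.2)
    (not_lt.1 fun h => hsf.1 ⟨hmN, h⟩) hsf.2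
  intro i hi j hj
  have p1 := S.xClass_reach hi (Finset.mem_inter.1 hi₀'.1).1
  have p2 : ReachIn (copyRel (S.R ω) b) Set.univ (leaf A i₀, hub B) (leaf A i₀, leaf B j₀) :=
    .single trivial trivial hR₀
  have p3 := S.nestedClass_reach_copy hj₀ hj₁
  have p4 : ReachIn (copyRel (S.R ω) b) Set.univ (leaf A i₀, leaf B j₁) (hub A, leaf B j₁) :=
    .single trivial trivial hR₁
  have p5 := S.nestedClass_reach_copy (S.nestedClass_cons_subset ω B _ _ hj₁) hj
  exact p1.trans (p2.trans (p3.trans (p4.trans p5)))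

/-- Error bound for `CrossJoin`. -/
def _root_.LocalParams.crossErr (P Q α κ m : ℝ) (r R : ℕ) : ℝ :=
  3 * sliceErr P Q α κ m r R + flucErr κ m +
    (sliceErr P Q α κ m r R + flucErr κ m) / κ

/-- Here `A` is fixed and `B` is averaged, because the nested classes are controlled in this way.
The term `SmallX` is kept since it is controlled by averaging over `A` with `B` fixed. -/
theorem sum_not_crossJoin_le (hp : LocalParams P Q α κ m r R) (hS : S.LocalHyp P Q) (b : Bool)
    (A : HubLabel r R) (l : List (Bool × StarCube r R)) (hl : l.length ≤ 2)
    (hnd : ((b, hub A) :: l).Nodup)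
    (hfresh : (r : ℝ) - 1 ≤ (freshDirs b A ((b, hub A) :: l)).card) :
    ∑ B, π.Pr (fun ω => ¬ S.CrossJoin b A l B ω) ≤
      ∑ B, π.Pr (S.SmallX α b A B) +
        Fintype.card (HubLabel r R) * crossErr P Q α κ m r R := by
  set h := (Fintype.card (HubLabel r R) : ℝ) with hh
  have hr : (0 : ℝ) < r := by linarith [hp.m_pos, hp.m_le_sub]
  have hκ := hp.κ_pos
  set D := freshDirs b A ((b, hub A) :: l) with hD
  have hDr : (D.card : ℝ) ≤ r := by
    have := Finset.card_le_univ D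
    rw [Fintype.card_fin] at this
    exact_mod_cast this
  set s := sliceErr P Q α κ m r R with hs
  set e := flucErr κ m with he
  have he0 : 0 ≤ e := (Real.exp_pos _).le
  have hs0 : 0 ≤ s := hp.sliceErr_nonneg
  have hh0 : 0 ≤ h := Nat.cast_nonneg _
  have b1 : ∑ B, π.Pr (fun ω => ¬ S.ChainOK α B ω ((b, hub A) :: l)) ≤ 3 * (h * s) := by
    refine (S.sum_not_chainOK_le hp hS.good hS.unlY _ hnd (by rw [List.length_cons]; omega)).trans ?_
    refine mul_le_mul_of_nonneg_right ?_ (by positivity)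
    rw [List.length_cons]
    exact_mod_cast (by omega : l.length + 1 ≤ 3)
  have b2 : ∑ B, π.Pr (S.ManyUnlinkedPairs Q κ m b A ((b, hub A) :: l) B) ≤ h * e := by
    refine (Finset.sum_le_card_nsmul _ _ e fun B _ =>
      S.pr_manyUnlinkedPairs_le hp hS b A _ B hfresh).trans ?_
    rw [nsmul_eq_mul, Finset.card_univ]
  -- Markov's inequality: on average at most a proportion `s + e` of the columns fails.
  have b3 : ∑ B, π.Pr (fun ω => κ * r ≤ ((D.filter fun i =>
      S.SliceFails α m b A l B i ω).card : ℝ)) ≤ h * ((s + e) / κ) := by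
    have h1 : κ * r * ∑ B, π.Pr (fun ω => κ * r ≤ ((D.filter fun i =>
        S.SliceFails α m b A l B i ω).card : ℝ)) ≤ r * (h * (s + e)) := by
      rw [Finset.mul_sum]
      have h2 : ∀ B, κ * r * π.Pr (fun ω => κ * r ≤ ((D.filter fun i =>
          S.SliceFails α m b A l B i ω).card : ℝ)) ≤
          ∑ i ∈ D, (π.Pr (S.SmallClass α m (b, leaf A i) ((b, hub A) :: l) B) + e) := by
        intro B
        refine (π.markov (fun ω => Nat.cast_nonneg _) _).trans ?_
        rw [FinProb.E_card]
        refine Finset.sum_le_sum fun i hi => (π.Pr_or _ _).trans (add_le_add_right ?_ _)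
        rw [List.nodup_cons] at hnd
        refine S.pr_manyUnlinked_le hp (fun h => ?_) hnd.1 (fun w => ?_) B
        · exact (Finset.mem_filter.1 hi).2 (List.mem_cons_of_mem _ h)
        · rw [S.pr_unlinked_comm]
          exact hS.unlX _ _ _ _
      refine (Finset.sum_le_sum fun B _ => h2 B).trans ?_
      rw [Finset.sum_comm]
      have h3 : ∀ i ∈ D, ∑ B, (π.Pr (S.SmallClass α m (b, leaf A i) ((b, hub A) :: l) B) + e) ≤
          h * (s + e) := by
        intro i hi
        rw [Finset.sum_add_distrib, Finset.sum_const, nsmul_eq_mul, Finset.card_univ, mul_add]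
        exact add_le_add_left
          (S.sum_smallClass_le hp hS.good hS.unlY (Finset.mem_filter.1 hi).2) _
      refine (Finset.sum_le_card_nsmul _ _ _ h3).trans ?_
      rw [nsmul_eq_mul]
      exact mul_le_mul_of_nonneg_right hDr (by positivity)
    rw [mul_div_assoc', le_div_iff₀ hκ]
    have h4 : r * (κ * ∑ B, π.Pr (fun ω => κ * r ≤ ((D.filter fun i =>
        S.SliceFails α m b A l B i ω).card : ℝ))) ≤ r * (h * (s + e)) := by
      rw [← mul_assoc, mul_comm (r : ℝ) κ]; exact h1
    have := le_of_mul_le_mul_left h4 hr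
    linarith
  have hall : ∑ B, π.Pr (fun ω => ¬ S.CrossJoin b A l B ω) ≤
      ∑ B, (π.Pr (S.SmallX α b A B) + (π.Pr (fun ω => ¬ S.ChainOK α B ω ((b, hub A) :: l)) +
        (π.Pr (S.ManyUnlinkedPairs Q κ m b A ((b, hub A) :: l) B) +
        π.Pr (fun ω => κ * r ≤ ((D.filter fun i =>
          S.SliceFails α m b A l B i ω).card : ℝ))))) := by
    refine Finset.sum_le_sum fun B _ => ?_
    refine le_trans (π.Pr_mono fun ω hω => ?_) ((π.Pr_or _ _).trans (add_le_add_right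
      ((π.Pr_or _ _).trans (add_le_add_right (π.Pr_or _ _) _)) _))
    by_contra hn
    simp only [not_or, not_not, not_le] at hn
    exact hω (S.crossJoin_of hp hl hfresh hn.2.1 hn.1 hn.2.2.1 hn.2.2.2)
  refine hall.trans ?_
  rw [Finset.sum_add_distrib, Finset.sum_add_distrib, Finset.sum_add_distrib]
  refine add_le_add_right ?_ _
  unfold crossErr
  rw [← hs, ← he]
  have : h * (3 * s + e + (s + e) / κ) = 3 * (h * s) + (h * e + h * ((s + e) / κ)) := by ring
  rw [this]
  exact add_le_add b1 (add_le_add b2 b3)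

end SiteBond

/-! ### Joining the clusters of different hub pairs -/

theorem sum_sum_piecewise_swap {ι β : Type*} [Fintype (ι → β)] (s : Finset ι)
    [∀ j, Decidable (j ∈ s)] (F : (ι → β) → (ι → β) → ℝ) :
    ∑ A, ∑ A', F (s.piecewise A' A) (s.piecewise A A') = ∑ A, ∑ A', F A A' := by
  -- Exchanging the coordinates in `s` is an involution on pairs. Thus a uniform hub whose
  -- coordinates are partly replaced by those of an independent one is still uniform.
  let f : (ι → β) × (ι → β) → (ι → β) × (ι → β) :=
    fun p => (s.piecewise p.2 p.1, s.piecewise p.1 p.2)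
  have hf : Function.Involutive f := by
    rintro ⟨A, A'⟩
    simp only [f, Prod.mk.injEq]
    constructor <;> ext i <;> by_cases hi : i ∈ s <;> simp [hi]
  rw [← Fintype.sum_prod_type', ← Fintype.sum_prod_type']
  exact Equiv.sum_comp hf.toPerm (fun p => F p.1 p.2)

namespace SiteBond

open LocalParams

variable {Ω : Type*} [Fintype Ω] {π : FinProb Ω}
  {r R : ℕ} (S : SiteBond π (CopySite r R)) {P Q α κ m : ℝ}

/-- The clusters in the first direction around two hub pairs are joined inside the copy `b`. -/
def PairJoin (b : Bool) (p p' : HubLabel r R × HubLabel r R) (ω : Ω) : Prop :=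
  (xClass (S.R ω) b p.1 p.2).Nonempty ∧ (xClass (S.R ω) b p'.1 p'.2).Nonempty ∧
  ∀ i ∈ xClass (S.R ω) b p.1 p.2, ∀ i' ∈ xClass (S.R ω) b p'.1 p'.2,
    ReachIn (copyRel (S.R ω) b) Set.univ (leaf p.1 i, hub p.2) (leaf p'.1 i', hub p'.2)

variable {S} in
theorem PairJoin.trans {b : Bool} {p p' p'' : HubLabel r R × HubLabel r R} {ω : Ω}
    (h : S.PairJoin b p p' ω) (h' : S.PairJoin b p' p'' ω) : S.PairJoin b p p'' ω := by
  obtain ⟨h1, ⟨j, hj⟩, h2⟩ := h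
  exact ⟨h1, h'.2.1, fun i hi i' hi' => (h2 i hi j hj).trans (h'.2.2 j hj i' hi')⟩

theorem reach_symm_copy {ω : Ω} {b : Bool} {z z' : StarCube r R × StarCube r R}
    (h : ReachIn (copyRel (S.R ω) b) Set.univ z z') :
    ReachIn (copyRel (S.R ω) b) Set.univ z' z :=
  h.symm fun _ _ h => S.symm ω _ _ h

/-- Hubs that differ only in coordinate `t` share the leaf in direction `t`. The columns over the
first hub, this leaf and the second hub are linked consecutively by `exists_link`, and `CrossJoin`
ties each hub column to its horizontal cluster. The classes of the three columns are nested, so a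
single list serves both links. -/
theorem pairJoin_update_of (hp : LocalParams P Q α κ m r R) {b : Bool} {A B : HubLabel r R}
    {t : Fin r} {v : Fin R} {ω : Ω} (h1 : S.CrossJoin b A [] B ω)
    (h2 : S.CrossJoin b (Function.update A t v) [(b, leaf A t), (b, hub A)] B ω)
    (hch : S.ChainOK α B ω [(b, hub (Function.update A t v)), (b, leaf A t), (b, hub A)])
    (hu1 : ¬ S.ManyUnlinked α m (b, leaf A t) (b, hub A) [] B ω)
    (hu2 : ¬ S.ManyUnlinked α m (b, hub (Function.update A t v)) (b, leaf A t) [(b, hub A)] B ω) :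
    S.PairJoin b (A, B) (Function.update A t v, B) ω := by
  refine ⟨h1.1, h2.1, fun i hi i' hi' => ?_⟩
  have hα := hp.α_pos
  obtain ⟨j₁, hj₁, hR₁⟩ := S.exists_link hα (hch.1.1.1.le_card S hp (by simp))
    (fun h => not_lt.2 hch.1.1.2 h.2) hch.1.2 hu1
  obtain ⟨j₂, hj₂, hR₂⟩ := S.exists_link hα (hch.1.1.le_card S hp (by simp))
    (fun h => not_lt.2 hch.1.2 h.2) hch.2 hu2
  have p1 := h1.2.2 i hi j₁ (S.nestedClass_cons_subset ω B _ _ hj₁)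
  have p2 : ReachIn (copyRel (S.R ω) b) Set.univ (leaf A t, leaf B j₁) (hub A, leaf B j₁) :=
    .single trivial trivial hR₁
  have p3 := S.nestedClass_reach_copy hj₁ (S.nestedClass_cons_subset ω B _ _ hj₂)
  have p4 : ReachIn (copyRel (S.R ω) b) Set.univ (hub (Function.update A t v), leaf B j₂)
    (leaf A t, leaf B j₂) := .single trivial trivial hR₂
  have p5 := h2.2.2 i' hi' j₂ hj₂
  exact p1.trans ((S.reach_symm_copy p2).trans (p3.trans ((S.reach_symm_copy p4).trans
    (S.reach_symm_copy p5))))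

theorem freshDirs_card_ge (b : Bool) (A : HubLabel r R) (l : List (Bool × StarCube r R))
    (t : Fin r) (h : ∀ i, (b, leaf A i) ∈ l → i = t) : (r : ℝ) - 1 ≤ (freshDirs b A l).card := by
  have h1 : (Finset.univ.erase t) ⊆ freshDirs b A l := fun i hi =>
    Finset.mem_filter.2 ⟨Finset.mem_univ _, fun hm => (Finset.mem_erase.1 hi).1 (h i hm)⟩
  have h2 := Finset.card_le_card h1
  rw [Finset.card_erase_of_mem (Finset.mem_univ _), Finset.card_univ, Fintype.card_fin] at h2
  have h3 : r ≤ (freshDirs b A l).card + 1 := by omega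
  have h4 : (r : ℝ) ≤ (freshDirs b A l).card + 1 := by exact_mod_cast h3
  linarith

theorem freshDirs_card_ge' (b : Bool) (A : HubLabel r R) (l : List (Bool × StarCube r R))
    (h : ∀ i, (b, leaf A i) ∉ l) : (r : ℝ) - 1 ≤ (freshDirs b A l).card := by
  have h1 : freshDirs b A l = Finset.univ := Finset.filter_true_of_mem fun i _ => h i
  rw [h1, Finset.card_univ, Fintype.card_fin]
  linarith

theorem sum_not_crossJoin_nil_le (hp : LocalParams P Q α κ m r R) (hS : S.LocalHyp P Q) (b : Bool)
    (A : HubLabel r R) :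
    ∑ B, π.Pr (fun ω => ¬ S.CrossJoin b A [] B ω) ≤
      ∑ B, π.Pr (S.SmallX α b A B) +
        Fintype.card (HubLabel r R) * crossErr P Q α κ m r R :=
  S.sum_not_crossJoin_le hp hS b A [] (by simp) (by simp)
    (freshDirs_card_ge' b A _ fun i h => by simp [(hub_ne_leaf A A i).symm] at h)

theorem not_pairJoin_self {α : ℝ} (hα : 0 < α) (hr : 0 < r) {b : Bool} {A B : HubLabel r R} {ω : Ω}
    (h : ¬ S.PairJoin b (A, B) (A, B) ω) : S.SmallX α b A B ω := by
  by_contra hn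
  unfold SmallX at hn
  have hpos : (0 : ℝ) < (xClass (S.R ω) b A B).card :=
    lt_of_lt_of_le (by positivity) (not_lt.1 hn)
  have hne : (xClass (S.R ω) b A B).Nonempty := Finset.card_pos.1 (by exact_mod_cast hpos)
  exact h ⟨hne, hne, fun i hi i' hi' => S.xClass_reach hi hi'⟩

/-- Error bound for changing one coordinate of a hub. -/
def _root_.LocalParams.updateErr (P Q α κ m : ℝ) (r R : ℕ) : ℝ :=
  2 * crossErr P Q α κ m r R + 3 * sliceErr P Q α κ m r R + 2 * flucErr κ m

theorem _root_.LocalParams.crossErr_nonneg (hp : LocalParams P Q α κ m r R) :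
    0 ≤ crossErr P Q α κ m r R := by
  have h1 := hp.sliceErr_nonneg
  have h2 : 0 ≤ flucErr κ m := (Real.exp_pos _).le
  have := hp.κ_pos
  unfold crossErr
  positivity

theorem sum_not_pairJoin_update_le (hp : LocalParams P Q α κ m r R) (hS : S.LocalHyp P Q)
    (b : Bool) (A : HubLabel r R) (t : Fin r) (v : Fin R) :
    ∑ B, π.Pr (fun ω => ¬ S.PairJoin b (A, B) (Function.update A t v, B) ω) ≤
      ∑ B, π.Pr (S.SmallX α b A B) + ∑ B, π.Pr (S.SmallX α b (Function.update A t v) B) +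
        Fintype.card (HubLabel r R) * updateErr P Q α κ m r R := by
  set h := (Fintype.card (HubLabel r R) : ℝ) with hh
  have hh0 : 0 ≤ h := Nat.cast_nonneg _
  have hs0 := hp.sliceErr_nonneg
  have he0 : 0 ≤ flucErr κ m := (Real.exp_pos _).le
  have hc0 := hp.crossErr_nonneg
  -- An update that changes nothing is treated apart, as the three columns would not be distinct.
  by_cases hA : Function.update A t v = A
  · rw [hA]
    have h1 : ∑ B, π.Pr (fun ω => ¬ S.PairJoin b (A, B) (A, B) ω) ≤
        ∑ B, π.Pr (S.SmallX α b A B) :=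
      Finset.sum_le_sum fun B _ => π.Pr_mono fun ω hω => S.not_pairJoin_self hp.α_pos t.pos hω
    have h2 : 0 ≤ ∑ B, π.Pr (S.SmallX α b A B) := Finset.sum_nonneg fun _ _ => π.Pr_nonneg _
    have h3 : 0 ≤ h * updateErr P Q α κ m r R := by unfold updateErr; positivity
    linarith
  set A'' := Function.update A t v with hA''
  have hne : hub A'' ≠ hub A := fun h => hA (hub_injective h)
  have hnd : [(b, hub A''), (b, leaf A t), (b, hub A)].Nodup := by
    simp [hne, hub_ne_leaf A'' A t, (hub_ne_leaf A A t).symm]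
  have b1 := S.sum_not_crossJoin_nil_le hp hS b A
  have b2 := S.sum_not_crossJoin_le hp hS b A'' [(b, leaf A t), (b, hub A)] (by simp) hnd
    (freshDirs_card_ge b A'' _ t fun i hi => by
      simp only [List.mem_cons, Prod.mk.injEq, true_and, (hub_ne_leaf _ _ _).symm, false_or,
        List.not_mem_nil, or_false] at hi
      exact leaf_dir hi)
  have b3 := S.sum_not_chainOK_le hp hS.good hS.unlY _ hnd (by simp)
  have b4 : ∑ B, π.Pr (S.ManyUnlinked α m (b, leaf A t) (b, hub A) [] B) ≤ h * flucErr κ m := by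
    refine (Finset.sum_le_card_nsmul _ _ _ fun B _ => S.pr_manyUnlinked_le hp (by simp) (by simp)
      (fun w => ?_) B).trans ?_
    · rw [S.pr_unlinked_comm]; exact hS.unlX _ _ _ _
    · rw [nsmul_eq_mul, Finset.card_univ]
  have b5 : ∑ B, π.Pr (S.ManyUnlinked α m (b, hub A'') (b, leaf A t) [(b, hub A)] B) ≤
      h * flucErr κ m := by
    refine (Finset.sum_le_card_nsmul _ _ _ fun B _ => S.pr_manyUnlinked_le hp (by simp [hne])
      (by simp [(hub_ne_leaf A A t).symm]) (fun w => ?_) B).trans ?_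
    · rw [← leaf_update A t v]; exact hS.unlX _ _ _ _
    · rw [nsmul_eq_mul, Finset.card_univ]
  have hall : ∑ B, π.Pr (fun ω => ¬ S.PairJoin b (A, B) (A'', B) ω) ≤
      ∑ B, (π.Pr (fun ω => ¬ S.CrossJoin b A [] B ω) +
        (π.Pr (fun ω => ¬ S.CrossJoin b A'' [(b, leaf A t), (b, hub A)] B ω) +
        (π.Pr (fun ω => ¬ S.ChainOK α B ω [(b, hub A''), (b, leaf A t), (b, hub A)]) +
        (π.Pr (S.ManyUnlinked α m (b, leaf A t) (b, hub A) [] B) +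
        π.Pr (S.ManyUnlinked α m (b, hub A'') (b, leaf A t) [(b, hub A)] B))))) := by
    refine Finset.sum_le_sum fun B _ => ?_
    refine le_trans (π.Pr_mono fun ω hω => ?_) ((π.Pr_or _ _).trans (add_le_add_right
      ((π.Pr_or _ _).trans (add_le_add_right ((π.Pr_or _ _).trans (add_le_add_right
      (π.Pr_or _ _) _)) _)) _))
    by_contra hn
    simp only [not_or, not_not] at hn
    exact hω (S.pairJoin_update_of hp hn.1 hn.2.1 hn.2.2.1 hn.2.2.2.1 hn.2.2.2.2)
  refine hall.trans ?_
  simp only [Finset.sum_add_distrib]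
  unfold updateErr
  simp only [List.length_cons, List.length_nil] at b3
  push_cast at b3
  have : h * (2 * crossErr P Q α κ m r R + 3 * sliceErr P Q α κ m r R + 2 * flucErr κ m) =
      h * crossErr P Q α κ m r R + h * crossErr P Q α κ m r R +
      (0 + 1 + 1 + 1) * (h * sliceErr P Q α κ m r R) + h * flucErr κ m + h * flucErr κ m := by ring
  rw [this]
  linarith

theorem sum_update_le (hp : LocalParams P Q α κ m r R) (hS : S.LocalHyp P Q)
    (b : Bool) (t : Fin r) :
    ∑ A, ∑ A' : HubLabel r R, ∑ B,
      π.Pr (fun ω => ¬ S.PairJoin b (A, B) (Function.update A t (A' t), B) ω) ≤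
      (Fintype.card (HubLabel r R)) ^ 3 *
        (2 * sliceErr P Q α κ m r R + updateErr P Q α κ m r R) := by
  set h := (Fintype.card (HubLabel r R) : ℝ) with hh
  have hs : ∑ A, ∑ B, π.Pr (S.SmallX α b A B) ≤ h * (h * sliceErr P Q α κ m r R) := by
    rw [Finset.sum_comm]
    refine (Finset.sum_le_card_nsmul _ _ _ fun B _ => S.sum_smallX_le hp hS b B).trans ?_
    rw [nsmul_eq_mul, Finset.card_univ]
  have hsw := sum_sum_piecewise_swap (ι := Fin r) (β := Fin R) {t}
    (fun A _ => ∑ B, π.Pr (S.SmallX α b A B))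
  simp only [Finset.piecewise_singleton, Finset.sum_const, Finset.card_univ, nsmul_eq_mul] at hsw
  have h1 := Finset.sum_le_sum fun A (_ : A ∈ Finset.univ) => Finset.sum_le_sum
    fun A' (_ : A' ∈ Finset.univ) => S.sum_not_pairJoin_update_le hp hS b A t ((A' : HubLabel r R) t)
  refine h1.trans ?_
  simp only [Finset.sum_add_distrib, Finset.sum_const, Finset.card_univ, nsmul_eq_mul]
  rw [hsw, ← Finset.mul_sum, ← hh]
  have hh0 : 0 ≤ h := Nat.cast_nonneg _
  have := mul_le_mul_of_nonneg_left hs hh0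
  nlinarith

/-- Error bound for changing the whole hub. -/
def _root_.LocalParams.pathErr (P Q α κ m : ℝ) (r R : ℕ) : ℝ :=
  r * (2 * sliceErr P Q α κ m r R + updateErr P Q α κ m r R)

theorem sum_path_le (hp : LocalParams P Q α κ m r R) (hS : S.LocalHyp P Q) (b : Bool) :
    ∑ A, ∑ A' : HubLabel r R, ∑ B, π.Pr (fun ω => ¬ S.PairJoin b (A, B) (A', B) ω) ≤
      (Fintype.card (HubLabel r R)) ^ 3 * pathErr P Q α κ m r R := by
  have hr : 0 < r := by
    have : (0 : ℝ) < r := by linarith [hp.m_pos, hp.m_le_sub]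
    exact_mod_cast this
  -- Coordinates of `A` are replaced by those of `A'` from left to right. The complementary mixture
  -- `(W t).piecewise A A'` still carries `A' t`, so after the swap each step has the form bounded
  -- in `sum_update_le`.
  let W : ℕ → Finset (Fin r) := fun n => Finset.univ.filter fun i => i.val < n
  have hW0 : ∀ A A' : HubLabel r R, (W 0).piecewise A' A = A := fun A A' => by
    ext i; simp [W]
  have hWr : ∀ A A' : HubLabel r R, (W r).piecewise A' A = A' := fun A A' => by
    ext i; simp [W, Finset.piecewise]
  have hWs : ∀ (A A' : HubLabel r R) (t : Fin r), (W (t + 1)).piecewise A' A =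
      Function.update ((W t).piecewise A' A) t (((W t).piecewise A A') t) := fun A A' t => by
    ext i
    by_cases hi : i = t
    · subst hi; simp [W, Finset.piecewise]
    · have : (i : ℕ) ≠ t := fun h => hi (Fin.ext h)
      have h3 : i ≤ t ↔ i < t := ⟨fun h => lt_of_le_of_ne h hi, le_of_lt⟩
      simp [W, Finset.piecewise, hi, h3]
  have hone : ∀ A A' B : HubLabel r R, π.Pr (fun ω => ¬ S.PairJoin b (A, B) (A', B) ω) ≤
      ∑ t : Fin r, π.Pr (fun ω => ¬ S.PairJoin b ((W t).piecewise A' A, B)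
        (Function.update ((W t).piecewise A' A) t (((W t).piecewise A A') t), B) ω) := by
    intro A A' B
    refine le_trans (π.Pr_mono fun ω hω => ?_) (π.Pr_exists_le Finset.univ _)
    by_contra hn
    push Not at hn
    have key : ∀ n, n < r → S.PairJoin b (A, B) ((W (n + 1)).piecewise A' A, B) ω := by
      intro n
      induction n with
      | zero =>
        intro h0
        have := hn ⟨0, h0⟩ (Finset.mem_univ _)
        rw [← hWs] at this
        simpa only [hW0] using this
      | succ n ih =>
        intro hn'
        have := hn ⟨n + 1, hn'⟩ (Finset.mem_univ _)
        rw [← hWs] at this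
        exact (ih (by omega)).trans this
    have := key (r - 1) (by omega)
    rw [Nat.sub_add_cancel hr, hWr] at this
    exact hω this
  have h1 := Finset.sum_le_sum fun A (_ : A ∈ Finset.univ) => Finset.sum_le_sum
    fun A' (_ : A' ∈ Finset.univ) => Finset.sum_le_sum fun B (_ : B ∈ Finset.univ) => hone A A' B
  refine h1.trans ?_
  have h2 : ∀ t : Fin r, ∑ A, ∑ A', ∑ B, π.Pr (fun ω => ¬ S.PairJoin b ((W t).piecewise A' A, B)
        (Function.update ((W t).piecewise A' A) t (((W t).piecewise A A') t), B) ω) ≤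
      (Fintype.card (HubLabel r R)) ^ 3 *
        (2 * sliceErr P Q α κ m r R + updateErr P Q α κ m r R) := by
    intro t
    rw [sum_sum_piecewise_swap (W t) (fun A A' => ∑ B, π.Pr (fun ω => ¬ S.PairJoin b (A, B)
        (Function.update A t (A' t), B) ω))]
    exact S.sum_update_le hp hS b t
  have h3 : ∑ A : HubLabel r R, ∑ A', ∑ B, ∑ t : Fin r,
      π.Pr (fun ω => ¬ S.PairJoin b ((W t).piecewise A' A, B)
        (Function.update ((W t).piecewise A' A) t (((W t).piecewise A A') t), B) ω) =
      ∑ t : Fin r, ∑ A, ∑ A', ∑ B, π.Pr (fun ω => ¬ S.PairJoin b ((W t).piecewise A' A, B)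
        (Function.update ((W t).piecewise A' A) t (((W t).piecewise A A') t), B) ω) := by
    symm
    rw [Finset.sum_comm]
    refine Finset.sum_congr rfl fun A _ => ?_
    rw [Finset.sum_comm]
    refine Finset.sum_congr rfl fun A' _ => ?_
    rw [Finset.sum_comm]
  rw [h3]
  refine (Finset.sum_le_card_nsmul _ _ _ fun t _ => h2 t).trans ?_
  rw [nsmul_eq_mul, Finset.card_univ, Fintype.card_fin]
  unfold pathErr
  exact le_of_eq (by ring)

/-- After the exchange, the clusters around `(B, A)` and `(B', A)` are the vertical classes in the
column over `hub A`. The two instances of `CrossJoin` lead from the horizontal clusters to them. -/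
theorem pairJoin_of_exchange {b : Bool} {A B B' : HubLabel r R} {ω : Ω}
    (h1 : S.CrossJoin b A [] B ω) (h2 : S.CrossJoin b A [] B' ω)
    (h : S.exchange.PairJoin b (B, A) (B', A) ω) : S.PairJoin b (A, B) (A, B') ω := by
  refine ⟨h1.1, h2.1, fun i hi i' hi' => ?_⟩
  obtain ⟨⟨j, hj⟩, ⟨j', hj'⟩, h3⟩ := h
  have p := (h3 j hj j' hj').map (ρ := copyRel (S.R ω) b) Prod.swap fun _ _ h => h
  exact (h1.2.2 i hi j hj).trans (p.trans (S.reach_symm_copy (h2.2.2 i' hi' j' hj')))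

/-- Error bound for joining two hub pairs. -/
def _root_.LocalParams.pairErr (P Q α κ m : ℝ) (r R : ℕ) : ℝ :=
  2 * pathErr P Q α κ m r R + 2 * (sliceErr P Q α κ m r R + crossErr P Q α κ m r R)

theorem sum_sum_not_crossJoin_le (hp : LocalParams P Q α κ m r R) (hS : S.LocalHyp P Q)
    (b : Bool) : ∑ A, ∑ B, π.Pr (fun ω => ¬ S.CrossJoin b A [] B ω) ≤
    (Fintype.card (HubLabel r R)) ^ 2 * (sliceErr P Q α κ m r R + crossErr P Q α κ m r R) := by
  set h := (Fintype.card (HubLabel r R) : ℝ) with hh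
  have hs : ∑ A, ∑ B, π.Pr (S.SmallX α b A B) ≤ h * (h * sliceErr P Q α κ m r R) := by
    rw [Finset.sum_comm]
    refine (Finset.sum_le_card_nsmul _ _ _ fun B _ => S.sum_smallX_le hp hS b B).trans ?_
    rw [nsmul_eq_mul, Finset.card_univ]
  refine (Finset.sum_le_sum fun A _ => S.sum_not_crossJoin_nil_le hp hS b A).trans ?_
  rw [Finset.sum_add_distrib, Finset.sum_const, nsmul_eq_mul, Finset.card_univ, ← hh]
  nlinarith

theorem sum_not_pairJoin_le (hp : LocalParams P Q α κ m r R) (hS : S.LocalHyp P Q) (b : Bool) :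
    ∑ p : HubLabel r R × HubLabel r R, ∑ p' : HubLabel r R × HubLabel r R,
      π.Pr (fun ω => ¬ S.PairJoin b p p' ω) ≤
      (Fintype.card (HubLabel r R)) ^ 4 * pairErr P Q α κ m r R := by
  set h := (Fintype.card (HubLabel r R) : ℝ) with hh
  have hh0 : 0 ≤ h := Nat.cast_nonneg _
  have h1 := S.sum_path_le hp hS b
  have h2 := S.exchange.sum_path_le hp (hS.exchange S) b
  have h3 := S.sum_sum_not_crossJoin_le hp hS b
  rw [← hh] at h1 h2 h3
  have hone : ∀ A B A' B' : HubLabel r R, π.Pr (fun ω => ¬ S.PairJoin b (A, B) (A', B') ω) ≤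
      π.Pr (fun ω => ¬ S.PairJoin b (A, B) (A', B) ω) +
      (π.Pr (fun ω => ¬ S.CrossJoin b A' [] B ω) + (π.Pr (fun ω => ¬ S.CrossJoin b A' [] B' ω) +
      π.Pr (fun ω => ¬ S.exchange.PairJoin b (B, A') (B', A') ω))) := by
    intro A B A' B'
    refine le_trans (π.Pr_mono fun ω hω => ?_) ((π.Pr_or _ _).trans (add_le_add_right
      ((π.Pr_or _ _).trans (add_le_add_right (π.Pr_or _ _) _)) _))
    by_contra hn
    simp only [not_or, not_not] at hn
    exact hω (hn.1.trans (S.pairJoin_of_exchange hn.2.1 hn.2.2.1 hn.2.2.2))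
  simp only [Fintype.sum_prod_type]
  refine (Finset.sum_le_sum fun A _ => Finset.sum_le_sum fun B _ => Finset.sum_le_sum fun A' _ =>
    Finset.sum_le_sum fun B' _ => hone A B A' B').trans ?_
  simp only [Finset.sum_add_distrib, Finset.sum_const, Finset.card_univ, nsmul_eq_mul,
    ← Finset.mul_sum]
  rw [← hh]
  have e1 : ∑ A, ∑ B, ∑ A', π.Pr (fun ω => ¬ S.PairJoin b (A, B) (A', B) ω) ≤
      h ^ 3 * pathErr P Q α κ m r R := by
    refine le_trans (le_of_eq ?_) h1
    exact Finset.sum_congr rfl fun A _ => Finset.sum_comm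
  have e2 : ∑ B, ∑ A', π.Pr (fun ω => ¬ S.CrossJoin b A' [] B ω) ≤
      h ^ 2 * (sliceErr P Q α κ m r R + crossErr P Q α κ m r R) := by
    rw [Finset.sum_comm]; exact h3
  have e3 : ∑ B, ∑ A', ∑ B', π.Pr (fun ω => ¬ S.exchange.PairJoin b (B, A') (B', A') ω) ≤
      h ^ 3 * pathErr P Q α κ m r R := by
    refine le_trans (le_of_eq ?_) h2
    exact Finset.sum_congr rfl fun A _ => Finset.sum_comm
  unfold pairErr
  have f1 := mul_le_mul_of_nonneg_left e1 hh0
  have f2 := mul_le_mul_of_nonneg_left e2 (mul_nonneg hh0 hh0)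
  have f3 := mul_le_mul_of_nonneg_left e3 hh0
  have f4 := mul_le_mul_of_nonneg_left h3 (mul_nonneg hh0 hh0)
  nlinarith

end SiteBond

/-! ### The giant cluster of a copy and the join of two copies -/

/-- The indicator of a proposition. -/
def ind (p : Prop) : ℝ := if p then 1 else 0

theorem ind_nonneg (p : Prop) : 0 ≤ ind p := by
  unfold ind; split_ifs <;> norm_num

theorem sum_ind_eq_card {ι : Type*} [Fintype ι] (p : ι → Prop) [DecidablePred p] :
    ∑ i, ind (p i) = ((Finset.univ.filter p).card : ℝ) := by
  rw [Finset.card_filter]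
  push_cast
  exact Finset.sum_congr rfl fun i _ => by by_cases h : p i <;> simp [ind, h]

theorem card_filter_not_real {ι : Type*} [Fintype ι] (p : ι → Prop) [DecidablePred p]
    [DecidablePred fun i => ¬ p i] :
    ((Finset.univ.filter p).card : ℝ) + (Finset.univ.filter fun i => ¬ p i).card =
      Fintype.card ι := by
  have := Finset.card_filter_add_card_filter_not (s := (Finset.univ : Finset ι)) p
  rw [Finset.card_univ] at this
  exact_mod_cast this

/-- The sites whose cluster contains the largest leaf cluster of most hub pairs. -/
def giantSites {r R : ℕ} (σ : StarCube r R × StarCube r R → StarCube r R × StarCube r R → Prop) :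
    Set (StarCube r R × StarCube r R) :=
  {v | 9 / 10 * (Fintype.card (HubLabel r R) : ℝ) ^ 2 ≤
    ((Finset.univ.filter fun p : HubLabel r R × HubLabel r R =>
      ∃ i ∈ sliceClass (fun x x' => σ (x, hub p.2) (x', hub p.2)) p.1 Finset.univ,
        ReachIn σ Set.univ v (leaf p.1 i, hub p.2)).card : ℝ)}

/-- Two families containing nine tenths of the hub pairs have a pair in common, so the giant cluster
is unique. -/
theorem giantSites_reach {r R : ℕ} (hR : 0 < R)
    {σ : StarCube r R × StarCube r R → StarCube r R × StarCube r R → Prop}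
    (hσ : ∀ a b, σ a b → σ b a) {v v' : StarCube r R × StarCube r R} (hv : v ∈ giantSites σ)
    (hv' : v' ∈ giantSites σ) : ReachIn σ Set.univ v v' := by
  have : NeZero R := ⟨hR.ne'⟩
  set T := fun v : StarCube r R × StarCube r R =>
    Finset.univ.filter fun p : HubLabel r R × HubLabel r R =>
      ∃ i ∈ sliceClass (fun x x' => σ (x, hub p.2) (x', hub p.2)) p.1 Finset.univ,
        ReachIn σ Set.univ v (leaf p.1 i, hub p.2) with hT
  have hh : (0 : ℝ) < Fintype.card (HubLabel r R) := by exact_mod_cast Fintype.card_pos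
  have h1 : 9 / 10 * (Fintype.card (HubLabel r R) : ℝ) ^ 2 ≤ (T v).card := hv
  have h2 : 9 / 10 * (Fintype.card (HubLabel r R) : ℝ) ^ 2 ≤ (T v').card := hv'
  have h3 : (T v ∩ T v').Nonempty := by
    rw [Finset.nonempty_iff_ne_empty]
    intro he
    have h4 := Finset.card_union_add_card_inter (T v) (T v')
    rw [he, Finset.card_empty, add_zero] at h4
    have h5 := Finset.card_le_univ (T v ∪ T v')
    rw [h4, Fintype.card_prod] at h5
    have h6 : ((T v).card : ℝ) + (T v').card ≤
      Fintype.card (HubLabel r R) * Fintype.card (HubLabel r R) := by exact_mod_cast h5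
    nlinarith
  obtain ⟨p, hp⟩ := h3
  rw [Finset.mem_inter] at hp
  obtain ⟨i, hi, h7⟩ := (Finset.mem_filter.1 hp.1).2
  obtain ⟨i', hi', h8⟩ := (Finset.mem_filter.1 hp.2).2
  have h9 : ReachIn (fun x x' => σ (x, hub p.2) (x', hub p.2)) Set.univ (leaf p.1 i) (leaf p.1 i') :=
    largestClass_rel (ρ := fun i j => ReachIn (fun x x' => σ (x, hub p.2) (x', hub p.2)) Set.univ
      (leaf p.1 i) (leaf p.1 j)) (fun _ _ h => h.symm fun _ _ => hσ _ _)
      (fun _ _ _ h h' => h.trans h') hi hi'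
  exact h7.trans ((h9.map (fun x => (x, hub p.2)) fun _ _ h => h).trans (h8.symm hσ))

namespace SiteBond

open LocalParams

variable {Ω : Type*} [Fintype Ω] {π : FinProb Ω}
  {r R : ℕ} (S : SiteBond π (CopySite r R)) {P Q α κ m : ℝ}

theorem reach_of_copy {ω : Ω} {b : Bool} {z z' : StarCube r R × StarCube r R}
    (h : ReachIn (copyRel (S.R ω) b) Set.univ z z') :
    ReachIn (S.R ω) Set.univ ((b, z.1), z.2) ((b, z'.1), z'.2) :=
  h.map (ρ := S.R ω) (fun z : StarCube r R × StarCube r R => (((b, z.1), z.2) : CopySite r R))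
    fun _ _ h => h

/-- The clusters around a hub pair in the two copies are joined. -/
def AcrossJoin (p : HubLabel r R × HubLabel r R) (ω : Ω) : Prop :=
  ∃ i ∈ xClass (S.R ω) false p.1 p.2, ∃ i' ∈ xClass (S.R ω) true p.1 p.2,
    ReachIn (S.R ω) Set.univ ((false, leaf p.1 i), hub p.2) ((true, leaf p.1 i'), hub p.2)

/-- The columns over `hub A` in the two copies are parallel slices and are linked by `exists_link`.
The class in the second copy is nested in the class of the first. -/
theorem acrossJoin_of (hp : LocalParams P Q α κ m r R) {A B : HubLabel r R} {ω : Ω}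
    (h1 : S.CrossJoin false A [] B ω) (h2 : S.CrossJoin true A [(false, hub A)] B ω)
    (hch : S.ChainOK α B ω [(true, hub A), (false, hub A)])
    (hu : ¬ S.ManyUnlinked α m (true, hub A) (false, hub A) [] B ω) :
    S.AcrossJoin (A, B) ω := by
  obtain ⟨i, hi⟩ := h1.1
  obtain ⟨i', hi'⟩ := h2.1
  obtain ⟨j, hj, hR⟩ := S.exists_link hp.α_pos (hch.1.1.le_card S hp (by simp))
    (fun h => not_lt.2 hch.1.2 h.2) hch.2 hu
  have p1 := S.reach_of_copy (h1.2.2 i hi j (S.nestedClass_cons_subset ω B _ _ hj))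
  have p2 := S.reach_of_copy (h2.2.2 i' hi' j hj)
  have p3 : ReachIn (S.R ω) Set.univ ((true, hub A), leaf B j) ((false, hub A), leaf B j) :=
    .single trivial trivial hR
  exact ⟨i, hi, i', hi', p1.trans ((S.reach_symm p3).trans (S.reach_symm p2))⟩

/-- Error bound for joining the two copies. -/
def _root_.LocalParams.acrossErr (P Q α κ m : ℝ) (r R : ℕ) : ℝ :=
  4 * sliceErr P Q α κ m r R + 2 * crossErr P Q α κ m r R + flucErr κ m

theorem sum_not_acrossJoin_le (hp : LocalParams P Q α κ m r R) (hS : S.LocalHyp P Q) :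
    ∑ p : HubLabel r R × HubLabel r R, π.Pr (fun ω => ¬ S.AcrossJoin p ω) ≤
      (Fintype.card (HubLabel r R)) ^ 2 * acrossErr P Q α κ m r R := by
  set h := (Fintype.card (HubLabel r R) : ℝ) with hh
  have hh0 : 0 ≤ h := Nat.cast_nonneg _
  have hs : ∑ A, ∑ B, π.Pr (S.SmallX α true A B) ≤ h * (h * sliceErr P Q α κ m r R) := by
    rw [Finset.sum_comm]
    refine (Finset.sum_le_card_nsmul _ _ _ fun B _ => S.sum_smallX_le hp hS true B).trans ?_
    rw [nsmul_eq_mul, Finset.card_univ]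
  have hnd : ∀ A : HubLabel r R, [(true, hub A), (false, hub A)].Nodup := fun A => by simp
  have hA : ∀ A : HubLabel r R, ∑ B, π.Pr (fun ω => ¬ S.AcrossJoin (A, B) ω) ≤
      ∑ B, π.Pr (fun ω => ¬ S.CrossJoin false A [] B ω) +
      (∑ B, π.Pr (S.SmallX α true A B) + h * (crossErr P Q α κ m r R +
        2 * sliceErr P Q α κ m r R + flucErr κ m)) := by
    intro A
    have b2 := S.sum_not_crossJoin_le hp hS true A [(false, hub A)] (by simp) (hnd A)
      (freshDirs_card_ge' true A _ fun i hi => by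
        simp [(hub_ne_leaf A A i).symm] at hi)
    have b3 := S.sum_not_chainOK_le hp hS.good hS.unlY _ (hnd A) (by simp)
    have b4 : ∑ B, π.Pr (S.ManyUnlinked α m (true, hub A) (false, hub A) [] B) ≤
        h * flucErr κ m := by
      refine (Finset.sum_le_card_nsmul _ _ _ fun B _ => S.pr_manyUnlinked_le hp (by simp) (by simp)
        (fun w => ?_) B).trans ?_
      · exact hS.unlE _ _ _
      · rw [nsmul_eq_mul, Finset.card_univ]
    have hall : ∑ B, π.Pr (fun ω => ¬ S.AcrossJoin (A, B) ω) ≤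
        ∑ B, (π.Pr (fun ω => ¬ S.CrossJoin false A [] B ω) +
          (π.Pr (fun ω => ¬ S.CrossJoin true A [(false, hub A)] B ω) +
          (π.Pr (fun ω => ¬ S.ChainOK α B ω [(true, hub A), (false, hub A)]) +
          π.Pr (S.ManyUnlinked α m (true, hub A) (false, hub A) [] B)))) := by
      refine Finset.sum_le_sum fun B _ => ?_
      refine le_trans (π.Pr_mono fun ω hω => ?_) ((π.Pr_or _ _).trans (add_le_add_right
        ((π.Pr_or _ _).trans (add_le_add_right (π.Pr_or _ _) _)) _))
      by_contra hn
      simp only [not_or, not_not] at hn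
      exact hω (S.acrossJoin_of hp hn.1 hn.2.1 hn.2.2.1 hn.2.2.2)
    simp only [Finset.sum_add_distrib] at hall
    simp only [List.length_cons, List.length_nil] at b3
    push_cast at b3
    rw [← hh] at b2 b3
    linarith
  rw [Fintype.sum_prod_type]
  refine (Finset.sum_le_sum fun A _ => hA A).trans ?_
  rw [Finset.sum_add_distrib, Finset.sum_add_distrib, Finset.sum_const, nsmul_eq_mul,
    Finset.card_univ, ← hh]
  have := S.sum_sum_not_crossJoin_le hp hS false
  rw [← hh] at this
  unfold acrossErr
  nlinarith

/-- By averaging, some hub pair fails to be joined to fewer than a tenth of the others; a leaf of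
its cluster is a giant site. -/
theorem giantSites_nonempty_of (hR : 0 < R) (b : Bool) {ω : Ω}
    (h : ∑ p : HubLabel r R × HubLabel r R, ∑ p' : HubLabel r R × HubLabel r R,
      ind (¬ S.PairJoin b p p' ω) <
        1 / 10 * (Fintype.card (HubLabel r R)) ^ 4) :
    (giantSites (copyRel (S.R ω) b)).Nonempty := by
  have : NeZero R := ⟨hR.ne'⟩
  set n := (Fintype.card (HubLabel r R) : ℝ) with hn
  have hn0 : 0 < n := by rw [hn]; exact_mod_cast Fintype.card_pos
  have hex : ∃ p : HubLabel r R × HubLabel r R, ∑ p' : HubLabel r R × HubLabel r R,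
      ind (¬ S.PairJoin b p p' ω) < 1 / 10 * n ^ 2 := by
    by_contra hcon
    push Not at hcon
    have := Finset.sum_le_sum fun p (_ : p ∈ Finset.univ) => hcon p
    rw [Finset.sum_const, nsmul_eq_mul, Finset.card_univ, Fintype.card_prod] at this
    push_cast at this
    rw [← hn] at this
    nlinarith
  obtain ⟨p, hp⟩ := hex
  have hc := card_filter_not_real fun p' => S.PairJoin b p p' ω
  rw [sum_ind_eq_card] at hp
  rw [Fintype.card_prod] at hc
  push_cast at hc
  rw [← hn] at hc
  have hbig : 9 / 10 * n ^ 2 ≤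
      ((Finset.univ.filter fun p' => S.PairJoin b p p' ω).card : ℝ) := by nlinarith
  have hne : (Finset.univ.filter fun p' => S.PairJoin b p p' ω).Nonempty := by
    rw [← Finset.card_pos]
    have : (0 : ℝ) < ((Finset.univ.filter fun p' => S.PairJoin b p p' ω).card : ℝ) :=
      lt_of_lt_of_le (by positivity) hbig
    exact_mod_cast this
  obtain ⟨p₁, hp₁⟩ := hne
  obtain ⟨i, hi⟩ := (Finset.mem_filter.1 hp₁).2.1
  refine ⟨(leaf p.1 i, hub p.2), hbig.trans (Nat.cast_le.2 (Finset.card_le_card fun p' hp' => ?_))⟩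
  obtain ⟨-, ⟨i', hi'⟩, h3⟩ := (Finset.mem_filter.1 hp').2
  exact Finset.mem_filter.2 ⟨Finset.mem_univ _, i', hi', h3 i hi i' hi'⟩

theorem giantSites_join_of (hR : 0 < R) {ω : Ω}
    (h : ∑ p : HubLabel r R × HubLabel r R, ind (¬ S.AcrossJoin p ω) <
        1 / 10 * (Fintype.card (HubLabel r R)) ^ 2)
    {v v' : StarCube r R × StarCube r R} (hv : v ∈ giantSites (copyRel (S.R ω) false))
    (hv' : v' ∈ giantSites (copyRel (S.R ω) true)) :
    ReachIn (S.R ω) Set.univ ((false, v.1), v.2) ((true, v'.1), v'.2) := by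
  have : NeZero R := ⟨hR.ne'⟩
  set n := (Fintype.card (HubLabel r R) : ℝ) with hn
  have hn0 : 0 < n := by rw [hn]; exact_mod_cast Fintype.card_pos
  set T := fun (b : Bool) (v : StarCube r R × StarCube r R) =>
    Finset.univ.filter fun p : HubLabel r R × HubLabel r R => ∃ i ∈ xClass (S.R ω) b p.1 p.2,
        ReachIn (copyRel (S.R ω) b) Set.univ v (leaf p.1 i, hub p.2) with hT
  have h1 : 9 / 10 * n ^ 2 ≤ (T false v).card := hv
  have h2 : 9 / 10 * n ^ 2 ≤ (T true v').card := hv'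
  have c1 := card_filter_not_real fun p => p ∈ T false v
  have c2 := card_filter_not_real fun p => p ∈ T true v'
  rw [sum_ind_eq_card] at h
  rw [Fintype.card_prod] at c1 c2
  push_cast at c1 c2
  have hm : ∀ T : Finset (HubLabel r R × HubLabel r R), (Finset.univ.filter fun p => p ∈ T) = T :=
    fun T => by ext; simp
  rw [← hn, hm] at c1 c2
  have hex : ∃ p, p ∈ T false v ∧ p ∈ T true v' ∧ S.AcrossJoin p ω := by
    by_contra hcon
    push Not at hcon
    have hsub : (Finset.univ : Finset (HubLabel r R × HubLabel r R)) ⊆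
        (Finset.univ.filter fun p => ¬ p ∈ T false v) ∪
        (Finset.univ.filter fun p => ¬ p ∈ T true v') ∪
        (Finset.univ.filter fun p => ¬ S.AcrossJoin p ω) := by
      intro p _
      have := hcon p
      simp only [Finset.mem_union, Finset.mem_filter, Finset.mem_univ, true_and]
      tauto
    have h3 := (Finset.card_le_card hsub).trans ((Finset.card_union_le _ _).trans
      (Nat.add_le_add_right (Finset.card_union_le _ _) _))
    rw [Finset.card_univ, Fintype.card_prod] at h3
    have h4 : n * n ≤ ((Finset.univ.filter fun p => ¬ p ∈ T false v).card : ℝ) +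
        (Finset.univ.filter fun p => ¬ p ∈ T true v').card +
        (Finset.univ.filter fun p => ¬ S.AcrossJoin p ω).card := by
      rw [hn]; exact_mod_cast h3
    nlinarith
  obtain ⟨p, hp1, hp2, i, hi, i', hi', h5⟩ := hex
  obtain ⟨j, hj, h6⟩ := (Finset.mem_filter.1 hp1).2
  obtain ⟨j', hj', h7⟩ := (Finset.mem_filter.1 hp2).2
  have p1 := S.reach_of_copy (h6.trans (S.xClass_reach hj hi))
  have p2 := S.reach_of_copy (h7.trans (S.xClass_reach hj' hi'))
  exact p1.trans (h5.trans (S.reach_symm p2))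

/-- The giant clusters of the two copies exist and are joined. -/
def CopiesJoined (ω : Ω) : Prop :=
  ∃ v ∈ giantSites (copyRel (S.R ω) false), ∃ v' ∈ giantSites (copyRel (S.R ω) true),
    ReachIn (S.R ω) Set.univ ((false, v.1), v.2) ((true, v'.1), v'.2)

theorem pr_not_copiesJoined_le (hp : LocalParams P Q α κ m r R) (hS : S.LocalHyp P Q) :
    π.Pr (fun ω => ¬ S.CopiesJoined ω) ≤
      20 * pairErr P Q α κ m r R + 10 * acrossErr P Q α κ m r R := by
  have hR := hp.R_pos
  have : NeZero R := ⟨hR.ne'⟩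
  set n := (Fintype.card (HubLabel r R) : ℝ) with hn
  have hn0 : 0 < n := by rw [hn]; exact_mod_cast Fintype.card_pos
  have key : ∀ b, π.Pr (fun ω => 1 / 10 * n ^ 4 ≤ ∑ p : HubLabel r R × HubLabel r R,
      ∑ p' : HubLabel r R × HubLabel r R, ind (¬ S.PairJoin b p p' ω)) ≤
      10 * pairErr P Q α κ m r R := by
    intro b
    have h1 := π.markov (X := fun ω => ∑ p : HubLabel r R × HubLabel r R,
      ∑ p' : HubLabel r R × HubLabel r R, ind (¬ S.PairJoin b p p' ω))
      (fun ω => Finset.sum_nonneg fun _ _ => Finset.sum_nonneg fun _ _ => ind_nonneg _) (1 / 10 * n ^ 4)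
    have h2 := S.sum_not_pairJoin_le hp hS b
    rw [FinProb.E_sum] at h1
    simp only [FinProb.E_sum] at h1
    have h3 := h1.trans h2
    have h4 : 0 < n ^ 4 := by positivity
    have h5 : n ^ 4 * (1 / 10 * π.Pr (fun ω => 1 / 10 * n ^ 4 ≤ ∑ p : HubLabel r R × HubLabel r R,
      ∑ p' : HubLabel r R × HubLabel r R, ind (¬ S.PairJoin b p p' ω))) ≤
      n ^ 4 * pairErr P Q α κ m r R := by linarith
    linarith [le_of_mul_le_mul_left h5 h4]
  have key2 : π.Pr (fun ω => 1 / 10 * n ^ 2 ≤ ∑ p : HubLabel r R × HubLabel r R,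
      ind (¬ S.AcrossJoin p ω)) ≤ 10 * acrossErr P Q α κ m r R := by
    have h1 := π.markov (X := fun ω => ∑ p : HubLabel r R × HubLabel r R,
      ind (¬ S.AcrossJoin p ω))
      (fun ω => Finset.sum_nonneg fun _ _ => ind_nonneg _) (1 / 10 * n ^ 2)
    have h2 := S.sum_not_acrossJoin_le hp hS
    rw [FinProb.E_sum] at h1
    have h3 := h1.trans h2
    have h4 : 0 < n ^ 2 := by positivity
    have h5 : n ^ 2 * (1 / 10 * π.Pr (fun ω => 1 / 10 * n ^ 2 ≤ ∑ p : HubLabel r R × HubLabel r R,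
      ind (¬ S.AcrossJoin p ω))) ≤ n ^ 2 * acrossErr P Q α κ m r R := by
      linarith
    linarith [le_of_mul_le_mul_left h5 h4]
  have hall : π.Pr (fun ω => ¬ S.CopiesJoined ω) ≤
      π.Pr (fun ω => 1 / 10 * n ^ 4 ≤ ∑ p : HubLabel r R × HubLabel r R,
        ∑ p' : HubLabel r R × HubLabel r R, ind (¬ S.PairJoin false p p' ω)) +
      (π.Pr (fun ω => 1 / 10 * n ^ 4 ≤ ∑ p : HubLabel r R × HubLabel r R,
        ∑ p' : HubLabel r R × HubLabel r R, ind (¬ S.PairJoin true p p' ω)) +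
      π.Pr (fun ω => 1 / 10 * n ^ 2 ≤ ∑ p : HubLabel r R × HubLabel r R,
        ind (¬ S.AcrossJoin p ω))) := by
    refine le_trans (π.Pr_mono fun ω hω => ?_) ((π.Pr_or _ _).trans (add_le_add_right
      (π.Pr_or _ _) _))
    by_contra hcon
    simp only [not_or, not_le] at hcon
    obtain ⟨v, hv⟩ := S.giantSites_nonempty_of hR false hcon.1
    obtain ⟨v', hv'⟩ := S.giantSites_nonempty_of hR true hcon.2.1
    exact hω ⟨v, hv, v', hv', S.giantSites_join_of hR hcon.2.2 hv hv'⟩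
  have := key false
  have := key true
  linarith

end SiteBond

namespace LocalParams

/-- The constants are crude. The factor `r` stems from replacing a hub one coordinate at a time. -/
theorem totalErr_le {P Q α κ m : ℝ} {r R : ℕ} (hp : LocalParams P Q α κ m r R) :
    20 * pairErr P Q α κ m r R + 10 * acrossErr P Q α κ m r R ≤
      r * (sliceErr P Q α κ m r R + flucErr κ m) * (700 + 140 * κ⁻¹) := by
  have hr : (1 : ℝ) ≤ r := by linarith [hp.m_pos, hp.m_le_sub]
  have hs := hp.sliceErr_nonneg
  have he : 0 ≤ flucErr κ m := (Real.exp_pos _).le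
  have hk : 0 < κ⁻¹ := inv_pos.2 hp.κ_pos
  unfold pairErr pathErr acrossErr updateErr crossErr
  set s := sliceErr P Q α κ m r R
  set e := flucErr κ m
  rw [div_eq_mul_inv]
  set k := κ⁻¹
  have h1 : 0 ≤ s * k := by positivity
  have h2 : 0 ≤ e * k := by positivity
  nlinarith [mul_le_mul_of_nonneg_right hr hs, mul_le_mul_of_nonneg_right hr he,
    mul_le_mul_of_nonneg_right hr h1, mul_le_mul_of_nonneg_right hr h2]

end LocalParams

/-- For suitable sizes of the star-shaped cubes the giant clusters of two adjacent copies are joined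
with probability close to one. -/
theorem exists_copiesJoined {P Q α : ℝ} (hP0 : 0 ≤ P) (hP1 : P ≤ 1) (hQ0 : 0 ≤ Q) (hα0 : 0 < α)
    (hα1 : α ≤ 1) (hgap : Q < (P - α) * P) (hQα : Q < α ^ 2) {η : ℝ} (hη : 0 < η) :
    ∃ r R : ℕ, 0 < R ∧ ∀ {Ω : Type} [Fintype Ω] {π : FinProb Ω} (S : SiteBond π (CopySite r R)),
      S.LocalHyp P Q → π.Pr (fun ω => ¬ S.CopiesJoined ω) ≤ η := by
  obtain ⟨κ, hκ0, hκ1, hκ2, hκ3⟩ : ∃ κ : ℝ, 0 < κ ∧ κ ≤ 1 ∧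
      0 < (P - α - 4 * κ) * P - (1 + κ) * Q ∧ Q + κ ≤ α * (α - 2 * κ) := by
    set d := min (min ((P - α) * P - Q) (α ^ 2 - Q)) 1 with hd
    have hd0 : 0 < d := lt_min (lt_min (by linarith) (by linarith)) one_pos
    have d1 : d ≤ (P - α) * P - Q := (min_le_left _ _).trans (min_le_left _ _)
    have d2 : d ≤ α ^ 2 - Q := (min_le_left _ _).trans (min_le_right _ _)
    have d3 : d ≤ 1 := min_le_right _ _
    have hQ1 : Q ≤ 1 := by nlinarith
    refine ⟨d / 8, by positivity, by linarith, ?_, ?_⟩ <;> nlinarith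
  set c0 := (P - α - 4 * κ) * P - (1 + κ) * Q with hc0
  set a := κ ^ 4 / 4 * (α ^ 3 / 2) with ha
  have ha0 : 0 < a := by positivity
  -- With `R = r ^ 3` the crossing error contributes `r * (r / R) = 1 / r`. Classes of size `α ^ 3 *
  -- r / 2` make the exponential terms negligible even after multiplication by `r`.
  have hlim : Tendsto (fun r : ℕ => (r : ℝ) * (((r : ℝ) / ((r ^ 3 : ℕ) : ℝ) +
      3 * Real.exp (-(κ ^ 4 / 4) * (α ^ 3 * r / 2))) / c0 +
      Real.exp (-(κ ^ 4 / 4) * (α ^ 3 * r / 2))) * (700 + 140 * κ⁻¹)) atTop (𝓝 0) := by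
    have l1 : Tendsto (fun r : ℕ => (r : ℝ) * Real.exp (-a * r)) atTop (𝓝 0) := by
      have := (Real.tendsto_pow_mul_exp_neg_atTop_nhds_zero 1).comp
        (tendsto_natCast_atTop_atTop (R := ℝ) |>.const_mul_atTop ha0)
      have h2 := this.const_mul a⁻¹
      rw [mul_zero] at h2
      refine h2.congr fun r => ?_
      simp only [Function.comp, pow_one]
      rw [neg_mul]
      field_simp
    have l2 : Tendsto (fun r : ℕ => (1 : ℝ) / r) atTop (𝓝 0) := tendsto_one_div_atTop_nhds_zero_nat
    have l3 := (((l2.add (l1.const_mul 3)).div_const c0).add l1).mul_const (700 + 140 * κ⁻¹)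
    simp only [mul_zero, add_zero, zero_div, zero_mul] at l3
    refine l3.congr' ?_
    filter_upwards [eventually_gt_atTop 0] with r hr
    have hr' : (r : ℝ) ≠ 0 := by positivity
    have e1 : -(κ ^ 4 / 4) * (α ^ 3 * r / 2) = -a * r := by rw [ha]; ring
    rw [e1]
    push_cast
    field_simp
  have hev := (hlim.eventually (gt_mem_nhds hη)).and
    ((eventually_ge_atTop 2).and ((tendsto_natCast_atTop_atTop (R := ℝ)).eventually_ge_atTop κ⁻¹))
  obtain ⟨r, h1, h2, h3⟩ := hev.exists
  have hr2 : (2 : ℝ) ≤ r := by exact_mod_cast h2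
  have hα3 : α ^ 3 ≤ 1 := pow_le_one₀ hα0.le hα1
  have hp : LocalParams P Q α κ (α ^ 3 * r / 2) r (r ^ 3) :=
    { P_nonneg := hP0, P_le_one := hP1, Q_nonneg := hQ0, α_pos := hα0, α_le_one := hα1,
      κ_pos := hκ0, κ_le_one := hκ1, gap := hκ2, Q_add_le := hκ3
      m_pos := by positivity
      m_le := by
        have : 0 < α ^ 3 * r := by positivity
        linarith
      m_le_sub := by nlinarith
      one_le := by
        have := (inv_le_iff_one_le_mul₀ hκ0).1 h3
        linarith
      R_pos := by positivity }
  refine ⟨r, r ^ 3, hp.R_pos, fun S hS => ?_⟩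
  exact (S.pr_not_copiesJoined_le hp hS).trans (hp.totalErr_le.trans h1.le)

/-! ### Connectivity of dense subsets of the cube -/

/-- The vertices of the `m`-dimensional cube. -/
abbrev Cube (m : ℕ) := Fin m → Bool

/-- The neighbour of `x` in direction `i`. -/
def flipAt {m : ℕ} (x : Cube m) (i : Fin m) : Cube m := Function.update x i (!x i)

section Cube

variable {m : ℕ}

theorem flipAt_flipAt (x : Cube m) (i : Fin m) : flipAt (flipAt x i) i = x := by
  simp [flipAt]

theorem flipAt_comm (x : Cube m) (i j : Fin m) :
    flipAt (flipAt x i) j = flipAt (flipAt x j) i := by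
  by_cases h : i = j
  · rw [h]
  · simp only [flipAt, Function.update_of_ne h, Function.update_of_ne (Ne.symm h)]
    exact Function.update_comm h _ _ _

theorem flipAt_ne (x : Cube m) (i : Fin m) : flipAt x i ≠ x := by
  intro h
  have := congrFun h i
  simp [flipAt] at this

theorem flipAt_injective (x : Cube m) : Function.Injective (flipAt x) := by
  intro i j h
  by_contra hij
  have := congrFun h i
  simp [flipAt, hij] at this

theorem cube_induction {p : Cube m → Prop} (x : Cube m) (h0 : p x)
    (hs : ∀ y k, p y → p (flipAt y k)) (y : Cube m) : p y := by
  have key : ∀ s : Finset (Fin m), p (s.piecewise y x) := by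
    intro s
    induction s using Finset.induction_on with
    | empty => simpa using h0
    | insert k s _ ih =>
      rw [Finset.piecewise_insert]
      by_cases hk : s.piecewise y x k = y k
      · rw [← hk, Function.update_eq_self]; exact ih
      · have : y k = !(s.piecewise y x k) := by
          cases h1 : y k <;> cases h2 : s.piecewise y x k <;> simp_all
        rw [this]
        exact hs _ k ih
  simpa using key Finset.univ

/-- If every vertex has few neighbours outside `G`, then `G` is connected in the cube. -/
theorem cube_connected (hm : 3 ≤ m) (G : Set (Cube m))
    (hG : ∀ x, ((Finset.univ.filter fun i => flipAt x i ∉ G).card : ℝ) < m / 10)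
    (ρ : Cube m → Cube m → Prop) (hs : ∀ x y, ρ x y → ρ y x)
    (ht : ∀ x y z, ρ x y → ρ y z → ρ x z)
    (hadj : ∀ x i, x ∈ G → flipAt x i ∈ G → ρ x (flipAt x i)) {x y : Cube m} (hx : x ∈ G)
    (hy : y ∈ G) : ρ x y := by
  have hm' : (3 : ℝ) ≤ m := by exact_mod_cast hm
  -- Three vertices exclude fewer than `3 * m / 10` directions altogether.
  have choose3 : ∀ a b c : Cube m, ∃ l, flipAt a l ∈ G ∧ flipAt b l ∈ G ∧ flipAt c l ∈ G := by
    intro a b c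
    by_contra hn
    push Not at hn
    have hsub : (Finset.univ : Finset (Fin m)) ⊆ (Finset.univ.filter fun i => flipAt a i ∉ G) ∪
        (Finset.univ.filter fun i => flipAt b i ∉ G) ∪
        (Finset.univ.filter fun i => flipAt c i ∉ G) := by
      intro l _
      have := hn l
      simp only [Finset.mem_union, Finset.mem_filter, Finset.mem_univ, true_and]
      tauto
    have h3 := (Finset.card_le_card hsub).trans ((Finset.card_union_le _ _).trans
      (Nat.add_le_add_right (Finset.card_union_le _ _) _))
    rw [Finset.card_univ, Fintype.card_fin] at h3
    have h4 : (m : ℝ) ≤ ((Finset.univ.filter fun i => flipAt a i ∉ G).card : ℝ) +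
        (Finset.univ.filter fun i => flipAt b i ∉ G).card +
        (Finset.univ.filter fun i => flipAt c i ∉ G).card := by exact_mod_cast h3
    linarith [hG a, hG b, hG c]
  -- The neighbours of `a` in `G` are joined to each other, through the neighbour in a common good
  -- direction `l`. The vertex `a` itself need not belong to `G`.
  have cloud : ∀ a i j, flipAt a i ∈ G → flipAt a j ∈ G → ρ (flipAt a i) (flipAt a j) := by
    intro a i j hi hj
    obtain ⟨l, h1, h2, h3⟩ := choose3 a (flipAt a i) (flipAt a j)
    have e1 := hadj _ l hi h2
    have e2 := hadj _ i h1 (by rw [flipAt_comm]; exact h2)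
    have e3 := hadj _ j h1 (by rw [flipAt_comm]; exact h3)
    have e4 := hadj _ l hj h3
    rw [flipAt_comm] at e2 e3
    exact ht _ _ _ e1 (ht _ _ _ (hs _ _ e2) (ht _ _ _ e3 (hs _ _ e4)))
  have i₀ : Fin m := ⟨0, by omega⟩
  -- The clouds of adjacent centres `z` and `flipAt z k` are joined by an edge in direction `k`, so
  -- the property spreads over all centres.
  have key : ∀ z, ∀ j, flipAt z j ∈ G → ρ x (flipAt z j) := by
    intro z
    refine cube_induction (p := fun z => ∀ j, flipAt z j ∈ G → ρ x (flipAt z j)) (flipAt x i₀)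
      ?_ ?_ z
    · intro j hj
      have := cloud (flipAt x i₀) i₀ j (by rwa [flipAt_flipAt]) hj
      rwa [flipAt_flipAt] at this
    · intro z k ih j hj
      obtain ⟨l, h1, h2, -⟩ := choose3 z (flipAt z k) z
      have e1 := ih l h1
      have e2 := hadj _ k h1 (by rw [flipAt_comm]; exact h2)
      rw [flipAt_comm] at e2
      exact ht _ _ _ e1 (ht _ _ _ e2 (cloud _ l j h2 hj))
  have := key (flipAt y i₀) i₀ (by rwa [flipAt_flipAt])
  rwa [flipAt_flipAt] at this

/-- Double counting of the pairs of a vertex and a neighbour outside `G`: each vertex outside `G`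
occurs `m` times. -/
theorem cube_dense (hm : 0 < m) (G : Set (Cube m))
    (hG : ∀ x, ((Finset.univ.filter fun i => flipAt x i ∉ G).card : ℝ) < m / 10) :
    9 / 10 * (2 : ℝ) ^ m ≤ ((Finset.univ.filter fun x => x ∈ G).card : ℝ) := by
  have h1 : ∑ x : Cube m, ((Finset.univ.filter fun i => flipAt x i ∉ G).card : ℝ) =
      m * ((Finset.univ.filter fun x => x ∉ G).card : ℝ) := by
    simp only [← sum_ind_eq_card]
    rw [Finset.sum_comm]
    have : ∀ i : Fin m, ∑ x : Cube m, ind (flipAt x i ∉ G) = ∑ x, ind (x ∉ G) := by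
      intro i
      have hinv : Function.Involutive (fun x : Cube m => flipAt x i) := fun x => flipAt_flipAt x i
      exact Equiv.sum_comp hinv.toPerm (fun x => ind (x ∉ G))
    rw [Finset.sum_congr rfl fun i _ => this i, Finset.sum_const, nsmul_eq_mul, Finset.card_univ,
      Fintype.card_fin]
  have h2 : ∑ x : Cube m, ((Finset.univ.filter fun i => flipAt x i ∉ G).card : ℝ) ≤
      2 ^ m * (m / 10) := by
    refine (Finset.sum_le_card_nsmul _ _ _ fun x _ => (hG x).le).trans ?_
    rw [nsmul_eq_mul, Finset.card_univ]
    simp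
  have h3 := card_filter_not_real fun x : Cube m => x ∈ G
  have h4 : (Fintype.card (Cube m) : ℝ) = 2 ^ m := by simp
  rw [h4] at h3
  have hm' : (0 : ℝ) < m := by exact_mod_cast hm
  have h5 : (m : ℝ) * ((Finset.univ.filter fun x => x ∉ G).card : ℝ) ≤ m * (2 ^ m / 10) := by
    rw [← h1]; linarith
  have := le_of_mul_le_mul_left h5 hm'
  linarith

/-- Dense connected sets in the slices over a connected part of the cube are joined, provided that
most of the edges between adjacent slices are present. -/
theorem slices_joined {β : Type*} [Fintype β] [Nonempty β] (hm : 3 ≤ m)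
    {ρ : Cube m × β → Cube m × β → Prop} (hs : ∀ a b, ρ a b → ρ b a) (G : Set (Cube m))
    (hG : ∀ x, ((Finset.univ.filter fun i => flipAt x i ∉ G).card : ℝ) < m / 10)
    (D : Cube m → Finset β) (hD : ∀ x ∈ G, 9 / 10 * (Fintype.card β : ℝ) ≤ (D x).card)
    (hDc : ∀ x ∈ G, ∀ a ∈ D x, ∀ b ∈ D x, ReachIn ρ Set.univ (x, a) (x, b))
    (hE : ∀ x i, ((Finset.univ.filter fun v => ¬ ρ (x, v) (flipAt x i, v)).card : ℝ) <
      1 / 10 * Fintype.card β) {x y : Cube m} (hx : x ∈ G) (hy : y ∈ G) {a b : β} (ha : a ∈ D x)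
    (hb : b ∈ D y) : ReachIn ρ Set.univ (x, a) (y, b) := by
  have hβ : (0 : ℝ) < Fintype.card β := by exact_mod_cast Fintype.card_pos
  have hne : ∀ x ∈ G, (D x).Nonempty := fun x hx => by
    have : (0 : ℝ) < (D x).card := lt_of_lt_of_le (by positivity) (hD x hx)
    exact Finset.card_pos.1 (by exact_mod_cast this)
  refine (cube_connected hm G hG
    (fun x y => x ∈ G ∧ y ∈ G ∧ ∀ a ∈ D x, ∀ b ∈ D y, ReachIn ρ Set.univ (x, a) (y, b))
    (fun x y h => ⟨h.2.1, h.1, fun a ha b hb => (h.2.2 b hb a ha).symm hs⟩) ?_ ?_ hx hy).2.2 a ha b hb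
  · rintro x y z ⟨h1, h2, h3⟩ ⟨-, h4, h5⟩
    obtain ⟨c, hc⟩ := hne y h2
    exact ⟨h1, h4, fun a ha b hb => (h3 a ha c hc).trans (h5 c hc b hb)⟩
  · intro x i hx hi
    refine ⟨hx, hi, fun a ha b hb => ?_⟩
    -- Three exceptional sets, each of density at most one tenth, cannot cover the fibre.
    have hex : ∃ v, v ∈ D x ∧ v ∈ D (flipAt x i) ∧ ρ (x, v) (flipAt x i, v) := by
      by_contra hn
      push Not at hn
      have hsub : (Finset.univ : Finset β) ⊆ (D x)ᶜ ∪ (D (flipAt x i))ᶜ ∪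
          (Finset.univ.filter fun v => ¬ ρ (x, v) (flipAt x i, v)) := by
        intro l _
        have := hn l
        simp only [Finset.mem_union, Finset.mem_filter, Finset.mem_univ, true_and,
          Finset.mem_compl]
        tauto
      have h3 := (Finset.card_le_card hsub).trans ((Finset.card_union_le _ _).trans
        (Nat.add_le_add_right (Finset.card_union_le _ _) _))
      rw [Finset.card_univ] at h3
      have h4 : (Fintype.card β : ℝ) ≤ ((D x)ᶜ.card : ℝ) + ((D (flipAt x i))ᶜ.card : ℝ) +
          (Finset.univ.filter fun v => ¬ ρ (x, v) (flipAt x i, v)).card := by exact_mod_cast h3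
      have h5 : ((D x).card : ℝ) + (D x)ᶜ.card = Fintype.card β := by
        exact_mod_cast Finset.card_add_card_compl (D x)
      have h6 : ((D (flipAt x i)).card : ℝ) + (D (flipAt x i))ᶜ.card = Fintype.card β := by
        exact_mod_cast Finset.card_add_card_compl (D (flipAt x i))
      linarith [hD x hx, hD _ hi, hE x i]
    obtain ⟨v, h1, h2, h3⟩ := hex
    exact (hDc x hx a ha v h1).trans ((ReachIn.single (Set.mem_univ _) (Set.mem_univ _) h3).trans
      (hDc _ hi v h2 b hb))

end Cube

/-! ### Percolation on a cube with bonds that are rarely absent -/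

namespace SiteBond

variable {Ω : Type*} [Fintype Ω] {π : FinProb Ω}

/-- Among independent unlikely events, rarely a tenth of them occurs. -/
theorem pr_tenth_le {V : Type*} (S : SiteBond π V) {ι : Type*} (s : Finset ι) (A : ι → Set V)
    (hA : ∀ i ∈ s, ∀ j ∈ s, i ≠ j → Disjoint (A i) (A j)) (p : ι → Ω → Prop)
    (hp : ∀ i ∈ s, S.Det (A i) (p i)) {t : ℝ} (ht : 20 ≤ t)
    (hE : ∀ i ∈ s, π.Pr (p i) ≤ Real.exp (-t)) :
    π.Pr (fun ω => (s.card : ℝ) / 10 ≤ ((s.filter fun i => p i ω).card : ℝ)) ≤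
      Real.exp (-(t / 20) * s.card) := by
  -- The exponent `t` matches the probabilities `exp (-t)`, so every factor has mean at most `2`,
  -- hence at most `exp 1`. The bound is `exp (n - t * n / 10)` for `n` events, and `t ≥ 20` absorbs
  -- the first term.
  have hm := π.markov (X := fun ω => ∏ i ∈ s, Real.exp (t * ind (p i ω)))
    (fun ω => Finset.prod_nonneg fun i _ => (Real.exp_pos _).le)
    (Real.exp (t * (s.card / 10)))
  rw [S.indep_prod s A hA _ fun i hi => (hp i hi).comp fun q => Real.exp (t * ind q)] at hm
  have h1 : ∀ i ∈ s, π.E (fun ω => Real.exp (t * ind (p i ω))) ≤ Real.exp 1 := by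
    intro i hi
    have h2 : π.E (fun ω => Real.exp (t * ind (p i ω))) ≤ 1 + Real.exp t * π.Pr (p i) := by
      rw [FinProb.Pr, ← FinProb.E_mul_left, ← π.E_const 1, ← FinProb.E_add, π.E_const]
      refine π.E_mono fun ω => ?_
      by_cases h : p i ω <;> simp [ind, h]
    have h3 := mul_le_mul_of_nonneg_left (hE i hi) (Real.exp_pos t).le
    rw [← Real.exp_add, add_neg_cancel, Real.exp_zero] at h3
    have := Real.add_one_le_exp 1
    linarith
  have h2 : ∏ i ∈ s, π.E (fun ω => Real.exp (t * ind (p i ω))) ≤ Real.exp s.card := by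
    refine (Finset.prod_le_prod (fun i _ => π.E_nonneg fun ω => (Real.exp_pos _).le) h1).trans ?_
    rw [Finset.prod_const, ← Real.exp_nat_mul, mul_one]
  have hev : π.Pr (fun ω => (s.card : ℝ) / 10 ≤ ((s.filter fun i => p i ω).card : ℝ)) ≤
      π.Pr (fun ω => Real.exp (t * (s.card / 10)) ≤ ∏ i ∈ s, Real.exp (t * ind (p i ω))) := by
    refine π.Pr_mono fun ω hω => ?_
    rw [← Real.exp_sum, ← Finset.mul_sum]
    refine Real.exp_le_exp.2 (mul_le_mul_of_nonneg_left (hω.trans (le_of_eq ?_)) (by linarith))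
    rw [Finset.card_filter]
    push_cast
    exact Finset.sum_congr rfl fun i _ => by by_cases h : p i ω <;> simp [ind, h]
  refine hev.trans (((le_div_iff₀' (Real.exp_pos _)).2 (hm.trans h2)).trans ?_)
  rw [← Real.exp_sub]
  refine Real.exp_le_exp.2 ?_
  nlinarith [Nat.cast_nonneg (α := ℝ) s.card]

variable {m : ℕ}

/-- There is a connected set containing most of the sites. -/
def HasDenseSet {V : Type*} [Fintype V] (S : SiteBond π V) (θ : ℝ) (ω : Ω) : Prop :=
  ∃ D : Finset V, θ * Fintype.card V ≤ D.card ∧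
    ∀ a ∈ D, ∀ b ∈ D, ReachIn (S.R ω) Set.univ a b

/-- Few of the edges at `(y, x)` in the first direction are absent. -/
def Rich (S : SiteBond π (Cube m × Cube m)) (y x : Cube m) (ω : Ω) : Prop :=
  ((Finset.univ.filter fun l => ¬ S.R ω (y, x) (flipAt y l, x)).card : ℝ) < m / 10

/-- An edge inside the slice `y` may be absent, so adjacent rich sites are joined by a detour
through a parallel slice `flipAt y l`. Each of the three edges of the detour is absent for fewer
than `m / 10` directions `l`. -/
theorem hasDenseSet_of_rich (S : SiteBond π (Cube m × Cube m)) (hm : 3 ≤ m) {ω : Ω}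
    (h1 : ∀ y x, ((Finset.univ.filter fun i => ¬ S.Rich y (flipAt x i) ω).card : ℝ) < m / 10)
    (h2 : ∀ y x i, ((Finset.univ.filter fun l =>
      ¬ S.R ω (flipAt y l, x) (flipAt y l, flipAt x i)).card : ℝ) < m / 10)
    (h3 : ∀ y l, ((Finset.univ.filter fun x => ¬ S.R ω (y, x) (flipAt y l, x)).card : ℝ) <
      1 / 10 * Fintype.card (Cube m)) : S.HasDenseSet (9 / 10) ω := by
  have hm' : (3 : ℝ) ≤ m := by exact_mod_cast hm
  set D : Cube m → Finset (Cube m) := fun y => Finset.univ.filter fun x => S.Rich y x ω with hD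
  have hdense : ∀ y, 9 / 10 * (Fintype.card (Cube m) : ℝ) ≤ (D y).card := by
    intro y
    have := cube_dense (by omega : 0 < m) {x | S.Rich y x ω} (h1 y)
    have h4 : (Fintype.card (Cube m) : ℝ) = 2 ^ m := by simp
    rw [h4]
    exact this
  have hconn : ∀ y, ∀ a ∈ D y, ∀ b ∈ D y, ReachIn (S.R ω) Set.univ (y, a) (y, b) := by
    intro y a ha b hb
    refine cube_connected hm {x | S.Rich y x ω} (h1 y)
      (fun x x' => ReachIn (S.R ω) Set.univ (y, x) (y, x')) (fun _ _ h => S.reach_symm h)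
      (fun _ _ _ h h' => h.trans h') ?_ (Finset.mem_filter.1 ha).2 (Finset.mem_filter.1 hb).2
    intro x i hx hi
    have hex : ∃ l, S.R ω (y, x) (flipAt y l, x) ∧ S.R ω (flipAt y l, x) (flipAt y l, flipAt x i) ∧
        S.R ω (y, flipAt x i) (flipAt y l, flipAt x i) := by
      by_contra hn
      push Not at hn
      have hsub : (Finset.univ : Finset (Fin m)) ⊆
          (Finset.univ.filter fun l => ¬ S.R ω (y, x) (flipAt y l, x)) ∪
          (Finset.univ.filter fun l => ¬ S.R ω (flipAt y l, x) (flipAt y l, flipAt x i)) ∪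
          (Finset.univ.filter fun l => ¬ S.R ω (y, flipAt x i) (flipAt y l, flipAt x i)) := by
        intro l _
        have := hn l
        simp only [Finset.mem_union, Finset.mem_filter, Finset.mem_univ, true_and]
        tauto
      have h4 := (Finset.card_le_card hsub).trans ((Finset.card_union_le _ _).trans
        (Nat.add_le_add_right (Finset.card_union_le _ _) _))
      rw [Finset.card_univ, Fintype.card_fin] at h4
      have h5 : (m : ℝ) ≤
          ((Finset.univ.filter fun l => ¬ S.R ω (y, x) (flipAt y l, x)).card : ℝ) +
          (Finset.univ.filter fun l => ¬ S.R ω (flipAt y l, x) (flipAt y l, flipAt x i)).card +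
          (Finset.univ.filter fun l => ¬ S.R ω (y, flipAt x i) (flipAt y l, flipAt x i)).card := by
        exact_mod_cast h4
      have hx' : ((Finset.univ.filter fun l => ¬ S.R ω (y, x) (flipAt y l, x)).card : ℝ) < m / 10 :=
        hx
      have hi' : ((Finset.univ.filter fun l =>
        ¬ S.R ω (y, flipAt x i) (flipAt y l, flipAt x i)).card : ℝ) < m / 10 := hi
      linarith [h2 y x i]
    obtain ⟨l, e1, e2, e3⟩ := hex
    exact (ReachIn.single (Set.mem_univ _) (Set.mem_univ _) e1).trans ((ReachIn.single (Set.mem_univ _) (Set.mem_univ _) e2).trans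
      (S.reach_symm (ReachIn.single (Set.mem_univ _) (Set.mem_univ _) e3)))
  refine ⟨Finset.univ.filter fun p => p.2 ∈ D p.1, ?_, ?_⟩
  · have h4 : (Finset.univ.filter fun p : Cube m × Cube m => p.2 ∈ D p.1).card =
        ∑ y, (D y).card := by
      rw [Finset.card_filter, Fintype.sum_prod_type]
      refine Finset.sum_congr rfl fun y _ => ?_
      rw [← Finset.card_filter]
      congr 1; ext; simp
    rw [h4, Nat.cast_sum, Fintype.card_prod, Nat.cast_mul]
    have := Finset.card_nsmul_le_sum Finset.univ (fun y => ((D y).card : ℝ)) _ fun y _ => hdense y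
    rw [nsmul_eq_mul, Finset.card_univ] at this
    linarith
  · rintro ⟨y, a⟩ ha ⟨y', b⟩ hb
    refine slices_joined hm (S.symm ω) Set.univ (fun x => ?_) D (fun y _ => hdense y)
      (fun y _ => hconn y) h3 trivial trivial (Finset.mem_filter.1 ha).2 (Finset.mem_filter.1 hb).2
    simp only [Set.mem_univ, not_true, Finset.filter_false, Finset.card_empty, Nat.cast_zero]
    positivity

/-- Nine tenths of the slices have a connected set of density nine tenths, whence `81 / 100`. -/
theorem hasDenseSet_of_slices {β : Type*} [Fintype β] [Nonempty β] (S : SiteBond π (Cube m × β))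
    (hm : 3 ≤ m) {ω : Ω}
    (h1 : ∀ x, ((Finset.univ.filter fun i => ¬ (S.comap (fun v : β => (flipAt x i, v))
      (Prod.mk_right_injective _)).HasDenseSet (9 / 10) ω).card : ℝ) < m / 10)
    (h3 : ∀ x i, ((Finset.univ.filter fun v => ¬ S.R ω (x, v) (flipAt x i, v)).card : ℝ) <
      1 / 10 * Fintype.card β) : S.HasDenseSet (81 / 100) ω := by
  set G : Set (Cube m) := {x | (S.comap (fun v : β => (x, v))
      (Prod.mk_right_injective _)).HasDenseSet (9 / 10) ω} with hG
  choose! D hDd hDc using fun x (hx : x ∈ G) => hx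
  have hGd := cube_dense (by omega : 0 < m) G h1
  refine ⟨Finset.univ.filter fun p => p.1 ∈ G ∧ p.2 ∈ D p.1, ?_, ?_⟩
  · have h4 : (Finset.univ.filter fun p : Cube m × β => p.1 ∈ G ∧ p.2 ∈ D p.1).card =
        ∑ x ∈ Finset.univ.filter (fun x => x ∈ G), (D x).card := by
      rw [Finset.card_filter, Fintype.sum_prod_type, Finset.sum_filter]
      refine Finset.sum_congr rfl fun y _ => ?_
      split_ifs with hy
      · rw [← Finset.card_filter]
        congr 1; ext; simp [hy]
      · simp [hy]
    rw [h4, Nat.cast_sum, Fintype.card_prod, Nat.cast_mul]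
    have h5 := Finset.card_nsmul_le_sum (Finset.univ.filter (fun x => x ∈ G))
      (fun y => ((D y).card : ℝ)) _ fun y hy => hDd y (Finset.mem_filter.1 hy).2
    rw [nsmul_eq_mul] at h5
    have h6 : (Fintype.card (Cube m) : ℝ) = 2 ^ m := by simp
    rw [h6]
    have hβ : (0 : ℝ) ≤ Fintype.card β := Nat.cast_nonneg _
    have := mul_le_mul_of_nonneg_right hGd (by positivity : 0 ≤ 9 / 10 * (Fintype.card β : ℝ))
    linarith
  · rintro ⟨y, a⟩ ha ⟨y', b⟩ hb
    have ha' := (Finset.mem_filter.1 ha).2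
    have hb' := (Finset.mem_filter.1 hb).2
    refine slices_joined hm (S.symm ω) G h1 D hDd (fun x hx a ha b hb => ?_) h3 ha'.1 hb'.1
      ha'.2 hb'.2
    exact (hDc x hx a ha b hb).map (fun v => (x, v)) fun _ _ h => h

end SiteBond

namespace FinProb

theorem pr_exists_univ_le {Ω : Type*} [Fintype Ω] (π : FinProb Ω) {ι : Type*} [Fintype ι]
    (p : ι → Ω → Prop) {e : ℝ} (h : ∀ i, π.Pr (p i) ≤ e) :
    π.Pr (fun ω => ∃ i, p i ω) ≤ Fintype.card ι * e := by
  have h1 := π.Pr_exists_le Finset.univ p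
  simp only [Finset.mem_univ, true_and] at h1
  refine h1.trans ((Finset.sum_le_card_nsmul _ _ e fun i _ => h i).trans ?_)
  rw [nsmul_eq_mul, Finset.card_univ]

end FinProb

theorem two_pow_le_exp (m : ℕ) : (2 : ℝ) ^ m ≤ Real.exp m := by
  rw [← Real.exp_one_pow]
  refine pow_le_pow_left₀ (by norm_num) ?_ m
  have := Real.add_one_le_exp 1
  linarith

theorem disjoint_fibers {α β : Type*} (f : α → β) {b b' : β} (h : b ≠ b') :
    Disjoint {v | f v = b} {v | f v = b'} := by
  rw [Set.disjoint_left]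
  intro v hv hv'
  exact h (hv.symm.trans hv')

namespace SiteBond

variable {Ω : Type*} [Fintype Ω] {π : FinProb Ω} {m : ℕ}

theorem det_not_rel {V : Type*} (S : SiteBond π V) {A : Set V} {u v : V} (hu : u ∈ A)
    (hv : v ∈ A) : S.Det A (fun ω => ¬ S.R ω u v) :=
  (determinedBy_rel S.R hu hv).comp Not

/-- The edges concerned all meet at `(y, x)`, so independence is not available and Markov's
inequality is used. Independence is recovered later between sites with different second coordinates.
-/
theorem pr_not_rich_le (S : SiteBond π (Cube m × Cube m)) (hm : 0 < m) {η : ℝ} (y x : Cube m)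
    (hb : ∀ l, π.Pr (fun ω => ¬ S.R ω (y, x) (flipAt y l, x)) ≤ η) :
    π.Pr (fun ω => ¬ S.Rich y x ω) ≤ 10 * η := by
  have h1 := π.markov (X := fun ω =>
    ((Finset.univ.filter fun l => ¬ S.R ω (y, x) (flipAt y l, x)).card : ℝ))
    (fun _ => Nat.cast_nonneg _) (m / 10)
  have h2 : π.E (fun ω => ((Finset.univ.filter fun l => ¬ S.R ω (y, x) (flipAt y l, x)).card : ℝ))
      ≤ m * η := by
    have h3 := (π.E_card Finset.univ (fun l ω => ¬ S.R ω (y, x) (flipAt y l, x))).le.trans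
      (Finset.sum_le_card_nsmul _ _ η fun l _ => hb l)
    rw [nsmul_eq_mul, Finset.card_univ, Fintype.card_fin] at h3
    refine le_trans (le_of_eq ?_) h3
    congr 1; ext ω; congr 2; ext; simp
  have hm' : (0 : ℝ) < m := by exact_mod_cast hm
  have h3 : π.Pr (fun ω => ¬ S.Rich y x ω) ≤ π.Pr (fun ω => (m : ℝ) / 10 ≤
      ((Finset.univ.filter fun l => ¬ S.R ω (y, x) (flipAt y l, x)).card : ℝ)) :=
    π.Pr_mono fun ω h => not_lt.1 h
  have h4 : (m : ℝ) * (1 / 10 * π.Pr (fun ω => (m : ℝ) / 10 ≤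
      ((Finset.univ.filter fun l => ¬ S.R ω (y, x) (flipAt y l, x)).card : ℝ))) ≤ m * η := by
    linarith
  linarith [le_of_mul_le_mul_left h4 hm']

theorem pr_tenth_univ_le {V : Type*} (S : SiteBond π V) {ι : Type*} [Fintype ι] (A : ι → Set V)
    (hA : ∀ i j, i ≠ j → Disjoint (A i) (A j)) (p : ι → Ω → Prop)
    (hp : ∀ i, S.Det (A i) (p i)) {t : ℝ} (ht : 20 ≤ t)
    (hE : ∀ i, π.Pr (p i) ≤ Real.exp (-t)) :
    π.Pr (fun ω => 1 / 10 * (Fintype.card ι : ℝ) ≤ ((Finset.univ.filter fun i => p i ω).card : ℝ)) ≤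
      Real.exp (-(t / 20) * Fintype.card ι) := by
  have := S.pr_tenth_le Finset.univ A (fun i _ j _ h => hA i j h) p (fun i _ => hp i) ht
    fun i _ => hE i
  rw [Finset.card_univ] at this
  refine le_trans (π.Pr_mono fun ω h => ?_) this
  linarith

/-- Each hypothesis of `hasDenseSet_of_rich` counts events on disjoint sets of sites, so it fails at
a given place with probability at most `exp (-((s + 4) * m))`. The union bound costs at most `4 ^ m
* (2 * m + 1) ≤ exp (4 * m)`. -/
theorem pr_not_hasDenseSet_two_le (S : SiteBond π (Cube m × Cube m)) (hm : 3 ≤ m) {s η : ℝ}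
    (hs : 0 ≤ s) (hη : 10 * η ≤ Real.exp (-(20 * (s + 4)))) (hη0 : 0 ≤ η)
    (hb1 : ∀ y x l, π.Pr (fun ω => ¬ S.R ω (y, x) (flipAt y l, x)) ≤ η)
    (hb2 : ∀ y x l, π.Pr (fun ω => ¬ S.R ω (y, x) (y, flipAt x l)) ≤ η) :
    π.Pr (fun ω => ¬ S.HasDenseSet (9 / 10) ω) ≤ Real.exp (-(s * m)) := by
  set e := Real.exp (-((s + 4) * m)) with he
  have ht : 20 ≤ 20 * (s + 4) := by linarith
  have hη' : η ≤ Real.exp (-(20 * (s + 4))) := by linarith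
  have ht' : -(20 * (s + 4) / 20) * (m : ℝ) = -((s + 4) * m) := by ring
  have f1 : ∀ y x, π.Pr (fun ω => 1 / 10 * (m : ℝ) ≤
      ((Finset.univ.filter fun i => ¬ S.Rich y (flipAt x i) ω).card : ℝ)) ≤ e := by
    intro y x
    have := S.pr_tenth_univ_le (fun i => {v | v.2 = flipAt x i})
      (fun i j h => disjoint_fibers Prod.snd fun h' => h (flipAt_injective x h'))
      (fun i ω => ¬ S.Rich y (flipAt x i) ω) (fun i ω ω' h => ?_) ht
      (fun i => (S.pr_not_rich_le (by omega) y _ fun l => hb1 _ _ _).trans hη)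
    · rw [Fintype.card_fin, ht'] at this
      refine le_trans (le_of_eq ?_) this
      congr!
    · have h1 : ∀ l, S.R ω (y, flipAt x i) (flipAt y l, flipAt x i) ↔
          S.R ω' (y, flipAt x i) (flipAt y l, flipAt x i) := fun l => h _ rfl _ rfl
      simp only [Rich, h1]
  have f2 : ∀ y x i, π.Pr (fun ω => 1 / 10 * (m : ℝ) ≤ ((Finset.univ.filter fun l =>
      ¬ S.R ω (flipAt y l, x) (flipAt y l, flipAt x i)).card : ℝ)) ≤ e := by
    intro y x i
    have := S.pr_tenth_univ_le (fun l => {v | v.1 = flipAt y l})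
      (fun i j h => disjoint_fibers Prod.fst fun h' => h (flipAt_injective y h'))
      (fun l ω => ¬ S.R ω (flipAt y l, x) (flipAt y l, flipAt x i))
      (fun _ => S.det_not_rel rfl rfl) ht
      (fun l => (hb2 _ _ _).trans hη')
    rw [Fintype.card_fin, ht'] at this
    refine le_trans (le_of_eq ?_) this
    congr!
  have f3 : ∀ y l, π.Pr (fun ω => 1 / 10 * (Fintype.card (Cube m) : ℝ) ≤
      ((Finset.univ.filter fun x => ¬ S.R ω (y, x) (flipAt y l, x)).card : ℝ)) ≤ e := by
    intro y l
    have := S.pr_tenth_univ_le (fun x => {v | v.2 = x}) (fun i j h => disjoint_fibers Prod.snd h)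
      (fun x ω => ¬ S.R ω (y, x) (flipAt y l, x))
      (fun _ => S.det_not_rel rfl rfl) ht
      (fun l => (hb1 _ _ _).trans hη')
    have h2 : Real.exp (-(20 * (s + 4) / 20) * (Fintype.card (Cube m) : ℝ)) ≤ e := by
      refine Real.exp_le_exp.2 ?_
      have h3 : (m : ℝ) ≤ Fintype.card (Cube m) := by
        have := Nat.lt_two_pow_self (n := m)
        simp only [Fintype.card_pi, Fintype.card_bool, Finset.prod_const, Finset.card_univ,
          Fintype.card_fin]
        exact_mod_cast this.le
      nlinarith
    refine le_trans (le_of_eq ?_) (this.trans h2)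
    congr!
  have hall : π.Pr (fun ω => ¬ S.HasDenseSet (9 / 10) ω) ≤
      π.Pr (fun ω => ∃ q : Cube m × Cube m, 1 / 10 * (m : ℝ) ≤
        ((Finset.univ.filter fun i => ¬ S.Rich q.1 (flipAt q.2 i) ω).card : ℝ)) +
      (π.Pr (fun ω => ∃ q : (Cube m × Cube m) × Fin m, 1 / 10 * (m : ℝ) ≤
        ((Finset.univ.filter fun l =>
          ¬ S.R ω (flipAt q.1.1 l, q.1.2) (flipAt q.1.1 l, flipAt q.1.2 q.2)).card : ℝ)) +
      π.Pr (fun ω => ∃ q : Cube m × Fin m, 1 / 10 * (Fintype.card (Cube m) : ℝ) ≤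
        ((Finset.univ.filter fun x => ¬ S.R ω (q.1, x) (flipAt q.1 q.2, x)).card : ℝ))) := by
    refine le_trans (π.Pr_mono fun ω hω => ?_) ((π.Pr_or _ _).trans (add_le_add_right
      (π.Pr_or _ _) _))
    by_contra hn
    simp only [not_or, not_exists, not_le, Prod.forall] at hn
    refine hω (S.hasDenseSet_of_rich hm (fun y x => ?_) (fun y x i => ?_) hn.2.2)
    · have := hn.1 y x; linarith
    · have := hn.2.1 y x i; linarith
  have g1 := π.pr_exists_univ_le (fun (q : Cube m × Cube m) ω => 1 / 10 * (m : ℝ) ≤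
        ((Finset.univ.filter fun i => ¬ S.Rich q.1 (flipAt q.2 i) ω).card : ℝ)) fun q => f1 _ _
  have g2 := π.pr_exists_univ_le (fun (q : (Cube m × Cube m) × Fin m) ω => 1 / 10 * (m : ℝ) ≤
        ((Finset.univ.filter fun l =>
          ¬ S.R ω (flipAt q.1.1 l, q.1.2) (flipAt q.1.1 l, flipAt q.1.2 q.2)).card : ℝ))
        fun q => f2 _ _ _
  have g3 := π.pr_exists_univ_le (fun (q : Cube m × Fin m) ω =>
        1 / 10 * (Fintype.card (Cube m) : ℝ) ≤
        ((Finset.univ.filter fun x => ¬ S.R ω (q.1, x) (flipAt q.1 q.2, x)).card : ℝ))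
        fun q => f3 _ _
  refine hall.trans ((add_le_add g1 (add_le_add g2 g3)).trans ?_)
  simp only [Fintype.card_prod, Fintype.card_pi, Fintype.card_bool, Finset.prod_const,
    Finset.card_univ, Fintype.card_fin]
  push_cast
  have h2 := two_pow_le_exp m
  have h2' : (1 : ℝ) ≤ 2 ^ m := one_le_pow₀ (by norm_num)
  have h3 := Real.add_one_le_exp (2 * m : ℝ)
  have he0 : 0 ≤ e := (Real.exp_pos _).le
  have hm0 : (0 : ℝ) ≤ m := Nat.cast_nonneg _
  have h4 : (2 : ℝ) ^ m * 2 ^ m ≤ Real.exp (2 * m) := by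
    rw [two_mul, Real.exp_add]
    exact mul_le_mul h2 h2 (by positivity) (Real.exp_pos _).le
  have h5 : (2 : ℝ) ^ m * 2 ^ m * (2 * m + 1) ≤ Real.exp (4 * m) := by
    have : (4 * m : ℝ) = 2 * m + 2 * m := by ring
    rw [this, Real.exp_add]
    exact mul_le_mul h4 h3 (by positivity) (Real.exp_pos _).le
  have h6 : Real.exp (4 * m) * e = Real.exp (-(s * m)) := by
    rw [he, ← Real.exp_add]; congr 1; ring
  rw [← h6]
  have h7 : (2 : ℝ) ^ m * 2 ^ m * e + (2 ^ m * 2 ^ m * m * e + 2 ^ m * m * e) ≤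
      (2 ^ m * 2 ^ m * (2 * m + 1)) * e := by
    have : (2 : ℝ) ^ m * m * e ≤ 2 ^ m * 2 ^ m * m * e := by
      have h8 : (2 : ℝ) ^ m * (m * e) * 1 ≤ 2 ^ m * (m * e) * 2 ^ m :=
        mul_le_mul_of_nonneg_left h2' (by positivity)
      linarith
    linarith
  exact h7.trans (mul_le_mul_of_nonneg_right h5 he0)

/-- The slices over the `m` neighbours of a vertex are disjoint, hence independent, and each fails
with probability at most `exp (-(60 * m))`. A tenth of them fail together with probability at most
`exp (-(3 * m ^ 2))`, where the quadratic exponent appears. The constant is `1280 = 20 * (60 + 4)`.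
-/
theorem pr_not_hasDenseSet_three_le (S : SiteBond π (Cube m × (Cube m × Cube m))) (hm : 3 ≤ m)
    {η : ℝ} (hη : 10 * η ≤ Real.exp (-1280)) (hη0 : 0 ≤ η)
    (hb1 : ∀ x v i, π.Pr (fun ω => ¬ S.R ω (x, v) (flipAt x i, v)) ≤ η)
    (hb2 : ∀ x y z i, π.Pr (fun ω => ¬ S.R ω (x, (y, z)) (x, (flipAt y i, z))) ≤ η)
    (hb3 : ∀ x y z i, π.Pr (fun ω => ¬ S.R ω (x, (y, z)) (x, (y, flipAt z i))) ≤ η) :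
    π.Pr (fun ω => ¬ S.HasDenseSet (81 / 100) ω) ≤ Real.exp (-((m : ℝ) ^ 2)) := by
  have hm' : (3 : ℝ) ≤ m := by exact_mod_cast hm
  set e := Real.exp (-(3 * (m : ℝ) ^ 2)) with he
  have f1 : ∀ x, π.Pr (fun ω => 1 / 10 * (m : ℝ) ≤
      ((Finset.univ.filter fun i => ¬ (S.comap (fun v : Cube m × Cube m => (flipAt x i, v))
      (Prod.mk_right_injective _)).HasDenseSet (9 / 10) ω).card : ℝ)) ≤ e := by
    intro x
    have := S.pr_tenth_univ_le (t := 60 * m) (fun i => {v | v.1 = flipAt x i})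
      (fun i j h => disjoint_fibers Prod.fst fun h' => h (flipAt_injective x h'))
      (fun i ω => ¬ (S.comap (fun v : Cube m × Cube m => (flipAt x i, v))
      (Prod.mk_right_injective _)).HasDenseSet (9 / 10) ω) (fun i ω ω' h => ?_) (by linarith)
      (fun i => (S.comap (fun v : Cube m × Cube m => (flipAt x i, v))
      (Prod.mk_right_injective _)).pr_not_hasDenseSet_two_le hm (s := 60) (by norm_num)
        (hη.trans (le_of_eq (by norm_num))) hη0 (fun _ _ _ => hb2 _ _ _ _)
        fun _ _ _ => hb3 _ _ _ _)
    · rw [Fintype.card_fin] at this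
      have h2 : -(60 * (m : ℝ) / 20) * m = -(3 * (m : ℝ) ^ 2) := by ring
      rw [h2] at this
      refine le_trans (le_of_eq ?_) this
      congr!
    · have h1 : (S.comap (fun v : Cube m × Cube m => (flipAt x i, v))
        (Prod.mk_right_injective _)).R ω = (S.comap (fun v : Cube m × Cube m => (flipAt x i, v))
        (Prod.mk_right_injective _)).R ω' := by
        ext u v
        exact h (flipAt x i, u) rfl (flipAt x i, v) rfl
      simp only [HasDenseSet, h1]
  have f2 : ∀ x i, π.Pr (fun ω => 1 / 10 * (Fintype.card (Cube m × Cube m) : ℝ) ≤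
      ((Finset.univ.filter fun v => ¬ S.R ω (x, v) (flipAt x i, v)).card : ℝ)) ≤
      Real.exp (-(64 * (m : ℝ) ^ 2)) := by
    intro x i
    have := S.pr_tenth_univ_le (t := 1280) (fun v => {u | u.2 = v})
      (fun i j h => disjoint_fibers Prod.snd h)
      (fun v ω => ¬ S.R ω (x, v) (flipAt x i, v))
      (fun _ => S.det_not_rel rfl rfl) (by norm_num)
      (fun l => (hb1 _ _ _).trans (by linarith))
    have h2 : Real.exp (-(1280 / 20) * (Fintype.card (Cube m × Cube m) : ℝ)) ≤
        Real.exp (-(64 * (m : ℝ) ^ 2)) := by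
      refine Real.exp_le_exp.2 ?_
      have h3 : (m : ℝ) ≤ 2 ^ m := by exact_mod_cast (Nat.lt_two_pow_self (n := m)).le
      simp only [Fintype.card_prod, Fintype.card_pi, Fintype.card_bool, Finset.prod_const,
        Finset.card_univ, Fintype.card_fin]
      push_cast
      nlinarith
    refine le_trans (le_of_eq ?_) (this.trans h2)
    congr!
  have hall : π.Pr (fun ω => ¬ S.HasDenseSet (81 / 100) ω) ≤
      π.Pr (fun ω => ∃ x : Cube m, 1 / 10 * (m : ℝ) ≤
        ((Finset.univ.filter fun i => ¬ (S.comap (fun v : Cube m × Cube m => (flipAt x i, v))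
          (Prod.mk_right_injective _)).HasDenseSet (9 / 10) ω).card : ℝ)) +
      π.Pr (fun ω => ∃ q : Cube m × Fin m, 1 / 10 * (Fintype.card (Cube m × Cube m) : ℝ) ≤
        ((Finset.univ.filter fun v => ¬ S.R ω (q.1, v) (flipAt q.1 q.2, v)).card : ℝ)) := by
    refine le_trans (π.Pr_mono fun ω hω => ?_) (π.Pr_or _ _)
    by_contra hn
    simp only [not_or, not_exists, not_le, Prod.forall] at hn
    refine hω (S.hasDenseSet_of_slices hm (fun x => ?_) hn.2)
    have := hn.1 x; linarith
  have g1 := π.pr_exists_univ_le (fun (x : Cube m) ω => 1 / 10 * (m : ℝ) ≤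
        ((Finset.univ.filter fun i => ¬ (S.comap (fun v : Cube m × Cube m => (flipAt x i, v))
          (Prod.mk_right_injective _)).HasDenseSet (9 / 10) ω).card : ℝ)) f1
  have g2 := π.pr_exists_univ_le (fun (q : Cube m × Fin m) ω =>
        1 / 10 * (Fintype.card (Cube m × Cube m) : ℝ) ≤
        ((Finset.univ.filter fun v => ¬ S.R ω (q.1, v) (flipAt q.1 q.2, v)).card : ℝ))
        fun q => f2 _ _
  refine hall.trans ((add_le_add g1 g2).trans ?_)
  simp only [Fintype.card_prod, Fintype.card_pi, Fintype.card_bool, Finset.prod_const,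
    Finset.card_univ, Fintype.card_fin]
  push_cast
  have h2 := two_pow_le_exp m
  have h3 : (m : ℝ) ≤ Real.exp m := by linarith [Real.add_one_le_exp (m : ℝ)]
  have h4 : (2 : ℝ) ^ m * e ≤ Real.exp (-(2 * (m : ℝ) ^ 2)) := by
    refine (mul_le_mul_of_nonneg_right h2 (Real.exp_pos _).le).trans ?_
    rw [← Real.exp_add]
    exact Real.exp_le_exp.2 (by nlinarith)
  have h5 : (2 : ℝ) ^ m * m * Real.exp (-(64 * (m : ℝ) ^ 2)) ≤ Real.exp (-(2 * (m : ℝ) ^ 2)) := by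
    refine (mul_le_mul_of_nonneg_right (mul_le_mul h2 h3 (by positivity) (Real.exp_pos _).le)
      (Real.exp_pos _).le).trans ?_
    rw [← Real.exp_add, ← Real.exp_add]
    exact Real.exp_le_exp.2 (by nlinarith)
  have h6 : 2 * Real.exp (-(2 * (m : ℝ) ^ 2)) ≤ Real.exp (-((m : ℝ) ^ 2)) := by
    have h7 : (2 : ℝ) ≤ Real.exp ((m : ℝ) ^ 2) := by
      have := Real.add_one_le_exp ((m : ℝ) ^ 2)
      nlinarith
    have h8 : Real.exp (-((m : ℝ) ^ 2)) = Real.exp ((m : ℝ) ^ 2) * Real.exp (-(2 * (m : ℝ) ^ 2)) := by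
      rw [← Real.exp_add]; congr 1; ring
    rw [h8]
    exact mul_le_mul_of_nonneg_right h7 (Real.exp_pos _).le
  linarith

end SiteBond

/-! ### Coarse fields of giant clusters and of blocks -/

namespace SiteBond

variable {Ω : Type*} [Fintype Ω] {π : FinProb Ω} {r R : ℕ} {X : Type*}
  (S : SiteBond π ((StarCube r R × StarCube r R) × X))

/-- The relation inside the copy over `x`. -/
def fiberRel (ω : Ω) (x : X) (z z' : StarCube r R × StarCube r R) : Prop := S.R ω (z, x) (z', x)

/-- The giant clusters of the copies over `x` and `x'` exist and are joined. -/
def GiantJoin (ω : Ω) (x x' : X) : Prop :=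
  ∃ v ∈ giantSites (S.fiberRel ω x), ∃ v' ∈ giantSites (S.fiberRel ω x'),
    ReachIn (S.R ω) {s | s.2 = x ∨ s.2 = x'} (v, x) (v', x')

theorem reach_of_fiber {ω : Ω} {x : X} {z z' : StarCube r R × StarCube r R}
    (h : ReachIn (S.fiberRel ω x) Set.univ z z') :
    ReachIn (S.R ω) {s | s.2 = x ∨ s.2 = x} (z, x) (z', x) := by
  induction h with
  | single h => exact .single (Or.inl rfl) (Or.inl rfl) h.2.2
  | tail _ h ih => exact ih.trans (.single (Or.inl rfl) (Or.inl rfl) h.2.2)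

/-- The field of joined giant clusters. -/
def giantField (hR : 0 < R) : SiteBond π X :=
  S.derive S.GiantJoin (fun x => {s | s.2 = x}) (fun _ _ h => disjoint_fibers Prod.snd h)
    (fun ω x x' ⟨v, hv, v', hv', h⟩ => ⟨v', hv', v, hv, by
      have := S.reach_symm h
      rwa [show {s : (StarCube r R × StarCube r R) × X | s.2 = x ∨ s.2 = x'} =
        {s | s.2 = x' ∨ s.2 = x} from Set.ext fun s => or_comm] at this⟩)
    (fun ω x x' ⟨v, hv, _⟩ => ⟨v, hv, v, hv, S.reach_of_fiber
      (giantSites_reach hR (fun _ _ h => S.symm ω _ _ h) hv hv)⟩)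
    (fun x x' ω ω' h => by
      have h1 : S.fiberRel ω x = S.fiberRel ω' x := by
        ext z z'; exact h _ (Or.inl rfl) _ (Or.inl rfl)
      have h2 : S.fiberRel ω x' = S.fiberRel ω' x' := by
        ext z z'; exact h _ (Or.inr rfl) _ (Or.inr rfl)
      have h3 := determinedBy_reachIn S.R {s | s.2 = x ∨ s.2 = x'} ω ω' h
      simp only [GiantJoin, h1, h2]
      simp only at h3
      rw [h3])

/-- The embedding of two copies over distinct points. -/
def copyMap (x x' : X) (v : CopySite r R) : (StarCube r R × StarCube r R) × X :=
  ((v.1.2, v.2), bif v.1.1 then x' else x)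

theorem copyMap_injective {x x' : X} (h : x ≠ x') :
    Function.Injective (copyMap (r := r) (R := R) x x') := by
  rintro ⟨⟨b, z⟩, w⟩ ⟨⟨b', z'⟩, w'⟩ he
  simp only [copyMap, Prod.mk.injEq] at he
  obtain ⟨⟨rfl, rfl⟩, h3⟩ := he
  cases b <;> cases b' <;> simp_all

theorem pr_not_giantJoin_le (hR : 0 < R) {x x' : X} (h : x ≠ x') {η : ℝ}
    (hη : π.Pr (fun ω => ¬ (S.comap _ (copyMap_injective h)).CopiesJoined ω) ≤ η) :
    π.Pr (fun ω => ¬ (S.giantField hR).R ω x x') ≤ η := by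
  refine le_trans (π.Pr_mono (q := fun ω =>
    ¬ (S.comap _ (copyMap_injective h)).CopiesJoined ω) fun ω hω hj => hω ?_) hη
  obtain ⟨v, hv, v', hv', hr⟩ := hj
  refine ⟨v, hv, v', hv', (S.reach_of_comap _ (copyMap_injective h) hr).mono ?_⟩
  rintro s ⟨⟨⟨b, z⟩, w⟩, -, rfl⟩
  cases b
  · exact Or.inl rfl
  · exact Or.inr rfl

/-- Consecutive joins may enter and leave a copy at different giant sites; these are connected
inside the copy by `giantSites_reach`. -/
theorem reach_of_giantField (hR : 0 < R) {ω : Ω} {x x' : X}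
    (h : ReachIn ((S.giantField hR).R ω) Set.univ x x') {v v' : StarCube r R × StarCube r R}
    (hv : v ∈ giantSites (S.fiberRel ω x)) (hv' : v' ∈ giantSites (S.fiberRel ω x')) :
    ReachIn (S.R ω) Set.univ (v, x) (v', x') := by
  have fib : ∀ {x : X} {v v' : StarCube r R × StarCube r R}, v ∈ giantSites (S.fiberRel ω x) →
      v' ∈ giantSites (S.fiberRel ω x) → ReachIn (S.R ω) Set.univ (v, x) (v', x) := fun hv hv' =>
    (S.reach_of_fiber (giantSites_reach hR (fun _ _ h => S.symm ω _ _ h) hv hv')).mono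
      (Set.subset_univ _)
  induction h generalizing v' with
  | single h =>
    obtain ⟨a, ha, b, hb, hab⟩ := h.2.2
    exact (fib hv ha).trans ((hab.mono (Set.subset_univ _)).trans (fib hb hv'))
  | tail _ h ih =>
    obtain ⟨a, ha, b, hb, hab⟩ := h.2.2
    exact (ih ha).trans ((hab.mono (Set.subset_univ _)).trans (fib hb hv'))

/-- A dense set of joined giant clusters gives a large connected set of sites. -/
theorem exists_section_of_hasDenseSet [Fintype X] (hR : 0 < R) {θ : ℝ} {ω : Ω}
    (h : (S.giantField hR).HasDenseSet θ ω) :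
    ∃ (D : Finset X) (f : X → StarCube r R × StarCube r R), θ * Fintype.card X ≤ D.card ∧
      ∀ a ∈ D, ∀ b ∈ D, ReachIn (S.R ω) Set.univ (f a, a) (f b, b) := by
  obtain ⟨D, h1, h2⟩ := h
  have h3 : ∀ a ∈ D, ∃ v, v ∈ giantSites (S.fiberRel ω a) := fun a ha => by
    obtain ⟨v, hv, _⟩ := (S.giantField hR).reach_good_left (h2 a ha a ha)
    exact ⟨v, hv⟩
  choose! f hf using h3
  exact ⟨D, f, h1, fun a ha b hb => S.reach_of_giantField hR (h2 a ha b hb) (hf a ha) (hf b hb)⟩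

end SiteBond

/-- A field on blocks: two sites are joined when both blocks are connected and some pair of
corresponding vertices is joined. -/
def BlockConn {V W Y : Type*} (ρ : V → V → Prop) (vert : Y → W → V) (s : W) : Prop :=
  ∀ y y', ReachIn (fun a b => ρ (vert a s) (vert b s)) Set.univ y y'

namespace SiteBond

variable {Ω : Type*} [Fintype Ω] {π : FinProb Ω} {V W Y : Type*} (S : SiteBond π V)
  (vert : Y → W → V)

/-- Both blocks are connected and some pair of corresponding vertices is joined. -/
def BlockJoin (ω : Ω) (s s' : W) : Prop :=
  BlockConn (S.R ω) vert s ∧ BlockConn (S.R ω) vert s' ∧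
    (s = s' ∨ ∃ y, S.R ω (vert y s) (vert y s'))

/-- The field of joined blocks. -/
def blockField (hv : Function.Injective fun q : Y × W => vert q.1 q.2) : SiteBond π W :=
  S.derive (S.BlockJoin vert) (fun s => Set.range fun y => vert y s)
    (fun s s' h => by
      rw [Set.disjoint_left]
      rintro _ ⟨y, rfl⟩ ⟨y', h'⟩
      exact h (Prod.mk.inj (hv (a₁ := (y', s')) (a₂ := (y, s)) h')).2.symm)
    (fun ω s s' ⟨h1, h2, h3⟩ => ⟨h2, h1, h3.imp Eq.symm fun ⟨y, hy⟩ => ⟨y, S.symm _ _ _ hy⟩⟩)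
    (fun ω s s' ⟨h1, _, _⟩ => ⟨h1, h1, Or.inl rfl⟩)
    (fun s s' ω ω' h => by
      have h1 : ∀ a b, S.R ω (vert a s) (vert b s) = S.R ω' (vert a s) (vert b s) := fun a b =>
        propext (h _ (Or.inl ⟨a, rfl⟩) _ (Or.inl ⟨b, rfl⟩))
      have h2 : ∀ a b, S.R ω (vert a s') (vert b s') = S.R ω' (vert a s') (vert b s') := fun a b =>
        propext (h _ (Or.inr ⟨a, rfl⟩) _ (Or.inr ⟨b, rfl⟩))
      have h3 : ∀ a, S.R ω (vert a s) (vert a s') = S.R ω' (vert a s) (vert a s') := fun a =>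
        propext (h _ (Or.inl ⟨a, rfl⟩) _ (Or.inr ⟨a, rfl⟩))
      simp only [BlockJoin, BlockConn, h1, h2, h3])

theorem reach_of_blockField (hv : Function.Injective fun q : Y × W => vert q.1 q.2) {ω : Ω}
    {s s' : W} (h : ReachIn ((S.blockField vert hv).R ω) Set.univ s s') (y y' : Y) :
    ReachIn (S.R ω) Set.univ (vert y s) (vert y' s') := by
  have one : ∀ {s s' : W}, S.BlockJoin vert ω s s' → ∀ y y',
      ReachIn (S.R ω) Set.univ (vert y s) (vert y' s') := by
    rintro s s' ⟨h1, h2, h3⟩ y y'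
    have c1 : ∀ a b, ReachIn (S.R ω) Set.univ (vert a s) (vert b s) := fun a b =>
      (h1 a b).map (fun a => vert a s) fun _ _ h => h
    have c2 : ∀ a b, ReachIn (S.R ω) Set.univ (vert a s') (vert b s') := fun a b =>
      (h2 a b).map (fun a => vert a s') fun _ _ h => h
    rcases h3 with rfl | ⟨z, hz⟩
    · exact c1 y y'
    · exact (c1 y z).trans ((ReachIn.single (Set.mem_univ _) (Set.mem_univ _) hz).trans (c2 z y'))
  induction h generalizing y' with
  | single h => exact one h.2.2 y y'
  | tail _ h ih => exact (ih y).trans (one h.2.2 y y')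

/-- When two connected blocks are unlinked, all pairs of corresponding vertices are unrelated. These
pairs are disjoint, so the probabilities multiply. -/
theorem pr_unlinked_block_le [Fintype Y] (hv : Function.Injective fun q : Y × W => vert q.1 q.2)
    {s s' : W} {θ : ℝ}
    (h : ∀ y, π.Pr (fun ω => ¬ S.R ω (vert y s) (vert y s')) ≤ θ) :
    π.Pr (fun ω => (S.blockField vert hv).Unlinked ω s s') ≤ θ ^ Fintype.card Y := by
  have h1 : π.Pr (fun ω => (S.blockField vert hv).Unlinked ω s s') ≤
      π.E (fun ω => ∏ y : Y, ind (¬ S.R ω (vert y s) (vert y s'))) := by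
    refine π.E_mono fun ω => ?_
    split_ifs with hu
    · obtain ⟨⟨h1, _⟩, ⟨h2, _⟩, h3⟩ := hu
      refine le_of_eq (Finset.prod_eq_one fun y _ => ?_).symm
      exact if_pos fun hr => h3 ⟨h1, h2, Or.inr ⟨y, hr⟩⟩
    · exact Finset.prod_nonneg fun _ _ => ind_nonneg _
  refine h1.trans ?_
  rw [S.indep_prod Finset.univ (fun y => {vert y s, vert y s'})]
  · refine (Finset.prod_le_prod (fun y _ => π.E_nonneg fun _ => ind_nonneg _)
      fun y _ => h y).trans ?_
    rw [Finset.prod_const, Finset.card_univ]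
  · intro y _ y' _ hy
    have e : ∀ a b, vert y a ≠ vert y' b := fun a b he =>
      hy (Prod.mk.inj (hv (a₁ := (y, a)) (a₂ := (y', b)) he)).1
    simp [Set.disjoint_left, e]
  · intro y _
    exact (S.det_not_rel (by simp) (by simp)).comp ind

end SiteBond

/-! ### One-independent models as random fields -/

namespace FinProb

/-- The weights of a probability measure on a finite space. -/
def ofMeasure {Ω : Type*} [Fintype Ω] [MeasurableSpace Ω] [MeasurableSingletonClass Ω]
    (μ : Measure Ω) [IsProbabilityMeasure μ] : FinProb Ω where
  w ω := μ.real {ω}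
  nonneg _ := measureReal_nonneg
  total := by rw [sum_measureReal_singleton]; simp

variable {Ω : Type*} [Fintype Ω] [MeasurableSpace Ω] [MeasurableSingletonClass Ω]
    (μ : Measure Ω) [IsProbabilityMeasure μ]

theorem ofMeasure_E (f : Ω → ℝ) : (ofMeasure μ).E f = ∫ ω, f ω ∂μ := by
  rw [integral_fintype Integrable.of_finite]
  rfl

theorem ofMeasure_Pr (p : Ω → Prop) : (ofMeasure μ).Pr p = μ.real {ω | p ω} := by
  rw [Pr, ofMeasure_E, ← integral_indicator_one (Set.toFinite _).measurableSet]
  rfl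

end FinProb

section Percolation

variable {V V' : Type*} {G : SimpleGraph V} {G' : SimpleGraph V'}

theorem openSubgraph_adj (ω : EdgeConfig G) (e : G.edgeSet) (u v : V) (he : (e : Sym2 V) = s(u, v)) :
    (openSubgraph G ω).Adj u v ↔ ω e = true := by
  obtain ⟨e, h⟩ := e
  simp only at he
  subst he
  exact ⟨fun ⟨_, h'⟩ => h', fun h' => ⟨h, h'⟩⟩

/-- The random field of open edges of a 1-independent model. -/
def percolationField [Finite V] [Fintype (EdgeConfig G)] {p : ℝ} (μ : Measure (EdgeConfig G))
    [IsProbabilityMeasure μ] (hμ : IsOneIndepModel G p μ) :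
    SiteBond (FinProb.ofMeasure μ) V where
  R ω u v := u = v ∨ (openSubgraph G ω).Adj u v
  symm ω u v h := h.imp Eq.symm fun h => h.symm
  left ω u v _ := Or.inl rfl
  indep A B hAB f g hf hg := by
    -- A function determined by the relation on `A` factors through the states of the edges inside
    -- `A`. Edges inside disjoint sets share no vertex, so 1-independence applies.
    have key : ∀ (A : Set V) (f : EdgeConfig G → ℝ),
        DeterminedBy (fun ω u v => u = v ∨ (openSubgraph G ω).Adj u v) A f →
        ∃ F : ({e : G.edgeSet | ∀ v ∈ (e : Sym2 V), v ∈ A} → Bool) → ℝ,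
          f = F ∘ fun ω e => ω e := by
      intro A f hf
      refine ⟨Function.extend (fun (ω : EdgeConfig G)
        (e : {e : G.edgeSet | ∀ v ∈ (e : Sym2 V), v ∈ A}) => ω e) f 0, ?_⟩
      ext ω
      refine (Function.FactorsThrough.extend_apply (fun ω ω' h => ?_) _ ω).symm
      refine hf ω ω' fun u hu v hv => or_congr_right ?_
      by_cases he : s(u, v) ∈ G.edgeSet
      · have h1 := congrFun h ⟨⟨s(u, v), he⟩, fun w hw => by
          rcases Sym2.mem_iff.1 hw with rfl | rfl
          · exact hu
          · exact hv⟩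
        rw [openSubgraph_adj ω ⟨s(u, v), he⟩ u v rfl, openSubgraph_adj ω' ⟨s(u, v), he⟩ u v rfl]
        exact iff_of_eq (congrArg (· = true) h1)
      · exact ⟨fun ⟨h, _⟩ => absurd h he, fun ⟨h, _⟩ => absurd h he⟩
    obtain ⟨F, rfl⟩ := key A f hf
    obtain ⟨F', rfl⟩ := key B g hg
    have hI := (hμ.indep {e : G.edgeSet | ∀ v ∈ (e : Sym2 V), v ∈ A}
      {e : G.edgeSet | ∀ v ∈ (e : Sym2 V), v ∈ B}
      (fun e₁ h1 e₂ h2 v hv hv' => Set.disjoint_left.1 hAB (h1 v hv) (h2 v hv'))).comp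
      (measurable_of_finite F) (measurable_of_finite F')
    rw [FinProb.ofMeasure_E, FinProb.ofMeasure_E, FinProb.ofMeasure_E]
    exact hI.integral_fun_mul_eq_mul_integral Integrable.of_finite.aestronglyMeasurable
      Integrable.of_finite.aestronglyMeasurable

theorem percolationField_not_le [Finite V] [Fintype (EdgeConfig G)] {p : ℝ}
    (μ : Measure (EdgeConfig G)) [IsProbabilityMeasure μ] (hμ : IsOneIndepModel G p μ) {u v : V}
    (huv : G.Adj u v) :
    (FinProb.ofMeasure μ).Pr (fun ω => ¬ (percolationField μ hμ).R ω u v) ≤ 1 - p := by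
  rw [FinProb.Pr_not]
  have h1 := hμ.le_prob_open ⟨s(u, v), huv⟩
  have h2 : μ.real {ω | ω ⟨s(u, v), huv⟩ = true} ≤
      (FinProb.ofMeasure μ).Pr (fun ω => (percolationField μ hμ).R ω u v) := by
    rw [FinProb.ofMeasure_Pr]
    refine measureReal_mono fun ω hω => Or.inr ?_
    exact (openSubgraph_adj ω ⟨s(u, v), huv⟩ u v rfl).2 hω
  linarith

theorem reachable_of_reachIn [Finite V] [Fintype (EdgeConfig G)] {p : ℝ}
    {μ : Measure (EdgeConfig G)} [IsProbabilityMeasure μ] {hμ : IsOneIndepModel G p μ}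
    {ω : EdgeConfig G} {u v : V} (h : ReachIn ((percolationField μ hμ).R ω) Set.univ u v) :
    (openSubgraph G ω).Reachable u v := by
  have one : ∀ {u v : V}, (percolationField μ hμ).R ω u v → (openSubgraph G ω).Reachable u v := by
    rintro u v (rfl | h)
    · exact SimpleGraph.Reachable.refl _
    · exact h.reachable
  induction h with
  | single h => exact one h.2.2
  | tail _ h ih => exact ih.trans (one h.2.2)

/-- The restriction of a configuration along a graph homomorphism. -/
def restrictConfig (φ : G' →g G) (ω : EdgeConfig G) : EdgeConfig G' := fun e => ω (φ.mapEdgeSet e)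

/-- Injectivity on vertices keeps vertex-disjoint sets of edges vertex-disjoint. Through this lemma
the hypothesis on `Q_k` applies to every embedded block. -/
theorem isOneIndepModel_map [Finite V] [Finite V'] {p : ℝ} {μ : Measure (EdgeConfig G)}
    (hμ : IsOneIndepModel G p μ) (φ : G' →g G) (hφ : Function.Injective φ) :
    IsOneIndepModel G' p (μ.map (restrictConfig φ)) := by
  have := hμ.isProbabilityMeasure
  have hm : Measurable (restrictConfig (G := G) φ) := measurable_of_finite _
  refine ⟨Measure.isProbabilityMeasure_map hm.aemeasurable, fun S₁ S₂ h => ?_, fun e => ?_⟩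
  · have hI := hμ.indep (φ.mapEdgeSet '' S₁) (φ.mapEdgeSet '' S₂) ?_
    · have hI' := hI.comp
        (φ := fun (η : (φ.mapEdgeSet '' S₁ : Set G.edgeSet) → Bool) (e : S₁) =>
          η ⟨φ.mapEdgeSet e, Set.mem_image_of_mem _ e.2⟩)
        (ψ := fun (η : (φ.mapEdgeSet '' S₂ : Set G.edgeSet) → Bool) (e : S₂) =>
          η ⟨φ.mapEdgeSet e, Set.mem_image_of_mem _ e.2⟩)
        (measurable_of_finite _) (measurable_of_finite _)
      rw [indepFun_iff_measure_inter_preimage_eq_mul] at hI' ⊢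
      intro s t hs ht
      have m1 : MeasurableSet ((fun (ω : EdgeConfig G') (e : S₁) => ω e) ⁻¹' s) :=
        (Set.toFinite _).measurableSet
      have m2 : MeasurableSet ((fun (ω : EdgeConfig G') (e : S₂) => ω e) ⁻¹' t) :=
        (Set.toFinite _).measurableSet
      rw [Measure.map_apply hm (m1.inter m2), Measure.map_apply hm m1, Measure.map_apply hm m2]
      exact hI' s t hs ht
    · rintro _ ⟨e₁, h1, rfl⟩ _ ⟨e₂, h2, rfl⟩ v hv hv'
      obtain ⟨a, ha, rfl⟩ := Sym2.mem_map.1 hv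
      obtain ⟨b, hb, hab⟩ := Sym2.mem_map.1 hv'
      exact h e₁ h1 e₂ h2 a ha (hφ hab ▸ hb)
  · rw [map_measureReal_apply hm (Set.toFinite _).measurableSet]
    exact hμ.le_prob_open (φ.mapEdgeSet e)

/-- The model in which all edges are open. -/
theorem isOneIndepModel_dirac [Finite V] {p : ℝ} (hp : p ≤ 1) :
    IsOneIndepModel G p (Measure.dirac fun _ => true) := by
  refine ⟨inferInstance, fun S₁ S₂ _ => ?_, fun e => ?_⟩
  · rw [indepFun_iff_measure_inter_preimage_eq_mul]
    intro s t _ _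
    have m1 : MeasurableSet ((fun (ω : EdgeConfig G) (e : S₁) => ω e) ⁻¹' s) :=
      (Set.toFinite _).measurableSet
    have m2 : MeasurableSet ((fun (ω : EdgeConfig G) (e : S₂) => ω e) ⁻¹' t) :=
      (Set.toFinite _).measurableSet
    rw [Measure.dirac_apply' _ (m1.inter m2), Measure.dirac_apply' _ m1, Measure.dirac_apply' _ m2]
    simp only [Set.indicator_apply, Set.mem_inter_iff, Pi.one_apply]
    split_ifs <;> simp_all
  · rw [measureReal_def, Measure.dirac_apply' _ (Set.toFinite _).measurableSet]
    simpa using hp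

end Percolation

/-! ### Embedding of blocks and star-shaped cubes in the hypercube -/

section Coordinates

/-- Two functions differ in exactly one place. -/
def DiffOne {ι : Type*} (f g : ι → Bool) : Prop := ∃! i, f i ≠ g i

theorem DiffOne.symm {ι : Type*} {f g : ι → Bool} (h : DiffOne f g) : DiffOne g f := by
  simpa only [DiffOne, ne_comm] using h

theorem DiffOne.elim_left {ι κ : Type*} {f g : ι → Bool} (h : DiffOne f g) (k : κ → Bool) :
    DiffOne (Sum.elim f k) (Sum.elim g k) := by
  obtain ⟨i, hi, hu⟩ := h
  refine ⟨Sum.inl i, hi, ?_⟩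
  rintro (j | j) hj
  · exact congrArg Sum.inl (hu j hj)
  · exact absurd rfl hj

theorem DiffOne.elim_right {ι κ : Type*} {f g : ι → Bool} (h : DiffOne f g) (k : κ → Bool) :
    DiffOne (Sum.elim k f) (Sum.elim k g) := by
  obtain ⟨i, hi, hu⟩ := h
  refine ⟨Sum.inr i, hi, ?_⟩
  rintro (j | j) hj
  · exact absurd rfl hj
  · exact congrArg Sum.inr (hu j hj)

theorem DiffOne.extend {ι κ : Type*} {f g : ι → Bool} (h : DiffOne f g) (c : ι ↪ κ) :
    DiffOne (Function.extend c f fun _ => false) (Function.extend c g fun _ => false) := by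
  obtain ⟨i, hi, hu⟩ := h
  refine ⟨c i, by simpa only [c.injective.extend_apply] using hi, fun j hj => ?_⟩
  by_cases hc : ∃ a, c a = j
  · obtain ⟨a, rfl⟩ := hc
    simp only [c.injective.extend_apply] at hj
    exact congrArg c (hu a hj)
  · simp [Function.extend_apply' _ _ _ hc] at hj

theorem diffOne_flipAt {m : ℕ} (x : Cube m) (i : Fin m) : DiffOne x (flipAt x i) := by
  refine ⟨i, by simp [flipAt], fun j hj => ?_⟩
  by_contra h
  simp [flipAt, h] at hj

/-- The coordinates of a point of the star-shaped cube. -/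
def starCode {r R : ℕ} (z : StarCube r R) : Fin r × Fin R → Bool := fun q => decide (z q.1 = some q.2)

theorem starCode_injective {r R : ℕ} : Function.Injective (starCode (r := r) (R := R)) := by
  intro z z' h
  have h1 : ∀ i v, z i = some v ↔ z' i = some v := fun i v => by
    have := congrFun h (i, v)
    simpa [starCode] using this
  ext1 i
  exact Option.ext fun v => h1 i v

/-- A missing coordinate is coded by a zero row and a present one by a unit row, so passing from a
hub to a leaf changes a single bit. -/
theorem diffOne_starCode {r R : ℕ} (A : HubLabel r R) (i : Fin r) :
    DiffOne (starCode (hub A)) (starCode (leaf A i)) := by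
  refine ⟨(i, A i), by simp [starCode, hub, leaf], ?_⟩
  rintro ⟨j, v⟩ hj
  by_cases hij : j = i
  · subst hij
    have : A j = v := by
      by_contra hne
      simp [starCode, hub, leaf, hne] at hj
    rw [this]
  · simp [starCode, hub, leaf, hij] at hj

variable {k r R m n : ℕ}

/-- The index set of the coordinates used by the renormalization. -/
abbrev CoordIndex (k r R m : ℕ) :=
  Fin k ⊕ (((Fin r × Fin R) ⊕ (Fin r × Fin R)) ⊕ (Fin m ⊕ (Fin m ⊕ Fin m)))

/-- The sites of the renormalized lattice. -/
abbrev BlockSite (r R m : ℕ) := (StarCube r R × StarCube r R) × (Cube m × (Cube m × Cube m))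

/-- The coordinates of the vertex `y` in the block over `s`. -/
def blockCoord (y : Cube k) (s : BlockSite r R m) : CoordIndex k r R m → Bool :=
  Sum.elim y (Sum.elim (Sum.elim (starCode s.1.1) (starCode s.1.2))
    (Sum.elim s.2.1 (Sum.elim s.2.2.1 s.2.2.2)))

/-- The vertex `y` in the block over `s`. -/
def blockVertex (c : CoordIndex k r R m ↪ Fin n) (y : Cube k) (s : BlockSite r R m) :
    Fin n → Bool :=
  Function.extend c (blockCoord y s) fun _ => false

theorem blockVertex_injective (c : CoordIndex k r R m ↪ Fin n) :
    Function.Injective fun q : Cube k × BlockSite r R m => blockVertex c q.1 q.2 := by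
  rintro ⟨y, ⟨⟨z, w⟩, ⟨a, b, d⟩⟩⟩ ⟨y', ⟨⟨z', w'⟩, ⟨a', b', d'⟩⟩⟩ h
  have h1 : ∀ j, blockCoord y ((z, w), (a, (b, d))) j = blockCoord y' ((z', w'), (a', (b', d'))) j :=
    fun j => by
      have := congrFun h (c j)
      simpa only [blockVertex, c.injective.extend_apply] using this
  have e1 : y = y' := funext fun j => h1 (Sum.inl j)
  have e2 : z = z' := starCode_injective (funext fun j => h1 (Sum.inr (Sum.inl (Sum.inl j))))
  have e3 : w = w' := starCode_injective (funext fun j => h1 (Sum.inr (Sum.inl (Sum.inr j))))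
  have e4 : a = a' := funext fun j => h1 (Sum.inr (Sum.inr (Sum.inl j)))
  have e5 : b = b' := funext fun j => h1 (Sum.inr (Sum.inr (Sum.inr (Sum.inl j))))
  have e6 : d = d' := funext fun j => h1 (Sum.inr (Sum.inr (Sum.inr (Sum.inr j))))
  subst e1 e2 e3 e4 e5 e6
  rfl

theorem hypercube_adj_iff {u v : Fin n → Bool} : (hypercube n).Adj u v ↔ DiffOne u v := Iff.rfl

/-- The embedding of a block. -/
def blockHom (c : CoordIndex k r R m ↪ Fin n) (s : BlockSite r R m) :
    hypercube k →g hypercube n where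
  toFun y := blockVertex c y s
  map_rel' h := ((hypercube_adj_iff.1 h).elim_left _).extend c

theorem blockHom_injective (c : CoordIndex k r R m ↪ Fin n) (s : BlockSite r R m) :
    Function.Injective (blockHom c s) := fun y y' h =>
  (Prod.mk.inj (blockVertex_injective c (a₁ := (y, s)) (a₂ := (y', s)) h)).1

end Coordinates

/-! ### Renormalization of a model on the hypercube -/

section Renormalization

variable {k r R m n : ℕ} {p : ℝ} {μ : Measure (EdgeConfig (hypercube n))} [IsProbabilityMeasure μ]

/-- The renormalized field of a model on the hypercube. -/
def cubeField (hμ : IsOneIndepModel (hypercube n) p μ) (c : CoordIndex k r R m ↪ Fin n) :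
    SiteBond (FinProb.ofMeasure μ) (BlockSite r R m) :=
  (percolationField μ hμ).blockField (blockVertex c) (blockVertex_injective c)

theorem blockConn_of_connected (hμ : IsOneIndepModel (hypercube n) p μ)
    (c : CoordIndex k r R m ↪ Fin n) (s : BlockSite r R m) {ω : EdgeConfig (hypercube n)}
    (h : restrictConfig (blockHom c s) ω ∈ connectedEvent k) :
    BlockConn ((percolationField μ hμ).R ω) (blockVertex c) s := by
  intro y y'
  have h1 := SimpleGraph.reachable_iff_reflTransGen y y' |>.1
    ((show (openSubgraph (hypercube k) _).Connected from h).preconnected y y')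
  induction h1 with
  | refl => exact .single trivial trivial (Or.inl rfl)
  | tail _ h2 ih =>
    refine ih.trans (.single trivial trivial (Or.inr ?_))
    obtain ⟨he, ho⟩ := h2
    exact (openSubgraph_adj ω ((blockHom c s).mapEdgeSet ⟨_, he⟩) _ _ rfl).2 ho

theorem cubeField_good (hμ : IsOneIndepModel (hypercube n) p μ) (c : CoordIndex k r R m ↪ Fin n)
    {P : ℝ} (hP : ∀ μ : Measure (EdgeConfig (hypercube k)), IsOneIndepModel (hypercube k) p μ →
      P ≤ μ.real (connectedEvent k)) (s : BlockSite r R m) :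
    P ≤ (FinProb.ofMeasure μ).Pr (fun ω => (cubeField hμ c).R ω s s) := by
  refine (hP _ (isOneIndepModel_map hμ (blockHom c s) (blockHom_injective c s))).trans ?_
  rw [FinProb.ofMeasure_Pr, map_measureReal_apply (measurable_of_finite _)
    (Set.toFinite _).measurableSet]
  refine measureReal_mono fun ω hω => ?_
  have := blockConn_of_connected hμ c s hω
  exact ⟨this, this, Or.inl rfl⟩

theorem cubeField_unlinked (hμ : IsOneIndepModel (hypercube n) p μ)
    (c : CoordIndex k r R m ↪ Fin n) {s s' : BlockSite r R m}
    (h : ∀ y : Cube k, DiffOne (blockCoord y s) (blockCoord y s')) :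
    (FinProb.ofMeasure μ).Pr (fun ω => (cubeField hμ c).Unlinked ω s s') ≤ (1 - p) ^ 2 ^ k := by
  have := (percolationField μ hμ).pr_unlinked_block_le (blockVertex c) (blockVertex_injective c)
    (s := s) (s' := s') (θ := 1 - p) fun y => percolationField_not_le μ hμ ((h y).extend c)
  rwa [show Fintype.card (Cube k) = 2 ^ k by simp] at this

/-- All pairs of sites compared in the local argument differ in one bit of the hypercube, so `2 ^ k`
parallel edges run between their blocks. -/
theorem localHyp_of_diffOne (hμ : IsOneIndepModel (hypercube n) p μ)
    (c : CoordIndex k r R m ↪ Fin n) {P Q : ℝ}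
    (hP : ∀ μ : Measure (EdgeConfig (hypercube k)), IsOneIndepModel (hypercube k) p μ →
      P ≤ μ.real (connectedEvent k)) (hQ : (1 - p) ^ 2 ^ k ≤ Q)
    {x x' : Cube m × (Cube m × Cube m)} (hne : x ≠ x')
    (hx : DiffOne (Sum.elim x.1 (Sum.elim x.2.1 x.2.2)) (Sum.elim x'.1 (Sum.elim x'.2.1 x'.2.2))) :
    ((cubeField hμ c).comap _ (SiteBond.copyMap_injective hne)).LocalHyp P Q where
  good _ := cubeField_good hμ c hP _
  unlX b A i w := by
    refine (cubeField_unlinked hμ c fun y => ?_).trans hQ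
    exact (((diffOne_starCode A i).elim_left _).elim_left _).elim_right _
  unlY u B j := by
    refine (cubeField_unlinked hμ c fun y => ?_).trans hQ
    exact (((diffOne_starCode B j).elim_right _).elim_left _).elim_right _
  unlE b z w := by
    refine (cubeField_unlinked hμ c fun y => ?_).trans hQ
    cases b
    · exact (hx.elim_right _).elim_right _
    · exact (hx.symm.elim_right _).elim_right _

/-- One vertex is kept from each copy in the dense set. The unused coordinates are bounded in number
and affect only the constant `C`. -/
theorem giant_of_hasDenseSet (hR : 0 < R) (hμ : IsOneIndepModel (hypercube n) p μ)
    (c : CoordIndex k r R m ↪ Fin n) {C : ℝ} (hC : C * 2 ^ n ≤ 81 / 100 * 2 ^ (3 * m))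
    {ω : EdgeConfig (hypercube n)}
    (h : ((cubeField hμ c).giantField hR).HasDenseSet (81 / 100) ω) : ω ∈ giantEvent n C := by
  obtain ⟨D, f, h1, h2⟩ := (cubeField hμ c).exists_section_of_hasDenseSet hR h
  have hcard : (Fintype.card (Cube m × (Cube m × Cube m)) : ℝ) = 2 ^ (3 * m) := by
    simp only [Fintype.card_prod, Fintype.card_pi, Fintype.card_bool, Finset.prod_const,
      Finset.card_univ, Fintype.card_fin]
    push_cast
    ring
  rw [hcard] at h1
  have hDpos : (0 : ℝ) < D.card := lt_of_lt_of_le (by positivity) h1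
  obtain ⟨a₀, ha₀⟩ := Finset.card_pos.1 (by exact_mod_cast hDpos : 0 < D.card)
  let y₀ : Cube k := fun _ => false
  let g : Cube m × (Cube m × Cube m) → (Fin n → Bool) := fun a => blockVertex c y₀ (f a, a)
  have hg : Function.Injective g := fun a b hab =>
    (Prod.mk.inj (Prod.mk.inj (blockVertex_injective c (a₁ := (y₀, (f a, a)))
      (a₂ := (y₀, (f b, b))) hab)).2).2
  refine ⟨(openSubgraph (hypercube n) ω).connectedComponentMk (g a₀), ?_⟩
  refine hC.trans (h1.trans (Nat.cast_le.2 ?_))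
  have h3 : (D.image g : Set (Fin n → Bool)) ⊆
      ((openSubgraph (hypercube n) ω).connectedComponentMk (g a₀)).supp := by
    intro v hv
    obtain ⟨a, ha, rfl⟩ := Finset.mem_image.1 (Finset.mem_coe.1 hv)
    rw [SimpleGraph.ConnectedComponent.mem_supp_iff, SimpleGraph.ConnectedComponent.eq]
    exact reachable_of_reachIn ((percolationField μ hμ).reach_of_blockField (blockVertex c)
      (blockVertex_injective c) (h2 a ha a₀ ha₀) y₀ y₀)
  have h4 := Set.ncard_le_ncard h3 (Set.toFinite _)
  rw [Set.ncard_coe_finset, Finset.card_image_of_injective _ hg] at h4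
  exact h4

end Renormalization

/-- The bound `exp (-1280) / 10` on absent bonds is what `pr_not_hasDenseSet_three_le` requires. -/
theorem le_measureReal_giantEvent {k r R m n : ℕ} {p P Q C : ℝ} (hR : 0 < R) (hm : 3 ≤ m)
    {μ : Measure (EdgeConfig (hypercube n))} (hμ : IsOneIndepModel (hypercube n) p μ)
    (c : CoordIndex k r R m ↪ Fin n)
    (hP : ∀ μ : Measure (EdgeConfig (hypercube k)), IsOneIndepModel (hypercube k) p μ →
      P ≤ μ.real (connectedEvent k)) (hQ : (1 - p) ^ 2 ^ k ≤ Q)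
    (hloc : ∀ {Ω : Type} [Fintype Ω] {π : FinProb Ω} (S : SiteBond π (CopySite r R)),
      S.LocalHyp P Q → π.Pr (fun ω => ¬ S.CopiesJoined ω) ≤ Real.exp (-1280) / 10)
    (hC : C * 2 ^ n ≤ 81 / 100 * 2 ^ (3 * m)) :
    1 - Real.exp (-((m : ℝ) ^ 2)) ≤ μ.real (giantEvent n C) := by
  have := hμ.isProbabilityMeasure
  have hbond : ∀ {x x' : Cube m × (Cube m × Cube m)}, x ≠ x' →
      DiffOne (Sum.elim x.1 (Sum.elim x.2.1 x.2.2)) (Sum.elim x'.1 (Sum.elim x'.2.1 x'.2.2)) →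
      (FinProb.ofMeasure μ).Pr (fun ω => ¬ ((cubeField hμ c).giantField hR).R ω x x') ≤
        Real.exp (-1280) / 10 := fun hne hx =>
    (cubeField hμ c).pr_not_giantJoin_le hR hne (hloc _ (localHyp_of_diffOne hμ c hP hQ hne hx))
  have h1 := ((cubeField hμ c).giantField hR).pr_not_hasDenseSet_three_le hm
    (η := Real.exp (-1280) / 10) (by linarith) (by positivity)
    (fun x v i => hbond (fun h => flipAt_ne x i (Prod.mk.inj h).1.symm)
      ((diffOne_flipAt x i).elim_left _))
    (fun x y z i => hbond (fun h => flipAt_ne y i (Prod.mk.inj (Prod.mk.inj h).2).1.symm)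
      (((diffOne_flipAt y i).elim_left _).elim_right _))
    (fun x y z i => hbond (fun h => flipAt_ne z i (Prod.mk.inj (Prod.mk.inj h).2).2.symm)
      (((diffOne_flipAt z i).elim_right _).elim_right _))
  rw [FinProb.Pr_not] at h1
  have h2 : (FinProb.ofMeasure μ).Pr (((cubeField hμ c).giantField hR).HasDenseSet (81 / 100)) ≤
      μ.real (giantEvent n C) := by
    rw [FinProb.ofMeasure_Pr]
    exact measureReal_mono fun ω hω => giant_of_hasDenseSet hR hμ c hC hω
  linarith

theorem giantEvent_eq_univ {n : ℕ} {C : ℝ} (hC : C * 2 ^ n ≤ 1) : giantEvent n C = Set.univ := by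
  refine Set.eq_univ_of_forall fun ω => ?_
  refine ⟨(openSubgraph (hypercube n) ω).connectedComponentMk fun _ => false, hC.trans ?_⟩
  have : 0 < ((openSubgraph (hypercube n) ω).connectedComponentMk fun _ => false).supp.ncard :=
    (Set.ncard_pos (Set.toFinite _)).2 ⟨_, rfl⟩
  exact_mod_cast this

/-- Connectivity of small cubes with large probability forces a giant component in large cubes. -/
theorem giant_component_of_connected (p : ℝ) (k : ℕ) (P : ℝ) (hp1 : p ≤ 1)
    (hk : 1 ≤ k) (hlt : (1 - p) ^ (2 ^ (k - 1)) * Real.goldenRatio < P)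
    (hP : ∀ μ : Measure (EdgeConfig (hypercube k)), IsOneIndepModel (hypercube k) p μ →
        P ≤ μ.real (connectedEvent k)) :
      ∃ C : ℝ, 0 < C ∧ ∃ c : ℝ, 0 < c ∧
        ∀ (n : ℕ) (μ : Measure (EdgeConfig (hypercube n))), IsOneIndepModel (hypercube n) p μ →
          1 - Real.exp (-(c * (n : ℝ) ^ 2)) ≤ μ.real (giantEvent n C) := by
  set q := (1 - p) ^ (2 ^ (k - 1)) with hq
  have hq0 : 0 ≤ q := pow_nonneg (by linarith) _
  have hφ := Real.goldenRatio_pos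
  have hφ2 := Real.goldenRatio_sq
  have hP0 : 0 < P := lt_of_le_of_lt (by positivity) hlt
  have hP1 : P ≤ 1 := (hP _ (isOneIndepModel_dirac hp1)).trans measureReal_le_one
  -- By `φ ^ 2 = φ + 1`, this is the product `(P - q * φ) * (P + q * (φ - 1))`.
  have hquad : 0 < P * (P - q) - q ^ 2 := by
    have h1 : 0 < P - q * Real.goldenRatio := by linarith
    have h2 : 0 < P + q * (Real.goldenRatio - 1) := by
      have := Real.one_lt_goldenRatio
      have := mul_nonneg hq0 (by linarith : 0 ≤ Real.goldenRatio - 1)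
      linarith
    have h3 := mul_pos h1 h2
    nlinarith
  -- Any `α` slightly above `q` will do. With the excess `d / 2`, the gap `d - P * d / 2` stays
  -- positive because `P ≤ 1`.
  obtain ⟨α, hα0, hα1, hgap, hQα⟩ : ∃ α : ℝ, 0 < α ∧ α ≤ 1 ∧ q ^ 2 < (P - α) * P ∧ q ^ 2 < α ^ 2 := by
    set d := P * (P - q) - q ^ 2 with hd
    have hgap : q ^ 2 < (P - (q + d / 2)) * P := by nlinarith
    have hα : 0 < q + d / 2 := by linarith
    refine ⟨q + d / 2, hα, ?_, hgap, by nlinarith⟩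
    by_contra hn
    nlinarith [sq_nonneg q]
  obtain ⟨r, R, hR, hloc⟩ := exists_copiesJoined hP0.le hP1 (sq_nonneg q) hα0 hα1 hgap hQα
    (η := Real.exp (-1280) / 10) (by positivity)
  have hQ : (1 - p) ^ 2 ^ k ≤ q ^ 2 := by
    rw [hq, ← pow_mul, ← pow_succ, Nat.sub_add_cancel hk]
  set n₀ := k + 2 * (r * R) with hn₀
  -- For `n ≥ N` one has `n ≤ 6 * m`, which explains the constant `1 / 36`. For `n < N` the required
  -- size is at most one vertex.
  set N := 2 * (n₀ + 20) with hN
  refine ⟨(1 / 2) ^ N, by positivity, 1 / 36, by norm_num, fun n μ hμ => ?_⟩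
  have hprob := hμ.isProbabilityMeasure
  by_cases hn : n < N
  · rw [giantEvent_eq_univ]
    · have := Real.exp_pos (-(1 / 36 * (n : ℝ) ^ 2))
      rw [probReal_univ]
      linarith
    · rw [one_div, inv_pow, inv_mul_le_iff₀ (by positivity), mul_one]
      exact pow_le_pow_right₀ (by norm_num) hn.le
  · push Not at hn
    set m := (n - n₀) / 3 with hm
    have hm1 : 3 * m + n₀ ≤ n := by omega
    have hm2 : n ≤ 3 * m + n₀ + 2 := by omega
    have hm3 : n ≤ 6 * m := by omega
    have hm4 : 3 ≤ m := by omega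
    have hcard : Fintype.card (CoordIndex k r R m) ≤ Fintype.card (Fin n) := by
      simp only [Fintype.card_sum, Fintype.card_prod, Fintype.card_fin]
      omega
    obtain ⟨c⟩ := Function.Embedding.nonempty_of_card_le hcard
    have h1 := le_measureReal_giantEvent hR hm4 hμ c hP hQ hloc (C := (1 / 2) ^ N) ?_
    · refine le_trans ?_ h1
      have h2 : Real.exp (-((m : ℝ) ^ 2)) ≤ Real.exp (-(1 / 36 * (n : ℝ) ^ 2)) := by
        refine Real.exp_le_exp.2 ?_
        have h3 : (n : ℝ) ≤ 6 * m := by exact_mod_cast hm3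
        nlinarith [Nat.cast_nonneg (α := ℝ) n]
      linarith
    · have h2 : (2 : ℝ) ^ n ≤ 2 ^ (3 * m) * 2 ^ (n₀ + 2) := by
        rw [← pow_add]
        exact pow_le_pow_right₀ (by norm_num) (by omega)
      have h3 : (2 : ℝ) ^ (n₀ + 2) * 2 ≤ 2 ^ N := by
        rw [← pow_succ]
        exact pow_le_pow_right₀ (by norm_num) (by omega)
      have h4 : (0 : ℝ) < 2 ^ (3 * m) := by positivity
      rw [one_div, inv_pow, inv_mul_le_iff₀ (by positivity)]
      have h5 := mul_le_mul_of_nonneg_left h3 h4.le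
      have h6 : (0 : ℝ) < 2 ^ N * 2 ^ (3 * m) := by positivity
      linarith

/-! ### Reduction to exact edge probabilities -/

/-- Adjoin an independent coin to a finite probability space. -/
def FinProb.coin {Ω : Type*} [Fintype Ω] (π : FinProb Ω) (t : ℝ) (h0 : 0 ≤ t) (h1 : t ≤ 1) :
    FinProb (Ω × Bool) where
  w x := π.w x.1 * if x.2 then t else 1 - t
  nonneg x := mul_nonneg (π.nonneg _) (by split_ifs <;> linarith)
  total := by simp [Fintype.sum_prod_type, ← mul_add, π.total]

theorem FinProb.coin_E {Ω : Type*} [Fintype Ω] (π : FinProb Ω) {t : ℝ} (h0 : 0 ≤ t) (h1 : t ≤ 1)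
    (f : Ω × Bool → ℝ) : (π.coin t h0 h1).E f =
      t * π.E (fun ω => f (ω, true)) + (1 - t) * π.E (fun ω => f (ω, false)) := by
  simp only [E, coin, Fintype.sum_prod_type, Fintype.sum_bool, Finset.sum_add_distrib,
    Finset.mul_sum, if_true, Bool.false_eq_true, if_false]
  congr 1 <;> exact Finset.sum_congr rfl fun _ _ => by ring

namespace SiteBond

variable {Ω : Type*} [Fintype Ω] {π : FinProb Ω} {V : Type*} (S : SiteBond π V)

/-- Independent thinning of the field along one pair of distinct sites. -/
def thin {a b : V} (hab : a ≠ b) {t : ℝ} (h0 : 0 ≤ t) (h1 : t ≤ 1) :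
    SiteBond (π.coin t h0 h1) V where
  R x u v := S.R x.1 u v ∧ (s(u, v) = s(a, b) → x.2 = true)
  symm x u v h := ⟨S.symm _ _ _ h.1, fun h' => h.2 (Sym2.eq_swap.trans h')⟩
  left x u v h := ⟨S.left _ _ _ h.1, fun h' => absurd h' (by
    intro h''
    rcases Sym2.eq_iff.1 h'' with ⟨h1, h2⟩ | ⟨h1, h2⟩
    · exact hab (h1.symm.trans h2)
    · exact hab (h2.symm.trans h1))⟩
  indep A B hAB f g hf hg := by
    have sect : ∀ (A : Set V) (f : Ω × Bool → ℝ) (c : Bool), DeterminedBy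
        (fun (x : Ω × Bool) u v => S.R x.1 u v ∧ (s(u, v) = s(a, b) → x.2 = true)) A f →
        DeterminedBy S.R A (fun ω => f (ω, c)) := fun A f c hf ω ω' h =>
      hf _ _ fun u hu v hv => and_congr_left fun _ => h u hu v hv
    -- The coin is visible only to a set that contains both `a` and `b`, hence to at most one of two
    -- disjoint sets.
    have const : ∀ (A : Set V) (f : Ω × Bool → ℝ), ¬ (a ∈ A ∧ b ∈ A) → DeterminedBy
        (fun (x : Ω × Bool) u v => S.R x.1 u v ∧ (s(u, v) = s(a, b) → x.2 = true)) A f →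
        ∀ ω, f (ω, false) = f (ω, true) := fun A f hn hf ω => by
      refine hf _ _ fun u hu v hv => and_congr_right fun _ => ?_
      have : s(u, v) ≠ s(a, b) := fun h => hn (by
        rcases Sym2.eq_iff.1 h with ⟨rfl, rfl⟩ | ⟨rfl, rfl⟩
        · exact ⟨hu, hv⟩
        · exact ⟨hv, hu⟩)
      simp [this]
    simp only [FinProb.coin_E]
    rw [S.indep A B hAB _ _ (sect A f true hf) (sect B g true hg),
      S.indep A B hAB _ _ (sect A f false hf) (sect B g false hg)]
    by_cases hA : a ∈ A ∧ b ∈ A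
    · have hB : ¬ (a ∈ B ∧ b ∈ B) := fun h => Set.disjoint_left.1 hAB hA.1 h.1
      simp only [const B g hB hg]
      ring
    · simp only [const A f hA hf]
      ring

theorem thin_pr {a b : V} (hab : a ≠ b) {t : ℝ} (h0 : 0 ≤ t) (h1 : t ≤ 1) (u v : V) :
    (π.coin t h0 h1).Pr (fun x => (S.thin hab h0 h1).R x u v) =
      if s(u, v) = s(a, b) then t * π.Pr (fun ω => S.R ω u v) else π.Pr (fun ω => S.R ω u v) := by
  rw [FinProb.Pr, FinProb.coin_E]
  split_ifs with h
  · simp only [thin, h, and_true, true_implies, Bool.false_eq_true, and_false, if_false,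
      FinProb.E_const, mul_zero, add_zero]
    rfl
  · simp only [thin, h, false_implies, and_true, FinProb.Pr]
    ring

/-- An increasing event is least likely when all pairs of interest are related with the minimal
probability. -/
theorem le_pr_of_exact {V : Type*} {P p : ℝ} (hp : 0 < p) (F : Finset (Sym2 V))
    (hF : ∀ a b, s(a, b) ∈ F → a ≠ b) (A : (V → V → Prop) → Prop)
    (hA : ∀ ρ ρ' : V → V → Prop, (∀ u v, ρ u v → ρ' u v) → A ρ → A ρ')
    (exact_case : ∀ (Ω : Type) [Fintype Ω] (π : FinProb Ω) (S : SiteBond π V),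
      (∀ u v, s(u, v) ∈ F → π.Pr (fun ω => S.R ω u v) = p) → P ≤ π.Pr (fun ω => A (S.R ω)))
    {Ω : Type} [Fintype Ω] {π : FinProb Ω} (S : SiteBond π V)
    (hS : ∀ u v, s(u, v) ∈ F → p ≤ π.Pr (fun ω => S.R ω u v)) :
    P ≤ π.Pr (fun ω => A (S.R ω)) := by
  -- Induction on a set `D` of pairs whose probability may still exceed `p`. A pair of probability
  -- `q` is thinned with retention `p / q`, which only decreases the probability of `A`.
  suffices H : ∀ (D : Finset (Sym2 V)) (Ω : Type) [Fintype Ω] (π : FinProb Ω) (S : SiteBond π V),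
      (∀ u v, s(u, v) ∈ F → p ≤ π.Pr (fun ω => S.R ω u v)) →
      (∀ u v, s(u, v) ∈ F → s(u, v) ∉ D → π.Pr (fun ω => S.R ω u v) = p) →
      P ≤ π.Pr (fun ω => A (S.R ω)) from
    H F Ω π S hS fun u v h h' => absurd h h'
  intro D
  induction D using Finset.induction_on with
  | empty => exact fun Ω _ π S _ h => exact_case Ω π S fun u v hu => h u v hu (by simp)
  | insert e D he ih =>
    intro Ω _ π S h1 h2
    induction e using Sym2.ind with
    | _ a b =>
    by_cases hab : s(a, b) ∈ F
    · have hq := h1 a b hab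
      set q := π.Pr (fun ω => S.R ω a b) with hqdef
      have hq0 : 0 < q := hp.trans_le hq
      have ht0 : 0 ≤ p / q := by positivity
      have ht1 : p / q ≤ 1 := (div_le_one hq0).2 hq
      have key : ∀ u v, s(u, v) = s(a, b) → π.Pr (fun ω => S.R ω u v) = q := by
        intro u v h
        rcases Sym2.eq_iff.1 h with ⟨rfl, rfl⟩ | ⟨rfl, rfl⟩
        · rfl
        · rw [hqdef]
          congr 1
          ext ω
          exact ⟨S.symm ω _ _, S.symm ω _ _⟩
      have hval : p / q * q = p := div_mul_cancel₀ p hq0.ne'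
      refine (ih _ _ (S.thin (hF a b hab) ht0 ht1) (fun u v hu => ?_) fun u v hu hD => ?_).trans ?_
      · rw [thin_pr]
        split_ifs with h
        · rw [key u v h, hval]
        · exact h1 u v hu
      · rw [thin_pr]
        split_ifs with h
        · rw [key u v h, hval]
        · exact h2 u v hu (by simp [h, hD])
      · rw [FinProb.Pr, FinProb.coin_E]
        have hle : ∀ c, π.E (fun ω => if A ((S.thin (hF a b hab) ht0 ht1).R (ω, c)) then 1 else 0) ≤
            π.Pr (fun ω => A (S.R ω)) := fun c =>
          π.Pr_mono fun ω h => hA _ _ (fun u v h' => h'.1) h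
        have e1 := mul_le_mul_of_nonneg_left (hle true) ht0
        have e2 := mul_le_mul_of_nonneg_left (hle false) (sub_nonneg.2 ht1)
        linarith
    · exact ih Ω π S h1 fun u v hu hD => h2 u v hu fun h => by
        rcases Finset.mem_insert.1 h with h | h
        · exact hab (h ▸ hu)
        · exact hD h

end SiteBond

/-! ### Certificates for the connectivity of the three-dimensional cube -/

namespace ThreeCube

/-- The states of the edges of the three-dimensional cube on the vertices `0, …, 7`: those of the
cycle `0, 1, 3, 2` of the bottom face, those of the cycle `4, 5, 7, 6` of the top face, and the
vertical ones. -/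
structure EdgeStates where
  e0 : Bool
  e1 : Bool
  e2 : Bool
  e3 : Bool
  e4 : Bool
  e5 : Bool
  e6 : Bool
  e7 : Bool
  e8 : Bool
  e9 : Bool
  e10 : Bool
  e11 : Bool

/-- A table of numbers indexed by binary words. -/
inductive Table where
  | val (n : ℕ)
  | pair (l r : Table)

namespace Table

/-- The part of a table with a given first letter. -/
def child : Table → Bool → Table
  | val n, _ => val n
  | pair l r, b => bif b then r else l

/-- The number stored in a leaf. -/
def value : Table → ℕ
  | val n => n % 100000
  | pair _ _ => 0

/-- Look up a word of length seven. -/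
def look (t : Table) (a b c d e f g : Bool) : ℕ :=
  (((((((t.child a).child b).child c).child d).child e).child f).child g).value

end Table

/-- A linear programming certificate for the probability of connectedness when every edge is open
with probability `0.5847`. The multiplier of an edge is looked up in `face` or `vertical` according
to the states of the seven edges disjoint from it, and is shifted by `50000`; `gain` and `loss`
weigh the open paths of length two in the faces. -/
structure Certificate where
  face : Table
  vertical : Table
  gain : ℕ
  loss : ℕ
  credit : ℕ
  debit : ℕ

/-- The nonnegative form of `(10000 * a - 5847) * (u - 50000)`, where `a` indicates `b`. -/
def term (b : Bool) (u : ℕ) : ℕ :=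
  bif b then 4153 * u + 84700000 else 5847 * (100000 - u)

/-- The number of open paths of length two in a cycle of length four. -/
def paths (a b c d : Bool) : ℕ := (a.toNat + c.toNat) * (b.toNat + d.toNat)

namespace Certificate

/-- The side of the inequality that increases with `gain`. -/
def lhs (c : Certificate) : EdgeStates → ℕ
  | ⟨e0, e1, e2, e3, e4, e5, e6, e7, e8, e9, e10, e11⟩ =>
    c.credit + c.gain * (paths e0 e1 e2 e3 + paths e4 e5 e6 e7) +
      term e0 (c.face.look e2 e4 e5 e6 e7 e10 e11) +
      term e1 (c.face.look e3 e5 e6 e7 e4 e11 e8) +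
      term e2 (c.face.look e0 e6 e5 e4 e7 e9 e8) +
      term e3 (c.face.look e1 e7 e6 e5 e4 e10 e9) +
      term e4 (c.face.look e6 e0 e1 e2 e3 e10 e11) +
      term e5 (c.face.look e7 e1 e2 e3 e0 e11 e8) +
      term e6 (c.face.look e4 e2 e1 e0 e3 e9 e8) +
      term e7 (c.face.look e5 e3 e2 e1 e0 e10 e9) +
      term e8 (c.vertical.look e1 e2 e5 e6 e9 e10 e11) +
      term e9 (c.vertical.look e3 e2 e7 e6 e8 e11 e10) +
      term e10 (c.vertical.look e3 e0 e7 e4 e11 e8 e9) +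
      term e11 (c.vertical.look e1 e0 e5 e4 e10 e9 e8)

/-- The side of the inequality that increases with `loss`. -/
def rhs (c : Certificate) : EdgeStates → ℕ
  | ⟨e0, e1, e2, e3, e4, e5, e6, e7, _, _, _, _⟩ =>
    3508200000 + c.debit + c.loss * (paths e0 e1 e2 e3 * paths e4 e5 e6 e7)

end Certificate

/-- Evaluate the argument of a function before applying it. -/
def force {α : Type} (f : ℕ → α) : ℕ → α
  | 0 => f 0
  | n + 1 => f n.succ

/-- Add the endpoints of an edge, if it is open, to a set that contains one of them, and continue
with `k`; sets of vertices are coded in binary. -/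
def link (b : Bool) (e : ℕ) (k : ℕ → Bool) : ℕ → Bool :=
  force fun m => bif b then (bif (m.land e).beq 0 then k m else k (m.lor e)) else k m

/-- Enlarge a set of vertices once through every edge, and continue with `k`. -/
def sweep (k : ℕ → Bool) : EdgeStates → ℕ → Bool
  | ⟨e0, e1, e2, e3, e4, e5, e6, e7, e8, e9, e10, e11⟩ =>
    link e0 3 <|
    link e1 10 <|
    link e2 12 <|
    link e3 5 <|
    link e8 17 <|
    link e9 34 <|
    link e10 136 <|
    link e11 68 <|
    link e4 48 <|
    link e5 160 <|
    link e6 192 <|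
    link e7 80 <|
    k

/-- The given number of sweeps enlarges a set to the set of all vertices. -/
def spans (x : EdgeStates) : ℕ → ℕ → Bool
  | 0, m => m.beq 255
  | n + 1, m => m.beq 255 || sweep (spans x n) x m

/-- The pointwise inequality expressed by a certificate. -/
def Certificate.holds (c : Certificate) (x : EdgeStates) : Bool :=
  force (fun l => force (fun r => l.ble r || (l.ble (r + 90000000) && spans x 7 1)) (c.rhs x))
    (c.lhs x)

/-- Check both values of a bit. -/
def both (p : Bool → Bool) : Bool := p false && p true

/-- Check all states of the edges. -/
def always (p : EdgeStates → Bool) : Bool :=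
  both fun b0 => both fun b1 => both fun b2 => both fun b3 => both fun b4 => both fun b5 => both fun b6 => both fun b7 => both fun b8 => both fun b9 => both fun b10 => both fun b11 => 
    p ⟨b0, b1, b2, b3, b4, b5, b6, b7, b8, b9, b10, b11⟩

open Table

/-- The multipliers for the face edges in `lowCertificate`. -/
def lowFace : Table :=
  pair (pair (pair (pair (pair (pair (pair (val 67075) (val 41804)) (pair (val 41804) (val
  58056))) (pair (pair (val 58424) (val 49186)) (pair (val 44356) (val 60704)))) (pair (pair
  (pair (val 77810) (val 42829)) (pair (val 42829) (val 56908))) (pair (pair (val 81353) (val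
  60689)) (pair (val 55857) (val 70216))))) (pair (pair (pair (pair (val 58424) (val 44356))
  (pair (val 49186) (val 60704))) (pair (pair (val 50022) (val 46634)) (pair (val 46634) (val
  50034)))) (pair (pair (pair (val 81353) (val 55857)) (pair (val 60689) (val 70216))) (pair
  (pair (val 68061) (val 50000)) (pair (val 50000) (val 50000)))))) (pair (pair (pair (pair (pair
  (val 53715) (val 48138)) (pair (val 48138) (val 50778))) (pair (pair (val 41139) (val 40432))
  (pair (val 36896) (val 43293)))) (pair (pair (pair (val 48453) (val 48518)) (pair (val 48518)
  (val 54369))) (pair (pair (val 50653) (val 53586)) (pair (val 52190) (val 61312))))) (pair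
  (pair (pair (pair (val 41139) (val 36896)) (pair (val 40432) (val 43293))) (pair (pair (val
  48425) (val 43530)) (pair (val 43530) (val 39306)))) (pair (pair (pair (val 50653) (val 52190))
  (pair (val 53586) (val 61312))) (pair (pair (val 50000) (val 50000)) (pair (val 50000) (val
  50000))))))) (pair (pair (pair (pair (pair (pair (val 61685) (val 40286)) (pair (val 40286)
  (val 53243))) (pair (pair (val 53247) (val 45638)) (pair (val 49381) (val 60614)))) (pair (pair
  (pair (val 59624) (val 41269)) (pair (val 41269) (val 50000))) (pair (pair (val 48827) (val
  35648)) (pair (val 43132) (val 50000))))) (pair (pair (pair (pair (val 53247) (val 49381))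
  (pair (val 45638) (val 60614))) (pair (pair (val 43377) (val 49340)) (pair (val 49340) (val
  59158)))) (pair (pair (pair (val 48827) (val 43132)) (pair (val 35648) (val 50000))) (pair
  (pair (val 50118) (val 48673)) (pair (val 48673) (val 50000)))))) (pair (pair (pair (pair (pair
  (val 64311) (val 44741)) (pair (val 44741) (val 43655))) (pair (pair (val 69277) (val 56047))
  (pair (val 61084) (val 65161)))) (pair (pair (pair (val 52605) (val 46505)) (pair (val 46505)
  (val 44772))) (pair (pair (val 55058) (val 52623)) (pair (val 54258) (val 58482))))) (pair
  (pair (pair (pair (val 69277) (val 61084)) (pair (val 56047) (val 65161))) (pair (pair (val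
  62392) (val 52624)) (pair (val 52624) (val 56771)))) (pair (pair (pair (val 55058) (val 54258))
  (pair (val 52623) (val 58482))) (pair (pair (val 54329) (val 54234)) (pair (val 54234) (val
  54493)))))))

/-- The multipliers for the vertical edges in `lowCertificate`. -/
def lowVertical : Table :=
  pair (pair (pair (pair (pair (pair (pair (val 24528) (val 37319)) (pair (val 55055) (val
  41457))) (pair (pair (val 37319) (val 86754)) (pair (val 41457) (val 65289)))) (pair (pair
  (pair (val 46564) (val 55927)) (pair (val 64522) (val 52790))) (pair (pair (val 31639) (val
  67317)) (pair (val 36578) (val 56882))))) (pair (pair (pair (pair (val 46564) (val 31639))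
  (pair (val 64522) (val 36578))) (pair (pair (val 55927) (val 67317)) (pair (val 52790) (val
  56882)))) (pair (pair (pair (val 59493) (val 47957)) (pair (val 67729) (val 50000))) (pair
  (pair (val 47957) (val 50507)) (pair (val 50000) (val 50000)))))) (pair (pair (pair (pair (pair
  (val 46564) (val 55927)) (pair (val 64522) (val 52790))) (pair (pair (val 31639) (val 67317))
  (pair (val 36578) (val 56882)))) (pair (pair (pair (val 52017) (val 57609)) (pair (val 65687)
  (val 50000))) (pair (pair (val 34318) (val 63289)) (pair (val 50762) (val 55010))))) (pair
  (pair (pair (pair (val 47032) (val 44546)) (pair (val 55268) (val 50000))) (pair (pair (val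
  44546) (val 56148)) (pair (val 50000) (val 50000)))) (pair (pair (pair (val 53653) (val 53308))
  (pair (val 57843) (val 50000))) (pair (pair (val 45148) (val 53375)) (pair (val 50000) (val
  50000))))))) (pair (pair (pair (pair (pair (pair (val 46564) (val 31639)) (pair (val 64522)
  (val 36578))) (pair (pair (val 55927) (val 67317)) (pair (val 52790) (val 56882)))) (pair (pair
  (pair (val 47032) (val 44546)) (pair (val 55268) (val 50000))) (pair (pair (val 44546) (val
  56148)) (pair (val 50000) (val 50000))))) (pair (pair (pair (pair (val 52017) (val 34318))
  (pair (val 65687) (val 50762))) (pair (pair (val 57609) (val 63289)) (pair (val 50000) (val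
  55010)))) (pair (pair (pair (val 53653) (val 45148)) (pair (val 57843) (val 50000))) (pair
  (pair (val 53308) (val 53375)) (pair (val 50000) (val 50000)))))) (pair (pair (pair (pair (pair
  (val 59493) (val 47957)) (pair (val 67729) (val 50000))) (pair (pair (val 47957) (val 50507))
  (pair (val 50000) (val 50000)))) (pair (pair (pair (val 53653) (val 53308)) (pair (val 57843)
  (val 50000))) (pair (pair (val 45148) (val 53375)) (pair (val 50000) (val 50000))))) (pair
  (pair (pair (pair (val 53653) (val 45148)) (pair (val 57843) (val 50000))) (pair (pair (val
  53308) (val 53375)) (pair (val 50000) (val 50000)))) (pair (pair (pair (val 53615) (val 50682))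
  (pair (val 50000) (val 50000))) (pair (pair (val 50682) (val 51036)) (pair (val 50000) (val
  50000)))))))

/-- The certificate for a small expected number of open paths of length two in the faces. -/
def lowCertificate : Certificate where
  face := lowFace
  vertical := lowVertical
  gain := 3900963
  loss := 5933025
  credit := 4413872
  debit := 0

/-- The multipliers for the face edges in `middleCertificate`. -/
def middleFace : Table :=
  pair (pair (pair (pair (pair (pair (pair (val 66496) (val 42230)) (pair (val 42230) (val
  57476))) (pair (pair (val 56940) (val 47206)) (pair (val 41473) (val 62675)))) (pair (pair
  (pair (val 72909) (val 37860)) (pair (val 37860) (val 51863))) (pair (pair (val 81268) (val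
  62311)) (pair (val 54911) (val 72593))))) (pair (pair (pair (pair (val 56940) (val 41473))
  (pair (val 47206) (val 62675))) (pair (pair (val 52868) (val 44837)) (pair (val 44837) (val
  47931)))) (pair (pair (pair (val 81268) (val 54911)) (pair (val 62311) (val 72593))) (pair
  (pair (val 70969) (val 50000)) (pair (val 50000) (val 50000)))))) (pair (pair (pair (pair (pair
  (val 55682) (val 49446)) (pair (val 49446) (val 53747))) (pair (pair (val 36286) (val 37483))
  (pair (val 31814) (val 42008)))) (pair (pair (pair (val 46453) (val 47066)) (pair (val 47066)
  (val 57536))) (pair (pair (val 47706) (val 55023)) (pair (val 49084) (val 62375))))) (pair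
  (pair (pair (pair (val 36286) (val 31814)) (pair (val 37483) (val 42008))) (pair (pair (val
  48094) (val 41428)) (pair (val 41428) (val 38713)))) (pair (pair (pair (val 47706) (val 49084))
  (pair (val 55023) (val 62375))) (pair (pair (val 50000) (val 50000)) (pair (val 50000) (val
  50000))))))) (pair (pair (pair (pair (pair (pair (val 58565) (val 39585)) (pair (val 39585)
  (val 53497))) (pair (pair (val 47745) (val 43102)) (pair (val 49592) (val 65291)))) (pair (pair
  (pair (val 65926) (val 41207)) (pair (val 41207) (val 50000))) (pair (pair (val 44186) (val
  31333)) (pair (val 41763) (val 50000))))) (pair (pair (pair (pair (val 47745) (val 49592))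
  (pair (val 43102) (val 65291))) (pair (pair (val 41107) (val 47288)) (pair (val 47288) (val
  60742)))) (pair (pair (pair (val 44186) (val 41763)) (pair (val 31333) (val 50000))) (pair
  (pair (val 48549) (val 45229)) (pair (val 45229) (val 50000)))))) (pair (pair (pair (pair (pair
  (val 66449) (val 42297)) (pair (val 42297) (val 36432))) (pair (pair (val 70226) (val 55708))
  (pair (val 62261) (val 63888)))) (pair (pair (pair (val 55225) (val 45264)) (pair (val 45264)
  (val 42078))) (pair (pair (val 53820) (val 51132)) (pair (val 53213) (val 58182))))) (pair
  (pair (pair (pair (val 70226) (val 62261)) (pair (val 55708) (val 63888))) (pair (pair (val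
  64176) (val 53602)) (pair (val 53602) (val 54852)))) (pair (pair (pair (val 53820) (val 53213))
  (pair (val 51132) (val 58182))) (pair (pair (val 54517) (val 52804)) (pair (val 52804) (val
  54174)))))))

/-- The multipliers for the vertical edges in `middleCertificate`. -/
def middleVertical : Table :=
  pair (pair (pair (pair (pair (pair (pair (val 27937) (val 37619)) (pair (val 62403) (val
  39766))) (pair (pair (val 37619) (val 99235)) (pair (val 39766) (val 69946)))) (pair (pair
  (pair (val 45682) (val 59023)) (pair (val 65214) (val 52178))) (pair (pair (val 27939) (val
  70377)) (pair (val 38729) (val 57947))))) (pair (pair (pair (pair (val 45682) (val 27939))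
  (pair (val 65214) (val 38729))) (pair (pair (val 59023) (val 70377)) (pair (val 52178) (val
  57947)))) (pair (pair (pair (val 57448) (val 47769)) (pair (val 63472) (val 50000))) (pair
  (pair (val 47769) (val 47502)) (pair (val 50000) (val 50000)))))) (pair (pair (pair (pair (pair
  (val 45682) (val 59023)) (pair (val 65214) (val 52178))) (pair (pair (val 27939) (val 70377))
  (pair (val 38729) (val 57947)))) (pair (pair (pair (val 51305) (val 60313)) (pair (val 68912)
  (val 50000))) (pair (pair (val 31427) (val 66200)) (pair (val 48968) (val 55594))))) (pair
  (pair (pair (pair (val 46815) (val 45117)) (pair (val 52318) (val 50000))) (pair (pair (val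
  45117) (val 52831)) (pair (val 50000) (val 50000)))) (pair (pair (pair (val 53130) (val 51954))
  (pair (val 57158) (val 50000))) (pair (pair (val 45873) (val 52899)) (pair (val 50000) (val
  50000))))))) (pair (pair (pair (pair (pair (pair (val 45682) (val 27939)) (pair (val 65214)
  (val 38729))) (pair (pair (val 59023) (val 70377)) (pair (val 52178) (val 57947)))) (pair (pair
  (pair (val 46815) (val 45117)) (pair (val 52318) (val 50000))) (pair (pair (val 45117) (val
  52831)) (pair (val 50000) (val 50000))))) (pair (pair (pair (pair (val 51305) (val 31427))
  (pair (val 68912) (val 48968))) (pair (pair (val 60313) (val 66200)) (pair (val 50000) (val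
  55594)))) (pair (pair (pair (val 53130) (val 45873)) (pair (val 57158) (val 50000))) (pair
  (pair (val 51954) (val 52899)) (pair (val 50000) (val 50000)))))) (pair (pair (pair (pair (pair
  (val 57448) (val 47769)) (pair (val 63472) (val 50000))) (pair (pair (val 47769) (val 47502))
  (pair (val 50000) (val 50000)))) (pair (pair (pair (val 53130) (val 51954)) (pair (val 57158)
  (val 50000))) (pair (pair (val 45873) (val 52899)) (pair (val 50000) (val 50000))))) (pair
  (pair (pair (pair (val 53130) (val 45873)) (pair (val 57158) (val 50000))) (pair (pair (val
  51954) (val 52899)) (pair (val 50000) (val 50000)))) (pair (pair (pair (val 54335) (val 52397))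
  (pair (val 50000) (val 50000))) (pair (pair (val 52397) (val 55479)) (pair (val 50000) (val
  50000)))))))

/-- The certificate for a moderate expected number of open paths of length two in the faces. -/
def middleCertificate : Certificate where
  face := middleFace
  vertical := middleVertical
  gain := 10406876
  loss := 7638074
  credit := 0
  debit := 9731652

/-- The multipliers for the face edges in `highCertificate`. -/
def highFace : Table :=
  pair (pair (pair (pair (pair (pair (pair (val 53483) (val 46797)) (pair (val 46797) (val
  54893))) (pair (pair (val 51300) (val 50322)) (pair (val 46548) (val 61162)))) (pair (pair
  (pair (val 54087) (val 40651)) (pair (val 40651) (val 46780))) (pair (pair (val 65355) (val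
  59512)) (pair (val 55717) (val 67110))))) (pair (pair (pair (pair (val 51300) (val 46548))
  (pair (val 50322) (val 61162))) (pair (pair (val 49197) (val 43948)) (pair (val 43948) (val
  50839)))) (pair (pair (pair (val 65355) (val 55717)) (pair (val 59512) (val 67110))) (pair
  (pair (val 60993) (val 50000)) (pair (val 50000) (val 50000)))))) (pair (pair (pair (pair (pair
  (val 53950) (val 51030)) (pair (val 51030) (val 54166))) (pair (pair (val 37384) (val 40335))
  (pair (val 36051) (val 42370)))) (pair (pair (pair (val 49297) (val 50073)) (pair (val 50073)
  (val 58295))) (pair (pair (val 51954) (val 56315)) (pair (val 55663) (val 62081))))) (pair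
  (pair (pair (pair (val 37384) (val 36051)) (pair (val 40335) (val 42370))) (pair (pair (val
  44719) (val 38903)) (pair (val 38903) (val 38283)))) (pair (pair (pair (val 51954) (val 55663))
  (pair (val 56315) (val 62081))) (pair (pair (val 50000) (val 50000)) (pair (val 50000) (val
  50000))))))) (pair (pair (pair (pair (pair (pair (val 48429) (val 45714)) (pair (val 45714)
  (val 54576))) (pair (pair (val 48282) (val 48617)) (pair (val 53963) (val 67142)))) (pair (pair
  (pair (val 52389) (val 45981)) (pair (val 45981) (val 50000))) (pair (pair (val 40204) (val
  36645)) (pair (val 41819) (val 50000))))) (pair (pair (pair (pair (val 48282) (val 53963))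
  (pair (val 48617) (val 67142))) (pair (pair (val 47118) (val 49121)) (pair (val 49121) (val
  62977)))) (pair (pair (pair (val 40204) (val 41819)) (pair (val 36645) (val 50000))) (pair
  (pair (val 47148) (val 47538)) (pair (val 47538) (val 50000)))))) (pair (pair (pair (pair (pair
  (val 55784) (val 39762)) (pair (val 39762) (val 36165))) (pair (pair (val 63301) (val 55410))
  (pair (val 58993) (val 60360)))) (pair (pair (pair (val 49112) (val 45950)) (pair (val 45950)
  (val 43604))) (pair (pair (val 53611) (val 53361)) (pair (val 53954) (val 56912))))) (pair
  (pair (pair (pair (val 63301) (val 58993)) (pair (val 55410) (val 60360))) (pair (pair (val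
  59924) (val 54954)) (pair (val 54954) (val 54093)))) (pair (pair (pair (val 53611) (val 53954))
  (pair (val 53361) (val 56912))) (pair (pair (val 53207) (val 51630)) (pair (val 51630) (val
  52572)))))))

/-- The multipliers for the vertical edges in `highCertificate`. -/
def highVertical : Table :=
  pair (pair (pair (pair (pair (pair (pair (val 48880) (val 45932)) (pair (val 83302) (val
  46339))) (pair (pair (val 45932) (val 88103)) (pair (val 46339) (val 64123)))) (pair (pair
  (pair (val 52058) (val 60442)) (pair (val 64041) (val 51173))) (pair (pair (val 33554) (val
  67464)) (pair (val 49605) (val 57930))))) (pair (pair (pair (pair (val 52058) (val 33554))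
  (pair (val 64041) (val 49605))) (pair (pair (val 60442) (val 67464)) (pair (val 51173) (val
  57930)))) (pair (pair (pair (val 49482) (val 48618)) (pair (val 47911) (val 50000))) (pair
  (pair (val 48618) (val 43624)) (pair (val 50000) (val 50000)))))) (pair (pair (pair (pair (pair
  (val 52058) (val 60442)) (pair (val 64041) (val 51173))) (pair (pair (val 33554) (val 67464))
  (pair (val 49605) (val 57930)))) (pair (pair (pair (val 50053) (val 58587)) (pair (val 68380)
  (val 50000))) (pair (pair (val 35010) (val 68918)) (pair (val 49822) (val 57921))))) (pair
  (pair (pair (pair (val 48411) (val 49634)) (pair (val 44543) (val 50000))) (pair (pair (val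
  49634) (val 44240)) (pair (val 50000) (val 50000)))) (pair (pair (pair (val 51793) (val 49142))
  (pair (val 51831) (val 50000))) (pair (pair (val 49949) (val 48661)) (pair (val 50000) (val
  50000))))))) (pair (pair (pair (pair (pair (pair (val 52058) (val 33554)) (pair (val 64041)
  (val 49605))) (pair (pair (val 60442) (val 67464)) (pair (val 51173) (val 57930)))) (pair (pair
  (pair (val 48411) (val 49634)) (pair (val 44543) (val 50000))) (pair (pair (val 49634) (val
  44240)) (pair (val 50000) (val 50000))))) (pair (pair (pair (pair (val 50053) (val 35010))
  (pair (val 68380) (val 49822))) (pair (pair (val 58587) (val 68918)) (pair (val 50000) (val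
  57921)))) (pair (pair (pair (val 51793) (val 49949)) (pair (val 51831) (val 50000))) (pair
  (pair (val 49142) (val 48661)) (pair (val 50000) (val 50000)))))) (pair (pair (pair (pair (pair
  (val 49482) (val 48618)) (pair (val 47911) (val 50000))) (pair (pair (val 48618) (val 43624))
  (pair (val 50000) (val 50000)))) (pair (pair (pair (val 51793) (val 49142)) (pair (val 51831)
  (val 50000))) (pair (pair (val 49949) (val 48661)) (pair (val 50000) (val 50000))))) (pair
  (pair (pair (pair (val 51793) (val 49949)) (pair (val 51831) (val 50000))) (pair (pair (val
  49142) (val 48661)) (pair (val 50000) (val 50000)))) (pair (pair (pair (val 54750) (val 51250))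
  (pair (val 50000) (val 50000))) (pair (pair (val 51250) (val 53769)) (pair (val 50000) (val
  50000)))))))

/-- The certificate for a large expected number of open paths of length two in the faces. -/
def highCertificate : Certificate where
  face := highFace
  vertical := highVertical
  gain := 4924804
  loss := 1820630
  credit := 0
  debit := 5736308

/-- A finite computation over the `2 ^ 12` states of the edges; `force` keeps the arithmetic on
evaluated numerals. -/
theorem certificates_hold : always (fun x =>
    lowCertificate.holds x && (middleCertificate.holds x && highCertificate.holds x)) = true := by
  decide +kernel

theorem of_both {p : Bool → Bool} (h : both p = true) : ∀ b, p b = true := by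
  rw [both, Bool.and_eq_true] at h
  rintro (_ | _)
  · exact h.1
  · exact h.2

theorem of_always {p : EdgeStates → Bool} (h : always p = true) : ∀ x, p x = true := by
  rintro ⟨b0, b1, b2, b3, b4, b5, b6, b7, b8, b9, b10, b11⟩
  exact of_both (of_both (of_both (of_both (of_both (of_both (of_both (of_both (of_both (of_both
    (of_both (of_both h b0) b1) b2) b3) b4) b5) b6) b7) b8) b9) b10) b11

theorem force_eq {α : Type} (f : ℕ → α) (m : ℕ) : force f m = f m := by
  cases m <;> rfl

variable {Ω : Type} [Fintype Ω] {π : FinProb Ω} (S : SiteBond π (Fin 8))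

/-- The states of the edges of the cube in a random field. -/
def state (ω : Ω) : EdgeStates :=
  ⟨decide (S.R ω 0 1), decide (S.R ω 1 3), decide (S.R ω 3 2), decide (S.R ω 2 0), decide (S.R ω
    4 5), decide (S.R ω 5 7), decide (S.R ω 7 6), decide (S.R ω 6 4), decide (S.R ω 0 4), decide
    (S.R ω 1 5), decide (S.R ω 3 7), decide (S.R ω 2 6)⟩

/-- All vertices are joined to the first one. -/
def Spanned (ρ : Fin 8 → Fin 8 → Prop) : Prop := ∀ v, Relation.ReflTransGen ρ 0 v

/-- The vertices in the set coded by `m` are joined to the first one. -/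
def Reached (ρ : Fin 8 → Fin 8 → Prop) (m : ℕ) : Prop :=
  ∀ v : Fin 8, m.testBit v = true → Relation.ReflTransGen ρ 0 v

theorem spanned_of_link {ρ : Fin 8 → Fin 8 → Prop} (hs : ∀ u v, ρ u v → ρ v u) (a b : Fin 8)
    {e : ℕ} (he : e = 2 ^ a.val ||| 2 ^ b.val) {k : ℕ → Bool}
    (hk : ∀ m, Reached ρ m → k m = true → Spanned ρ) (m : ℕ) (hm : Reached ρ m)
    (h : link (decide (ρ a b)) e k m = true) : Spanned ρ := by
  subst he
  rw [link, force_eq, Bool.cond_eq_ite, Bool.cond_eq_ite] at h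
  simp only [decide_eq_true_eq, Nat.beq_eq] at h
  split_ifs at h with h1 h2
  · exact hk m hm h
  · refine hk _ (fun v hv => ?_) h
    have h3 : m.testBit a = true ∨ m.testBit b = true := by
      by_contra hn
      rw [not_or, Bool.not_eq_true, Bool.not_eq_true] at hn
      refine h2 (Nat.eq_of_testBit_eq fun i => ?_)
      change (m &&& (2 ^ a.val ||| 2 ^ b.val)).testBit i = _
      rw [Nat.testBit_and, Nat.testBit_or, Nat.testBit_two_pow, Nat.testBit_two_pow,
        Nat.zero_testBit]
      by_cases ha : a.val = i
      · rw [← ha, hn.1, Bool.false_and]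
      · by_cases hb : b.val = i
        · rw [← hb, hn.2, Bool.false_and]
        · simp [ha, hb]
    have h4 : Relation.ReflTransGen ρ 0 a ∧ Relation.ReflTransGen ρ 0 b := by
      rcases h3 with h' | h'
      · exact ⟨hm _ h', (hm _ h').tail h1⟩
      · exact ⟨(hm _ h').tail (hs _ _ h1), hm _ h'⟩
    change (m ||| (2 ^ a.val ||| 2 ^ b.val)).testBit v = true at hv
    simp only [Nat.testBit_or, Nat.testBit_two_pow, Bool.or_eq_true, decide_eq_true_eq] at hv
    rcases hv with hv | hv | hv
    · exact hm v hv
    · exact Fin.ext hv ▸ h4.1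
    · exact Fin.ext hv ▸ h4.2
  · exact hk m hm h

theorem spanned_of_sweep {ω : Ω} {k : ℕ → Bool}
    (hk : ∀ m, Reached (S.R ω) m → k m = true → Spanned (S.R ω)) :
    ∀ m, Reached (S.R ω) m → sweep k (state S ω) m = true → Spanned (S.R ω) := by
  unfold sweep state
  iterate 12 refine spanned_of_link (S.symm ω) _ _ rfl ?_
  exact hk

/-- Only soundness of the search is used, so it does not matter that seven sweeps always suffice.
The starting code `1` is the set containing only the vertex `0`. -/
theorem spanned_of_spans {ω : Ω} : ∀ (n m : ℕ), Reached (S.R ω) m →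
    spans (state S ω) n m = true → Spanned (S.R ω) := by
  have full : ∀ m : ℕ, Reached (S.R ω) m → m.beq 255 = true → Spanned (S.R ω) := by
    intro m hm h v
    refine hm v ?_
    rw [Nat.beq_eq] at h
    rw [h]
    revert v
    decide
  intro n
  induction n with
  | zero => exact full
  | succ n ih =>
    intro m hm h
    rw [spans, Bool.or_eq_true] at h
    exact h.elim (full m hm) (spanned_of_sweep S ih m hm)

theorem Certificate.le_of_holds {c : Certificate} {ω : Ω} (h : c.holds (state S ω) = true) :
    (c.lhs (state S ω) : ℝ) ≤
      c.rhs (state S ω) + 90000000 * if Spanned (S.R ω) then 1 else 0 := by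
  rw [holds, force_eq, force_eq, Bool.or_eq_true, Bool.and_eq_true, Nat.ble_eq, Nat.ble_eq] at h
  rcases h with h | ⟨h1, h2⟩
  · have h' : (c.lhs (state S ω) : ℝ) ≤ c.rhs (state S ω) := by exact_mod_cast h
    split_ifs <;> linarith
  · rw [if_pos (spanned_of_spans S 7 1 (fun v hv => ?_) h2), mul_one]
    · exact_mod_cast h1
    · rw [Nat.testBit_one_eq_true_iff_self_eq_zero] at hv
      rw [show v = 0 from Fin.ext hv]

/-- The contribution of an edge to the inequality expressed by a certificate. -/
def excess (b : Bool) (u : ℕ) : ℝ := (10000 * (if b then 1 else 0) - 5847) * ((u : ℝ) - 50000)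

theorem Table.look_le (t : Table) (a b c d e f g : Bool) : t.look a b c d e f g ≤ 100000 := by
  unfold look value
  split
  · exact (Nat.mod_lt _ (by norm_num)).le
  · exact Nat.zero_le _

/-- The shift `292350000 = 5847 * 50000` keeps the terms natural numbers. Over twelve edges it adds
up to the constant `3508200000` of `Certificate.rhs`. -/
theorem cast_term (b : Bool) {u : ℕ} (hu : u ≤ 100000) :
    (term b u : ℝ) = 292350000 + excess b u := by
  cases b
  · rw [term, cond_false, excess, Nat.cast_mul, Nat.cast_sub hu]
    push_cast
    simp
    ring
  · rw [term, cond_true, excess]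
    push_cast
    simp
    ring

/-- The multiplier depends only on sites off the edge, so it is independent of the state of the
edge, whose centred value has mean zero. The multipliers are thus free dual variables. -/
theorem E_excess {u v : Fin 8} (hp : π.Pr (fun ω => S.R ω u v) = 5847 / 10000) {M : Ω → ℕ}
    (hM : S.Det {u, v}ᶜ M) : π.E (fun ω => excess (decide (S.R ω u v)) (M ω)) = 0 := by
  have h := S.indep {u, v} {u, v}ᶜ disjoint_compl_right
    (fun ω => 10000 * (if decide (S.R ω u v) then 1 else 0) - 5847) (fun ω => (M ω : ℝ) - 50000)
    ((determinedBy_rel S.R (by simp) (by simp)).comp fun q : Prop =>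
      10000 * (if decide q then (1 : ℝ) else 0) - 5847)
    (hM.comp fun m : ℕ => (m : ℝ) - 50000)
  unfold excess
  rw [h, FinProb.E_sub, FinProb.E_mul_left, FinProb.E_const]
  simp only [decide_eq_true_eq]
  change (10000 * π.Pr (fun ω => S.R ω u v) - 5847) * _ = 0
  rw [hp]
  norm_num

theorem det_open {A : Set (Fin 8)} {u v : Fin 8} (hu : u ∈ A) (hv : v ∈ A) :
    S.Det A (fun ω => decide (S.R ω u v)) :=
  (determinedBy_rel S.R hu hv).comp fun q : Prop => decide q

theorem det_look (t : Table) {A : Set (Fin 8)} {a b c d e f g : Ω → Bool} (ha : S.Det A a)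
    (hb : S.Det A b) (hc : S.Det A c) (hd : S.Det A d) (he : S.Det A e) (hf : S.Det A f)
    (hg : S.Det A g) :
    S.Det A (fun ω => t.look (a ω) (b ω) (c ω) (d ω) (e ω) (f ω) (g ω)) := fun ω ω' h => by
  simp only [ha ω ω' h, hb ω ω' h, hc ω ω' h, hd ω ω' h, he ω ω' h, hf ω ω' h, hg ω ω' h]

/-- The number of open paths of length two in a cycle on four vertices. -/
def cyclePaths (a b c d : Fin 8) (ω : Ω) : ℝ :=
  paths (decide (S.R ω a b)) (decide (S.R ω b c)) (decide (S.R ω c d)) (decide (S.R ω d a))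

theorem cyclePaths_nonneg (a b c d : Fin 8) (ω : Ω) : 0 ≤ cyclePaths S a b c d ω :=
  Nat.cast_nonneg _

theorem cyclePaths_le (a b c d : Fin 8) (ω : Ω) : cyclePaths S a b c d ω ≤ 4 := by
  have h : ∀ a b c d : Bool, paths a b c d ≤ 4 := by decide
  unfold cyclePaths
  exact_mod_cast h _ _ _ _

theorem det_cyclePaths {A : Set (Fin 8)} {a b c d : Fin 8} (ha : a ∈ A) (hb : b ∈ A) (hc : c ∈ A)
    (hd : d ∈ A) : S.Det A (cyclePaths S a b c d) := fun ω ω' h => by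
  simp only [cyclePaths, det_open S ha hb ω ω' h, det_open S hb hc ω ω' h,
    det_open S hc hd ω ω' h, det_open S hd ha ω ω' h]

/-- The edges of the cube. -/
def edges : Finset (Sym2 (Fin 8)) :=
  {s(0, 1), s(1, 3), s(3, 2), s(2, 0), s(4, 5), s(5, 7), s(7, 6), s(6, 4), s(0, 4), s(1, 5),
    s(3, 7), s(2, 6)}

/-- On taking expectations of the pointwise inequality all edge terms vanish. The product of the two
path counts factors because opposite faces have no common vertex. -/
theorem Certificate.bound {c : Certificate} (hc : ∀ x, c.holds x = true)
    (hp : ∀ u v, s(u, v) ∈ edges → π.Pr (fun ω => S.R ω u v) = 5847 / 10000) :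
    c.credit + c.gain * (π.E (cyclePaths S 0 1 3 2) + π.E (cyclePaths S 4 5 7 6)) ≤
      c.debit + c.loss * (π.E (cyclePaths S 0 1 3 2) * π.E (cyclePaths S 4 5 7 6)) +
        90000000 * π.Pr (fun ω => Spanned (S.R ω)) := by
  have hle := π.E_mono fun ω => c.le_of_holds S (hc (state S ω))
  have hprod := S.indep {0, 1, 3, 2} {4, 5, 7, 6} (by simp [Set.disjoint_left]) _ _
    (det_cyclePaths S (a := 0) (b := 1) (c := 3) (d := 2) (by simp) (by simp) (by simp) (by simp))
    (det_cyclePaths S (a := 4) (b := 5) (c := 7) (d := 6) (by simp) (by simp) (by simp) (by simp))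
  have h0 := E_excess S (hp 0 1 (by simp [edges])) (det_look S c.face
    (det_open S (u := 3) (v := 2) (by simp) (by simp))
    (det_open S (u := 4) (v := 5) (by simp) (by simp))
    (det_open S (u := 5) (v := 7) (by simp) (by simp))
    (det_open S (u := 7) (v := 6) (by simp) (by simp))
    (det_open S (u := 6) (v := 4) (by simp) (by simp))
    (det_open S (u := 3) (v := 7) (by simp) (by simp))
    (det_open S (u := 2) (v := 6) (by simp) (by simp)))
  have h1 := E_excess S (hp 1 3 (by simp [edges])) (det_look S c.face
    (det_open S (u := 2) (v := 0) (by simp) (by simp))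
    (det_open S (u := 5) (v := 7) (by simp) (by simp))
    (det_open S (u := 7) (v := 6) (by simp) (by simp))
    (det_open S (u := 6) (v := 4) (by simp) (by simp))
    (det_open S (u := 4) (v := 5) (by simp) (by simp))
    (det_open S (u := 2) (v := 6) (by simp) (by simp))
    (det_open S (u := 0) (v := 4) (by simp) (by simp)))
  have h2 := E_excess S (hp 3 2 (by simp [edges])) (det_look S c.face
    (det_open S (u := 0) (v := 1) (by simp) (by simp))
    (det_open S (u := 7) (v := 6) (by simp) (by simp))
    (det_open S (u := 5) (v := 7) (by simp) (by simp))
    (det_open S (u := 4) (v := 5) (by simp) (by simp))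
    (det_open S (u := 6) (v := 4) (by simp) (by simp))
    (det_open S (u := 1) (v := 5) (by simp) (by simp))
    (det_open S (u := 0) (v := 4) (by simp) (by simp)))
  have h3 := E_excess S (hp 2 0 (by simp [edges])) (det_look S c.face
    (det_open S (u := 1) (v := 3) (by simp) (by simp))
    (det_open S (u := 6) (v := 4) (by simp) (by simp))
    (det_open S (u := 7) (v := 6) (by simp) (by simp))
    (det_open S (u := 5) (v := 7) (by simp) (by simp))
    (det_open S (u := 4) (v := 5) (by simp) (by simp))
    (det_open S (u := 3) (v := 7) (by simp) (by simp))
    (det_open S (u := 1) (v := 5) (by simp) (by simp)))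
  have h4 := E_excess S (hp 4 5 (by simp [edges])) (det_look S c.face
    (det_open S (u := 7) (v := 6) (by simp) (by simp))
    (det_open S (u := 0) (v := 1) (by simp) (by simp))
    (det_open S (u := 1) (v := 3) (by simp) (by simp))
    (det_open S (u := 3) (v := 2) (by simp) (by simp))
    (det_open S (u := 2) (v := 0) (by simp) (by simp))
    (det_open S (u := 3) (v := 7) (by simp) (by simp))
    (det_open S (u := 2) (v := 6) (by simp) (by simp)))
  have h5 := E_excess S (hp 5 7 (by simp [edges])) (det_look S c.face
    (det_open S (u := 6) (v := 4) (by simp) (by simp))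
    (det_open S (u := 1) (v := 3) (by simp) (by simp))
    (det_open S (u := 3) (v := 2) (by simp) (by simp))
    (det_open S (u := 2) (v := 0) (by simp) (by simp))
    (det_open S (u := 0) (v := 1) (by simp) (by simp))
    (det_open S (u := 2) (v := 6) (by simp) (by simp))
    (det_open S (u := 0) (v := 4) (by simp) (by simp)))
  have h6 := E_excess S (hp 7 6 (by simp [edges])) (det_look S c.face
    (det_open S (u := 4) (v := 5) (by simp) (by simp))
    (det_open S (u := 3) (v := 2) (by simp) (by simp))
    (det_open S (u := 1) (v := 3) (by simp) (by simp))
    (det_open S (u := 0) (v := 1) (by simp) (by simp))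
    (det_open S (u := 2) (v := 0) (by simp) (by simp))
    (det_open S (u := 1) (v := 5) (by simp) (by simp))
    (det_open S (u := 0) (v := 4) (by simp) (by simp)))
  have h7 := E_excess S (hp 6 4 (by simp [edges])) (det_look S c.face
    (det_open S (u := 5) (v := 7) (by simp) (by simp))
    (det_open S (u := 2) (v := 0) (by simp) (by simp))
    (det_open S (u := 3) (v := 2) (by simp) (by simp))
    (det_open S (u := 1) (v := 3) (by simp) (by simp))
    (det_open S (u := 0) (v := 1) (by simp) (by simp))
    (det_open S (u := 3) (v := 7) (by simp) (by simp))
    (det_open S (u := 1) (v := 5) (by simp) (by simp)))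
  have h8 := E_excess S (hp 0 4 (by simp [edges])) (det_look S c.vertical
    (det_open S (u := 1) (v := 3) (by simp) (by simp))
    (det_open S (u := 3) (v := 2) (by simp) (by simp))
    (det_open S (u := 5) (v := 7) (by simp) (by simp))
    (det_open S (u := 7) (v := 6) (by simp) (by simp))
    (det_open S (u := 1) (v := 5) (by simp) (by simp))
    (det_open S (u := 3) (v := 7) (by simp) (by simp))
    (det_open S (u := 2) (v := 6) (by simp) (by simp)))
  have h9 := E_excess S (hp 1 5 (by simp [edges])) (det_look S c.vertical
    (det_open S (u := 2) (v := 0) (by simp) (by simp))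
    (det_open S (u := 3) (v := 2) (by simp) (by simp))
    (det_open S (u := 6) (v := 4) (by simp) (by simp))
    (det_open S (u := 7) (v := 6) (by simp) (by simp))
    (det_open S (u := 0) (v := 4) (by simp) (by simp))
    (det_open S (u := 2) (v := 6) (by simp) (by simp))
    (det_open S (u := 3) (v := 7) (by simp) (by simp)))
  have h10 := E_excess S (hp 3 7 (by simp [edges])) (det_look S c.vertical
    (det_open S (u := 2) (v := 0) (by simp) (by simp))
    (det_open S (u := 0) (v := 1) (by simp) (by simp))
    (det_open S (u := 6) (v := 4) (by simp) (by simp))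
    (det_open S (u := 4) (v := 5) (by simp) (by simp))
    (det_open S (u := 2) (v := 6) (by simp) (by simp))
    (det_open S (u := 0) (v := 4) (by simp) (by simp))
    (det_open S (u := 1) (v := 5) (by simp) (by simp)))
  have h11 := E_excess S (hp 2 6 (by simp [edges])) (det_look S c.vertical
    (det_open S (u := 1) (v := 3) (by simp) (by simp))
    (det_open S (u := 0) (v := 1) (by simp) (by simp))
    (det_open S (u := 5) (v := 7) (by simp) (by simp))
    (det_open S (u := 4) (v := 5) (by simp) (by simp))
    (det_open S (u := 3) (v := 7) (by simp) (by simp))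
    (det_open S (u := 1) (v := 5) (by simp) (by simp))
    (det_open S (u := 0) (v := 4) (by simp) (by simp)))
  have hlhs : ∀ ω, (c.lhs (state S ω) : ℝ) = c.credit + c.gain * (cyclePaths S 0 1 3 2 ω +
      cyclePaths S 4 5 7 6 ω) + 3508200000 + (
      excess (decide (S.R ω 0 1)) (c.face.look (decide (S.R ω 3 2)) (decide (S.R ω 4 5)) (decide
      (S.R ω 5 7)) (decide (S.R ω 7 6)) (decide (S.R ω 6 4)) (decide (S.R ω 3 7)) (decide (S.R ω
      2 6))) +
      excess (decide (S.R ω 1 3)) (c.face.look (decide (S.R ω 2 0)) (decide (S.R ω 5 7)) (decide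
      (S.R ω 7 6)) (decide (S.R ω 6 4)) (decide (S.R ω 4 5)) (decide (S.R ω 2 6)) (decide (S.R ω
      0 4))) +
      excess (decide (S.R ω 3 2)) (c.face.look (decide (S.R ω 0 1)) (decide (S.R ω 7 6)) (decide
      (S.R ω 5 7)) (decide (S.R ω 4 5)) (decide (S.R ω 6 4)) (decide (S.R ω 1 5)) (decide (S.R ω
      0 4))) +
      excess (decide (S.R ω 2 0)) (c.face.look (decide (S.R ω 1 3)) (decide (S.R ω 6 4)) (decide
      (S.R ω 7 6)) (decide (S.R ω 5 7)) (decide (S.R ω 4 5)) (decide (S.R ω 3 7)) (decide (S.R ω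
      1 5))) +
      excess (decide (S.R ω 4 5)) (c.face.look (decide (S.R ω 7 6)) (decide (S.R ω 0 1)) (decide
      (S.R ω 1 3)) (decide (S.R ω 3 2)) (decide (S.R ω 2 0)) (decide (S.R ω 3 7)) (decide (S.R ω
      2 6))) +
      excess (decide (S.R ω 5 7)) (c.face.look (decide (S.R ω 6 4)) (decide (S.R ω 1 3)) (decide
      (S.R ω 3 2)) (decide (S.R ω 2 0)) (decide (S.R ω 0 1)) (decide (S.R ω 2 6)) (decide (S.R ω
      0 4))) +
      excess (decide (S.R ω 7 6)) (c.face.look (decide (S.R ω 4 5)) (decide (S.R ω 3 2)) (decide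
      (S.R ω 1 3)) (decide (S.R ω 0 1)) (decide (S.R ω 2 0)) (decide (S.R ω 1 5)) (decide (S.R ω
      0 4))) +
      excess (decide (S.R ω 6 4)) (c.face.look (decide (S.R ω 5 7)) (decide (S.R ω 2 0)) (decide
      (S.R ω 3 2)) (decide (S.R ω 1 3)) (decide (S.R ω 0 1)) (decide (S.R ω 3 7)) (decide (S.R ω
      1 5))) +
      excess (decide (S.R ω 0 4)) (c.vertical.look (decide (S.R ω 1 3)) (decide (S.R ω 3 2))
      (decide (S.R ω 5 7)) (decide (S.R ω 7 6)) (decide (S.R ω 1 5)) (decide (S.R ω 3 7)) (decide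
      (S.R ω 2 6))) +
      excess (decide (S.R ω 1 5)) (c.vertical.look (decide (S.R ω 2 0)) (decide (S.R ω 3 2))
      (decide (S.R ω 6 4)) (decide (S.R ω 7 6)) (decide (S.R ω 0 4)) (decide (S.R ω 2 6)) (decide
      (S.R ω 3 7))) +
      excess (decide (S.R ω 3 7)) (c.vertical.look (decide (S.R ω 2 0)) (decide (S.R ω 0 1))
      (decide (S.R ω 6 4)) (decide (S.R ω 4 5)) (decide (S.R ω 2 6)) (decide (S.R ω 0 4)) (decide
      (S.R ω 1 5))) +
      excess (decide (S.R ω 2 6)) (c.vertical.look (decide (S.R ω 1 3)) (decide (S.R ω 0 1))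
      (decide (S.R ω 5 7)) (decide (S.R ω 4 5)) (decide (S.R ω 3 7)) (decide (S.R ω 1 5)) (decide
      (S.R ω 0 4)))) := by
    intro ω
    simp only [lhs, state, Nat.cast_add, Nat.cast_mul, cast_term, Table.look_le]
    unfold cyclePaths
    ring
  have hrhs : ∀ ω, (c.rhs (state S ω) : ℝ) = 3508200000 + c.debit +
      c.loss * (cyclePaths S 0 1 3 2 ω * cyclePaths S 4 5 7 6 ω) := by
    intro ω
    simp only [rhs, state, Nat.cast_add, Nat.cast_mul, Nat.cast_ofNat]
    unfold cyclePaths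
    ring
  simp only [hlhs, hrhs, FinProb.E_add, FinProb.E_mul_left, FinProb.E_const, hprod, h0, h1, h2, h3,
    h4, h5, h6, h7, h8, h9, h10, h11] at hle
  change _ ≤ _ + 90000000 * π.Pr (fun ω => Spanned (S.R ω)) at hle
  linarith

end ThreeCube

/-! ### Connectivity of the three-dimensional cube and the threshold -/

namespace ThreeCube

theorem le_pr_spanned {Ω : Type} [Fintype Ω] {π : FinProb Ω} (S : SiteBond π (Fin 8))
    (hp : ∀ u v, s(u, v) ∈ edges → π.Pr (fun ω => S.R ω u v) = 5847 / 10000) :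
    0.0485 ≤ π.Pr (fun ω => Spanned (S.R ω)) := by
  have hall := fun x => of_always certificates_hold x
  simp only [Bool.and_eq_true] at hall
  have h1 := Certificate.bound S (fun x => (hall x).1) hp
  have h2 := Certificate.bound S (fun x => (hall x).2.1) hp
  have h3 := Certificate.bound S (fun x => (hall x).2.2) hp
  have hs0 := π.E_nonneg (cyclePaths_nonneg S 0 1 3 2)
  have ht0 := π.E_nonneg (cyclePaths_nonneg S 4 5 7 6)
  have hs4 := π.E_le_const (cyclePaths_le S 0 1 3 2)
  have ht4 := π.E_le_const (cyclePaths_le S 4 5 7 6)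
  generalize π.E (cyclePaths S 0 1 3 2) = s at *
  generalize π.E (cyclePaths S 4 5 7 6) = t at *
  generalize π.Pr (fun ω => Spanned (S.R ω)) = q at *
  have hst : 4 * (s * t) ≤ (s + t) * (s + t) := by nlinarith [sq_nonneg (s - t)]
  simp only [lowCertificate, middleCertificate, highCertificate, Nat.cast_ofNat,
    Nat.cast_zero] at h1 h2 h3
  -- Since `4 * (s * t) ≤ (s + t) ^ 2`, each certificate bounds `q` below by a concave quadratic in
  -- `s + t`. On an interval this is least at an endpoint, and the product with the two endpoint
  -- factors expresses this. The three intervals cover `[0, 8]`.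
  rcases le_total (s + t) (263 / 100) with h | h
  · have := mul_nonneg (add_nonneg hs0 ht0) (sub_nonneg.2 h)
    linarith
  · rcases le_total (s + t) (282 / 100) with h' | h'
    · have := mul_nonneg (sub_nonneg.2 h) (sub_nonneg.2 h')
      linarith
    · have := mul_nonneg (sub_nonneg.2 h') (sub_nonneg.2 (by linarith : s + t ≤ 8))
      linarith

/-- The vertices of the cube in binary. -/
def vertex (v : Fin 8) : Fin 3 → Bool := fun i => v.val.testBit i

theorem vertex_injective : Function.Injective vertex := by
  unfold vertex
  decide

theorem vertex_surjective : Function.Surjective vertex := by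
  unfold vertex
  decide

theorem adj_vertex {u v : Fin 8} (h : s(u, v) ∈ edges) :
    (hypercube 3).Adj (vertex u) (vertex v) := by
  have : ∀ u v : Fin 8, s(u, v) ∈ edges →
      ∃ i, vertex u i ≠ vertex v i ∧ ∀ j, vertex u j ≠ vertex v j → j = i := by
    unfold vertex edges
    decide
  exact this u v h

theorem ne_of_mem_edges {u v : Fin 8} (h : s(u, v) ∈ edges) : u ≠ v := fun h' =>
  (adj_vertex h).ne (congrArg vertex h')

end ThreeCube

theorem le_measureReal_connectedEvent_three (μ : Measure (EdgeConfig (hypercube 3)))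
    (hμ : IsOneIndepModel (hypercube 3) 0.5847 μ) : 0.0485 ≤ μ.real (connectedEvent 3) := by
  have := hμ.isProbabilityMeasure
  have h1 := SiteBond.le_pr_of_exact (p := 5847 / 10000) (by norm_num) ThreeCube.edges
    (fun _ _ => ThreeCube.ne_of_mem_edges) ThreeCube.Spanned
    (fun ρ ρ' h hρ v => Relation.ReflTransGen.mono h _ _ (hρ v)) (fun Ω _ π S hS => ThreeCube.le_pr_spanned S hS)
    ((percolationField μ hμ).comap ThreeCube.vertex ThreeCube.vertex_injective) ?_
  · refine h1.trans ?_
    rw [FinProb.ofMeasure_Pr]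
    refine measureReal_mono fun ω hω => ?_
    have hreach : ∀ v : Fin 8, (openSubgraph (hypercube 3) ω).Reachable (ThreeCube.vertex 0)
        (ThreeCube.vertex v) := by
      intro v
      have h2 := hω v
      induction h2 with
      | refl => exact .refl _
      | tail _ h ih =>
        exact ih.trans (h.elim (fun h => h ▸ .refl _) fun h => h.reachable)
    refine (SimpleGraph.connected_iff_exists_forall_reachable _).2 ⟨ThreeCube.vertex 0, fun w => ?_⟩
    obtain ⟨v, rfl⟩ := ThreeCube.vertex_surjective w
    exact hreach v
  · intro u v huv
    have h2 := percolationField_not_le μ hμ (ThreeCube.adj_vertex huv)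
    rw [FinProb.Pr_not] at h2
    simp only [SiteBond.comap_R]
    norm_num at h2 ⊢
    linarith

/-- The numbers fit narrowly: `(1 - 0.5847) ^ 4 * 1.62 < 0.0482`, below the bound `0.0485` for
connectivity. -/
theorem mem_giantSet : (0.5847 : ℝ) ∈ giantSet := by
  have hφ : Real.goldenRatio < 1.62 := by
    have h1 : √5 < 2.24 := (Real.sqrt_lt' (by norm_num)).2 (by norm_num)
    rw [Real.goldenRatio]
    linarith
  obtain ⟨C, hC, c, hc, h⟩ := giant_component_of_connected 0.5847 3 0.0485 (by norm_num)
    (by norm_num) (by norm_num; linarith) le_measureReal_connectedEvent_three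
  refine ⟨by norm_num, C, hC, ?_⟩
  have hlim : Tendsto (fun n : ℕ => 1 - Real.exp (-(c * (n : ℝ) ^ 2))) atTop (𝓝 1) := by
    have h1 : Tendsto (fun n : ℕ => c * (n : ℝ) ^ 2) atTop atTop :=
      ((tendsto_pow_atTop two_ne_zero).comp tendsto_natCast_atTop_atTop).const_mul_atTop hc
    simpa using (Real.tendsto_exp_neg_atTop_nhds_zero.comp h1).const_sub 1
  -- Needed because a real infimum over an empty family is `0` by convention.
  have hne : ∀ n, Nonempty {μ : Measure (EdgeConfig (hypercube n)) //
      IsOneIndepModel (hypercube n) 0.5847 μ} := fun n =>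
    ⟨⟨_, isOneIndepModel_dirac (by norm_num)⟩⟩
  refine tendsto_of_tendsto_of_tendsto_of_le_of_le hlim tendsto_const_nhds (fun n => ?_) fun n => ?_
  · have := hne n
    exact le_ciInf fun μ => h n μ.1 μ.2
  · obtain ⟨μ⟩ := hne n
    have := μ.2.isProbabilityMeasure
    exact (ciInf_le ⟨0, by rintro _ ⟨ν, rfl⟩; exact measureReal_nonneg⟩ μ).trans measureReal_le_one

theorem pGiant_le : pGiant ≤ 0.5847 :=
  csInf_le ⟨0, fun _ h => h.1.1⟩ mem_giantSet

end

theorem theorem1p6 :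
    (∀ (p : ℝ) (k : ℕ) (P : ℝ), 0 < p → p ≤ 1 → 1 ≤ k →
      (1 - p) ^ (2 ^ (k - 1)) * Real.goldenRatio < P →
      (∀ μ : Measure (EdgeConfig (hypercube k)), IsOneIndepModel (hypercube k) p μ →
        P ≤ μ.real (connectedEvent k)) →
      ∃ C : ℝ, 0 < C ∧ ∃ c : ℝ, 0 < c ∧
        ∀ (n : ℕ) (μ : Measure (EdgeConfig (hypercube n))), IsOneIndepModel (hypercube n) p μ →
          1 - Real.exp (-(c * (n : ℝ) ^ 2)) ≤ μ.real (giantEvent n C)) ∧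
    (giantSet.Nonempty ∧ pGiant ≤ 0.5847) := by
  refine ⟨fun p k P _ hp1 hk hlt hP => giant_component_of_connected p k P hp1 hk hlt hP, ?_⟩
  exact ⟨⟨_, mem_giantSet⟩, pGiant_le⟩
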